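/- Let $n\ge 1$ and let $C\subset\mathbb R^n$ be a convex body (a compact convex set with non-empty interior) with the origin in its interior and with boundary of class $C^{1,1}$. For a convex body $K$ and a boundary point $x$ at which the outer unit normal $n_K(x)$ is unique and $\partial K$ is twice differentiable (near $x$, $\partial K=\{x+v-f(v)\,n_K(x)\}$ with $v\in n_K(x)^\perp$ and $f(v)=\frac12 Av\cdot v+o(\|v\|^2)$, $A$ symmetric), let $H_{n-1}(K,x)=\det A$ be the Gauss–Kronecker curvature; for convex bodies almost all boundary points are of this kind. Integrals over boundaries are with respect to $(n-1)$-dimensional Hausdorff measure. The centro-affine surface area of $C$ is $$\Omega_n(C)=\int_{\partial C}\frac{H_{n-1}(C,x)^{1/2}}{(x\cdot n_C(x))^{(n-1)/2}}\,dx .$$ For $x\in\operatorname{int}C$ let $\|v\|_x=\frac12\big(\frac1{t^+}+\frac1{t^-}\big)$, where $t^\pm>0$ and $x\pm t^\pm v\in\partial C$ (and $\|0\|_x=0$), be the norm of the Hilbert geometry on $\operatorname{int}C$, let $I^C_x=\{v:\|v\|_x\le1\}$, let $\lambda_n$ be Lebesgue measure and $v_n$ the volume of the Euclidean unit ball. For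 a volume density $\sigma_C$ on $\operatorname{int}C$ and a convex body $K\subset\operatorname{int}C$, the floating area is $$\Omega_C(K)=\int_{\partial K}H_{n-1}(K,x)^{\frac1{n+1}}\,\sigma_C(x)^{\frac{n-1}{n+1}}\,dx .$$ **Theorem.** The integral $\Omega_n(C)$ and the integrals $\Omega_C(\lambda C)$, $0<\lambda<1$, converge, and $$\Omega_n(C)=2^{\frac{n-1}2}\lim_{\lambda\to1-}\Omega_C(\lambda C)\,(1-\lambda)^{\frac{n-1}2}$$ in each of the following cases: 1. $\sigma_C(x)=v_n/\lambda_n(I^C_x)$, the density of the Busemann volume; 2. $\sigma_C(x)=\lambda_n\big((I^C_x)^*\big)/v_n$, the density of the Holmes–Thompson volume, where $K^*=\{y: x\cdot y\le1\text{ for all }x\in K\}$ is the polar body; 3. $\sigma_C$ is the density of $\operatorname{vol}_C$ for any notion of volume $C'\mapsto\operatorname{vol}_{C'}$, defined for all convex bodies $C'\subset\mathbb R^n$, such that (a) $\operatorname{vol}_{C'}$ is a Borel measure on $\operatorname{int}C'$ that has a continuous non-negative density $\sigma_{C'}$ with respect to Lebesgue measure; (b) it is projectively invariant: $\operatorname{vol}_{P(C')}(P(A))=\operatorname{vol}_{C'}(A)$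 for Borel sets $A\subset\operatorname{int}C'$ and every projective transformation $P$ that is finite on $C'$; (c) if $C'\subset C''$ and $A\subset\operatorname{int}C'$ is Borel, then $\operatorname{vol}_{C'}(A)\ge\operatorname{vol}_{C''}(A)$; (d) if $C'$ is an ellipsoid, then $\operatorname{vol}_{C'}$ is the hyperbolic volume, that is, it corresponds under an affine map of the unit ball onto $C'$ to the measure with density $(1-\|x\|^2)^{-(n+1)/2}$ on the open unit ball. -/

import Mathlib

open MeasureTheory Filter Topology Set
open scoped Pointwise NNReal ENNReal RealInnerProductSpace

/-- A convex body: a compact convex set with non-empty interior. -/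
structure IsConvexBody {n : ℕ} (C : Set (EuclideanSpace ℝ (Fin n))) : Prop where
  convex : Convex ℝ C
  isCompact : IsCompact C
  interior_nonempty : (interior C).Nonempty

/-- The boundary of `C` is of class `C^{1,1}`: near each boundary point, `C` is the sublevel set
`{g ≤ 0}` of a differentiable function `g` with Lipschitz derivative that does not vanish at that
point. -/
def HasC11Boundary {n : ℕ} (C : Set (EuclideanSpace ℝ (Fin n))) : Prop :=
  ∀ x ∈ frontier C, ∃ (U : Set (EuclideanSpace ℝ (Fin n)))
    (g : EuclideanSpace ℝ (Fin n) → ℝ) (L : ℝ≥0),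
    IsOpen U ∧ x ∈ U ∧ DifferentiableOn ℝ g U ∧ LipschitzOnWith L (fderiv ℝ g) U ∧
      fderiv ℝ g x ≠ 0 ∧ C ∩ U = {y ∈ U | g y ≤ 0}

/-- `u` is an outer unit normal vector of `K` at `x`. -/
def IsOuterUnitNormal {n : ℕ} (K : Set (EuclideanSpace ℝ (Fin n)))
    (x u : EuclideanSpace ℝ (Fin n)) : Prop :=
  ‖u‖ = 1 ∧ ∀ y ∈ K, ⟪y - x, u⟫ ≤ 0

open Classical in
/-- The outer unit normal `n_K(x)` at a regular boundary point `x`, that is, a boundary point with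
exactly one outer unit normal (and `0` if `x` is not regular). -/
noncomputable def outerNormal {n : ℕ} (K : Set (EuclideanSpace ℝ (Fin n)))
    (x : EuclideanSpace ℝ (Fin n)) : EuclideanSpace ℝ (Fin n) :=
  if h : ∃! u, IsOuterUnitNormal K x u then h.choose else 0

/-- The function `f` on the hyperplane `u^⊥` whose graph represents `∂K` near the boundary point
`x` with outer normal `u`: the boundary points of `K` near `x` are `x + v - f(v) u`. -/
noncomputable def boundaryGraph {n : ℕ} (K : Set (EuclideanSpace ℝ (Fin n)))
    (x u : EuclideanSpace ℝ (Fin n)) (v : (ℝ ∙ u)ᗮ) : ℝ :=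
  sInf {t : ℝ | x + (v : EuclideanSpace ℝ (Fin n)) - t • u ∈ K}

/-- `A` is the (symmetric) second derivative at `0` of the graph function at `x`, that is,
`f(v) = ½ ⟨A v, v⟩ + o(‖v‖²)` as `v → 0`. (The terms of order zero and one vanish, as `f ≥ 0`
and `f(0) = 0`.) -/
def IsSecondFundamentalForm {n : ℕ} (K : Set (EuclideanSpace ℝ (Fin n)))
    (x u : EuclideanSpace ℝ (Fin n)) (A : (ℝ ∙ u)ᗮ →ₗ[ℝ] (ℝ ∙ u)ᗮ) : Prop :=
  A.IsSymmetric ∧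
    (fun v : (ℝ ∙ u)ᗮ => boundaryGraph K x u v - (1 / 2) * ⟪A v, v⟫)
      =o[𝓝 0] (fun v : (ℝ ∙ u)ᗮ => ‖v‖ ^ 2)

open Classical in
/-- The (generalized) Gauss-Kronecker curvature `H_{n-1}(K, x) = det A` at a normal boundary point
`x` (and `0` where the second derivative does not exist). -/
noncomputable def gaussKroneckerCurvature {n : ℕ} (K : Set (EuclideanSpace ℝ (Fin n)))
    (x : EuclideanSpace ℝ (Fin n)) : ℝ :=
  if h : ∃ A, IsSecondFundamentalForm K x (outerNormal K x) A then LinearMap.det h.choose else 0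

/-- The integrand of the centro-affine surface area. -/
noncomputable def centroAffineIntegrand {n : ℕ} (C : Set (EuclideanSpace ℝ (Fin n)))
    (x : EuclideanSpace ℝ (Fin n)) : ℝ :=
  gaussKroneckerCurvature C x ^ ((1 : ℝ) / 2) / ⟪x, outerNormal C x⟫ ^ (((n : ℝ) - 1) / 2)

/-- The centro-affine surface area `Ω_n(C)`. -/
noncomputable def centroAffineSurfaceArea {n : ℕ} (C : Set (EuclideanSpace ℝ (Fin n))) : ℝ :=
  ∫ x in frontier C, centroAffineIntegrand C x
    ∂(Measure.euclideanHausdorffMeasure (n - 1) : Measure (EuclideanSpace ℝ (Fin n)))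

/-- The integrand of the floating area of `K` for the volume density `σ`. -/
noncomputable def floatingIntegrand {n : ℕ} (σ : EuclideanSpace ℝ (Fin n) → ℝ)
    (K : Set (EuclideanSpace ℝ (Fin n))) (x : EuclideanSpace ℝ (Fin n)) : ℝ :=
  gaussKroneckerCurvature K x ^ (1 / ((n : ℝ) + 1)) * σ x ^ (((n : ℝ) - 1) / ((n : ℝ) + 1))

/-- The floating area `Ω_C(K)`, where `σ = σ_C` is the volume density of the Hilbert geometry on
the interior of `C`. -/
noncomputable def floatingArea {n : ℕ} (σ : EuclideanSpace ℝ (Fin n) → ℝ)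
    (K : Set (EuclideanSpace ℝ (Fin n))) : ℝ :=
  ∫ x in frontier K, floatingIntegrand σ K x
    ∂(Measure.euclideanHausdorffMeasure (n - 1) : Measure (EuclideanSpace ℝ (Fin n)))

/-- The norm `‖v‖_x = ½ (1 / t⁺ + 1 / t⁻)`, where `x ± t^± v ∈ ∂C`, of the Hilbert geometry on the
interior of `C`; note that `1 / t⁺` is the gauge of `C - x` at `v`. -/
noncomputable def hilbertNorm {n : ℕ} (C : Set (EuclideanSpace ℝ (Fin n)))
    (x v : EuclideanSpace ℝ (Fin n)) : ℝ :=
  (1 / 2) * (gauge (-x +ᵥ C) v + gauge (-x +ᵥ C) (-v))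

theorem hilbertNorm_eq {n : ℕ} {C : Set (EuclideanSpace ℝ (Fin n))} (hC : IsConvexBody C)
    {x v : EuclideanSpace ℝ (Fin n)} (hx : x ∈ interior C) {s t : ℝ} (hs : 0 < s) (ht : 0 < t)
    (hxs : x + s • v ∈ frontier C) (hxt : x - t • v ∈ frontier C) :
    hilbertNorm C x v = (1 / 2) * (1 / s + 1 / t) := by
  have key : ∀ (r : ℝ) (w : EuclideanSpace ℝ (Fin n)), 0 < r → x + r • w ∈ frontier C →
      gauge (-x +ᵥ C) w = 1 / r := by
    intro r w hr hw
    have hconv : Convex ℝ (-x +ᵥ C) := hC.convex.vadd (-x)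
    have h0 : (-x +ᵥ C) ∈ 𝓝 (0 : EuclideanSpace ℝ (Fin n)) := by
      have := (vadd_mem_nhds_vadd_iff (-x)).2 (mem_interior_iff_mem_nhds.1 hx)
      simpa using this
    have hfr : r • w ∈ frontier (-x +ᵥ C) := by
      have h1 : -x +ᵥ frontier C = frontier (-x +ᵥ C) :=
        (Homeomorph.vadd (-x) : EuclideanSpace ℝ (Fin n) ≃ₜ _).image_frontier C
      rw [← h1]
      exact ⟨x + r • w, hw, by simp⟩
    have h1 := (gauge_eq_one_iff_mem_frontier hconv h0).2 hfr
    rw [gauge_smul_of_nonneg hr.le, smul_eq_mul] at h1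
    field_simp
    linarith
  rw [hilbertNorm, key s v hs hxs, key t (-v) ht (by simpa [sub_eq_add_neg] using hxt)]

/-- The unit ball `I^C_x` of the norm `‖·‖_x`. -/
def hilbertUnitBall {n : ℕ} (C : Set (EuclideanSpace ℝ (Fin n)))
    (x : EuclideanSpace ℝ (Fin n)) : Set (EuclideanSpace ℝ (Fin n)) :=
  {v | hilbertNorm C x v ≤ 1}

/-- The polar body `K^*`. -/
def polarBody {n : ℕ} (K : Set (EuclideanSpace ℝ (Fin n))) : Set (EuclideanSpace ℝ (Fin n)) :=
  {y | ∀ x ∈ K, ⟪x, y⟫ ≤ 1}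

/-- The density `v_n / λ_n(I^C_x)` of the Busemann volume. -/
noncomputable def busemannDensity {n : ℕ} (C : Set (EuclideanSpace ℝ (Fin n)))
    (x : EuclideanSpace ℝ (Fin n)) : ℝ :=
  volume.real (Metric.closedBall (0 : EuclideanSpace ℝ (Fin n)) 1) /
    volume.real (hilbertUnitBall C x)

/-- The density `λ_n((I^C_x)^*) / v_n` of the Holmes-Thompson volume. -/
noncomputable def holmesThompsonDensity {n : ℕ} (C : Set (EuclideanSpace ℝ (Fin n)))
    (x : EuclideanSpace ℝ (Fin n)) : ℝ :=
  volume.real (polarBody (hilbertUnitBall C x)) /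
    volume.real (Metric.closedBall (0 : EuclideanSpace ℝ (Fin n)) 1)

/-- The projective map of `ℝⁿ` induced by the linear isomorphism `M` of `ℝⁿ × ℝ`, where `x ∈ ℝⁿ`
has the homogeneous coordinates `(x, 1)`; meaningful where the last coordinate of `M (x, 1)` is
not zero. -/
noncomputable def projectiveMap {n : ℕ}
    (M : (EuclideanSpace ℝ (Fin n) × ℝ) ≃ₗ[ℝ] (EuclideanSpace ℝ (Fin n) × ℝ))
    (x : EuclideanSpace ℝ (Fin n)) : EuclideanSpace ℝ (Fin n) :=
  (M (x, 1)).2⁻¹ • (M (x, 1)).1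

/-- The density of the hyperbolic volume in the projective (Beltrami-Cayley-Klein) model, the open
unit ball. -/
noncomputable def hyperbolicDensity {n : ℕ} (x : EuclideanSpace ℝ (Fin n)) : ℝ :=
  (1 - ‖x‖ ^ 2) ^ (-(((n : ℝ) + 1) / 2))

/-- `C ↦ vol C`, with densities `C ↦ σ C`, is a notion of volume for Hilbert geometries in `ℝⁿ`:
each `vol C` is a measure on the interior of `C` with a continuous density `σ C` with respect to
Lebesgue measure, the notion is projectively invariant, `vol C` decreases when `C` increases, and
`vol C` is the hyperbolic volume if `C` is an ellipsoid (an affine image of the unit ball). -/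
structure IsHilbertVolume {n : ℕ}
    (vol : Set (EuclideanSpace ℝ (Fin n)) → Measure (EuclideanSpace ℝ (Fin n)))
    (σ : Set (EuclideanSpace ℝ (Fin n)) → EuclideanSpace ℝ (Fin n) → ℝ) : Prop where
  density_nonneg : ∀ C, IsConvexBody C → ∀ x ∈ interior C, 0 ≤ σ C x
  density_continuousOn : ∀ C, IsConvexBody C → ContinuousOn (σ C) (interior C)
  vol_eq : ∀ C, IsConvexBody C → ∀ A, MeasurableSet A → A ⊆ interior C →
    vol C A = ∫⁻ x in A, ENNReal.ofReal (σ C x)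
  projective_invariant : ∀ C, IsConvexBody C →
    ∀ M : (EuclideanSpace ℝ (Fin n) × ℝ) ≃ₗ[ℝ] (EuclideanSpace ℝ (Fin n) × ℝ),
    (∀ x ∈ C, (M (x, 1)).2 ≠ 0) → ∀ A, MeasurableSet A → A ⊆ interior C →
    vol (projectiveMap M '' C) (projectiveMap M '' A) = vol C A
  antitone : ∀ C C', IsConvexBody C → IsConvexBody C' → C ⊆ C' →
    ∀ A, MeasurableSet A → A ⊆ interior C → vol C' A ≤ vol C A
  ellipsoid : ∀ T : EuclideanSpace ℝ (Fin n) ≃ᵃ[ℝ] EuclideanSpace ℝ (Fin n),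
    ∀ A, MeasurableSet A → A ⊆ Metric.ball 0 1 →
    vol (T '' Metric.closedBall 0 1) (T '' A) =
      ∫⁻ x in A, ENNReal.ofReal (hyperbolicDensity x)

/-- The volume density `σ` on the interior of `C` recovers the centro-affine surface area: the
floating areas `Ω_C(rC)`, `0 < r < 1`, are given by convergent integrals, and
`2^((n-1)/2) Ω_C(rC) (1-r)^((n-1)/2) → Ω_n(C)` as `r → 1-`. -/
def FloatingAreaLimit {n : ℕ} (C : Set (EuclideanSpace ℝ (Fin n)))
    (σ : EuclideanSpace ℝ (Fin n) → ℝ) : Prop :=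
  (∀ r : ℝ, 0 < r → r < 1 → IntegrableOn (floatingIntegrand σ (r • C)) (frontier (r • C))
    (Measure.euclideanHausdorffMeasure (n - 1) : Measure (EuclideanSpace ℝ (Fin n)))) ∧
  Tendsto
    (fun r : ℝ => (2 : ℝ) ^ (((n : ℝ) - 1) / 2) *
      (floatingArea σ (r • C) * (1 - r) ^ (((n : ℝ) - 1) / 2)))
    (𝓝[<] 1) (𝓝 (centroAffineSurfaceArea C))

-- All three cases rest on four properties of a density: it is non-negative, it decreases when the
-- body grows, it transforms under projective maps by the Jacobian, and on the unit ball it is the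
-- hyperbolic density (`IsCovariantDensity`). For the Busemann and Holmes-Thompson densities these
-- come from the projective invariance of the Hilbert norm (`hilbertNorm_projective`) and from its
-- explicit form on the ball; for an abstract notion of volume they come from comparing continuous
-- densities on small balls.
--
-- These properties determine the density asymptotically at the boundary. In coordinates `x = y + v
-- - t u` at a boundary point `y` with normal `u`, the ellipsoid `q ≥ 0`, where `q = 2t - ⟨Bv, v⟩ -
-- t² / s`, has density exactly `√(det B) q^(-(n+1)/2)`, and `q(ry) ~ 2⟨u, y⟩(1 - r)`. Let `A` be
-- the second fundamental form of `C` at `y`. For `B = A + ε` and small `s` the ellipsoid lies in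
-- `C`, which bounds the density of `C` from above. For `B = A - ε` positive definite, `C` lies in
-- the region `⟨Bv, v⟩ ≤ 2t + k t²`; a projective map that fixes `y` and has derivative the identity
-- there carries this region into an ellipsoid, which gives the lower bound. With `ε → 0`, `σ_C(ry)
-- (1 - r)^((n+1)/2) → √H (2⟨u, y⟩)^(-(n+1)/2)` (`tendsto_density_mul`). If `H = 0`, the lower bound
-- is trivial.
--
-- Raised to the power `(n-1)/(n+1)` and multiplied by `H^(1/(n+1))`, this limit is the
-- centro-affine integrand up to the factor `2^((n-1)/2)`. The integrals are then compared by
-- dominated convergence on `∂C`. The `C^{1,1}` hypothesis enters through a ball of fixed radius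
-- that rolls freely inside `C`: it bounds the rescaled density uniformly, hence also the curvature,
-- and makes the normal unique and continuous. Boundary points without second fundamental form have
-- curvature `0` by definition, so both integrands vanish there and almost everywhere
-- differentiability is not needed.

local notation "𝔼" n => EuclideanSpace ℝ (Fin n)
variable {n : ℕ}

/-! ### Projective maps -/

/-- The last homogeneous coordinate of `M (x, 1)`. -/
noncomputable def projectiveDenom (M : ((𝔼 n) × ℝ) ≃ₗ[ℝ] ((𝔼 n) × ℝ)) (x : 𝔼 n) : ℝ :=
  (M (x, 1)).2

/-- The derivative at `x` of the projective map induced by `M`. -/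
noncomputable def projectiveDeriv (M : ((𝔼 n) × ℝ) ≃ₗ[ℝ] ((𝔼 n) × ℝ)) (x : 𝔼 n) :
    (𝔼 n) →ₗ[ℝ] (𝔼 n) where
  toFun v := (projectiveDenom M x)⁻¹ • ((M (v, 0)).1 - (M (v, 0)).2 • projectiveMap M x)
  map_add' v w := by
    have : M (v + w, 0) = M (v, 0) + M (w, 0) := by rw [← map_add]; simp
    rw [this]
    simp only [Prod.fst_add, Prod.snd_add]
    module
  map_smul' c v := by
    have : M (c • v, 0) = c • M (v, 0) := by rw [← map_smul]; simp
    rw [this]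
    simp only [Prod.smul_fst, Prod.smul_snd, RingHom.id_apply, smul_eq_mul]
    module

theorem projectiveDeriv_apply (M : ((𝔼 n) × ℝ) ≃ₗ[ℝ] ((𝔼 n) × ℝ)) (x v : 𝔼 n) :
    projectiveDeriv M x v =
      (projectiveDenom M x)⁻¹ • ((M (v, 0)).1 - (M (v, 0)).2 • projectiveMap M x) := rfl

theorem apply_one_eq_smul {M : ((𝔼 n) × ℝ) ≃ₗ[ℝ] ((𝔼 n) × ℝ)} {x : 𝔼 n}
    (h : projectiveDenom M x ≠ 0) :
    M (x, 1) = projectiveDenom M x • (projectiveMap M x, 1) := by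
  ext1
  · simp only [projectiveMap, Prod.smul_mk]
    rw [← projectiveDenom, smul_inv_smul₀ h]
  · simp [projectiveDenom]

theorem projectiveMap_eq_of_apply_eq {M : ((𝔼 n) × ℝ) ≃ₗ[ℝ] ((𝔼 n) × ℝ)} {x y : 𝔼 n} {c : ℝ}
    (hc : c ≠ 0) (h : M (x, 1) = c • (y, 1)) : projectiveDenom M x = c ∧ projectiveMap M x = y := by
  have h2 : projectiveDenom M x = c := by simp [projectiveDenom, h]
  refine ⟨h2, ?_⟩
  rw [projectiveMap, ← projectiveDenom, h2, h]
  simp [inv_smul_smul₀ hc]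

theorem apply_zero_eq {M : ((𝔼 n) × ℝ) ≃ₗ[ℝ] ((𝔼 n) × ℝ)} {x : 𝔼 n}
    (h : projectiveDenom M x ≠ 0) (v : 𝔼 n) :
    M (v, 0) = projectiveDenom M x • (projectiveDeriv M x v, 0) +
      (M (v, 0)).2 • (projectiveMap M x, 1) := by
  ext1
  · simp only [projectiveDeriv_apply, Prod.smul_mk, Prod.mk_add_mk, smul_inv_smul₀ h]
    module
  · simp

theorem projectiveDenom_add_smul (M : ((𝔼 n) × ℝ) ≃ₗ[ℝ] ((𝔼 n) × ℝ)) (x v : 𝔼 n) (t : ℝ) :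
    projectiveDenom M (x + t • v) = projectiveDenom M x + t * (M (v, 0)).2 := by
  have : ((x + t • v, 1) : (𝔼 n) × ℝ) = (x, 1) + t • (v, 0) := by simp
  rw [projectiveDenom, this, map_add, map_smul]
  rfl

/-- Lines go to lines, with a fractional linear change of parameter. This is the source of the
additive change of the gauge in `gauge_projective`. -/
theorem projectiveMap_add_smul {M : ((𝔼 n) × ℝ) ≃ₗ[ℝ] ((𝔼 n) × ℝ)} {x v : 𝔼 n} {t : ℝ}
    (hx : projectiveDenom M x ≠ 0) (hxv : projectiveDenom M (x + t • v) ≠ 0) :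
    projectiveMap M (x + t • v) = projectiveMap M x +
      (t * projectiveDenom M x / projectiveDenom M (x + t • v)) • projectiveDeriv M x v := by
  refine (projectiveMap_eq_of_apply_eq hxv ?_).2
  have : ((x + t • v, 1) : (𝔼 n) × ℝ) = (x, 1) + t • (v, 0) := by simp
  rw [this, map_add, map_smul, apply_zero_eq hx, apply_one_eq_smul hx]
  have h2 := projectiveDenom_add_smul M x v t
  ext1
  · simp only [Prod.smul_mk, Prod.mk_add_mk, smul_add, smul_smul]
    rw [mul_div_cancel₀ _ hxv, h2]
    module
  · simp [h2]

theorem projectiveMap_injOn (M : ((𝔼 n) × ℝ) ≃ₗ[ℝ] ((𝔼 n) × ℝ)) {s : Set (𝔼 n)}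
    (h : ∀ x ∈ s, projectiveDenom M x ≠ 0) : InjOn (projectiveMap M) s := by
  intro x hx y hy hxy
  have h1 := apply_one_eq_smul (h x hx)
  have h2 := apply_one_eq_smul (h y hy)
  rw [← hxy] at h2
  have h3 : M ((projectiveDenom M x)⁻¹ • (x, 1)) = M ((projectiveDenom M y)⁻¹ • (y, 1)) := by
    rw [map_smul, map_smul, h1, h2, inv_smul_smul₀ (h x hx), inv_smul_smul₀ (h y hy)]
  have h4 := M.injective h3
  have h5 : (projectiveDenom M x)⁻¹ = (projectiveDenom M y)⁻¹ := by simpa using congrArg Prod.snd h4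
  have h6 := congrArg Prod.fst h4
  simp only [Prod.smul_mk] at h6
  rw [h5] at h6
  exact smul_right_injective _ (inv_ne_zero (h y hy)) h6

/-- For `v` in the kernel, `M (v, 0)` is a multiple of `M (x, 1)`, so `(v, 0)` is a multiple of `(x,
1)`; the last coordinate makes the multiple zero. -/
theorem projectiveDeriv_det_ne_zero {M : ((𝔼 n) × ℝ) ≃ₗ[ℝ] ((𝔼 n) × ℝ)} {x : 𝔼 n}
    (h : projectiveDenom M x ≠ 0) : LinearMap.det (projectiveDeriv M x) ≠ 0 := by
  rw [← isUnit_iff_ne_zero, ← LinearMap.isUnit_iff_isUnit_det, LinearMap.isUnit_iff_ker_eq_bot,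
    LinearMap.ker_eq_bot']
  intro v hv
  have h1 := apply_zero_eq h v
  have h2 := apply_one_eq_smul h
  rw [hv] at h1
  have h3 : M (v, 0) = M (((M (v, 0)).2 * (projectiveDenom M x)⁻¹) • (x, 1)) := by
    rw [map_smul, h2, smul_smul, inv_mul_cancel_right₀ h]
    nth_rewrite 1 [h1]
    simp
  have h4 := M.injective h3
  simp only [Prod.smul_mk, smul_eq_mul, mul_one] at h4
  have h5 := congrArg Prod.snd h4
  have h6 := congrArg Prod.fst h4
  simp only at h5 h6
  rw [← h5] at h6
  simpa using h6

theorem projectiveMap_hasStrictFDerivAt {M : ((𝔼 n) × ℝ) ≃ₗ[ℝ] ((𝔼 n) × ℝ)} {x : 𝔼 n}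
    (h : projectiveDenom M x ≠ 0) :
    HasStrictFDerivAt (projectiveMap M) (LinearMap.toContinuousLinearMap (projectiveDeriv M x)) x := by
  let L : ((𝔼 n) × ℝ) →L[ℝ] ((𝔼 n) × ℝ) := LinearMap.toContinuousLinearMap M.toLinearMap
  have h1 : HasStrictFDerivAt (fun y : 𝔼 n => L (y, 1))
      (L.comp (ContinuousLinearMap.inl ℝ (𝔼 n) ℝ)) x :=
    L.hasStrictFDerivAt.comp x ((hasStrictFDerivAt_id x).prodMk (hasStrictFDerivAt_const (1:ℝ) x))
  have h2 := h1.fst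
  have h3 := h1.snd
  have h4 := (hasStrictDerivAt_inv (x := (L (x, 1)).2) h).comp_hasStrictFDerivAt x h3
  have h5 := h4.fun_smul h2
  refine h5.congr_fderiv ?_
  ext1 v
  have e : L (x, 1) = M (x, 1) := rfl
  have e2 : L (v, 0) = M (v, 0) := rfl
  simp only [projectiveDeriv_apply, projectiveMap, LinearMap.coe_toContinuousLinearMap',
    _root_.add_apply, _root_.smul_apply, ContinuousLinearMap.smulRight_apply,
    ContinuousLinearMap.comp_apply, ContinuousLinearMap.inl_apply, e, e2, projectiveDenom,
    ContinuousLinearMap.coe_fst', ContinuousLinearMap.coe_snd', Function.comp_apply, smul_eq_mul]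
  have h' : (M (x, 1)).2 ≠ 0 := h
  rw [pow_two, mul_inv]
  module

theorem continuous_projectiveDenom (M : ((𝔼 n) × ℝ) ≃ₗ[ℝ] ((𝔼 n) × ℝ)) :
    Continuous (projectiveDenom M) := by
  have := LinearMap.continuous_of_finiteDimensional M.toLinearMap
  unfold projectiveDenom
  exact continuous_snd.comp (this.comp (by fun_prop))

theorem projectiveMap_image_mem_nhds {M : ((𝔼 n) × ℝ) ≃ₗ[ℝ] ((𝔼 n) × ℝ)} {x : 𝔼 n}
    (h : projectiveDenom M x ≠ 0) {s : Set (𝔼 n)} (hs : s ∈ 𝓝 x) :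
    projectiveMap M '' s ∈ 𝓝 (projectiveMap M x) := by
  have h1 := (projectiveMap_hasStrictFDerivAt h).map_nhds_eq_of_surj (by
    have := projectiveDeriv_det_ne_zero h
    rw [← isUnit_iff_ne_zero, ← LinearMap.isUnit_iff_isUnit_det,
      LinearMap.isUnit_iff_range_eq_top] at this
    simpa using this)
  rw [← h1]
  exact image_mem_map hs

theorem projectiveMap_mem_interior {M : ((𝔼 n) × ℝ) ≃ₗ[ℝ] ((𝔼 n) × ℝ)} {x : 𝔼 n} {C : Set (𝔼 n)}
    (h : projectiveDenom M x ≠ 0) (hx : x ∈ interior C) :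
    projectiveMap M x ∈ interior (projectiveMap M '' C) :=
  mem_interior_iff_mem_nhds.2 (projectiveMap_image_mem_nhds h (mem_interior_iff_mem_nhds.1 hx))

theorem IsConvexBody.projectiveMap_image {C : Set (𝔼 n)} (hC : IsConvexBody C)
    {M : ((𝔼 n) × ℝ) ≃ₗ[ℝ] ((𝔼 n) × ℝ)} (h : ∀ x ∈ C, 0 < projectiveDenom M x) :
    IsConvexBody (projectiveMap M '' C) where
  convex := by
    rintro _ ⟨x, hx, rfl⟩ _ ⟨y, hy, rfl⟩ a b ha hb hab
    have hwx := h x hx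
    have hwy := h y hy
    -- Weights divided by the denominators: `M` maps `p (x, 1) + q (y, 1)` to `a (Px, 1) + b (Py,
    -- 1)`, so the normalized combination of `x` and `y` is a preimage of the required point.
    set p := a / projectiveDenom M x with hp
    set q := b / projectiveDenom M y with hq
    have hp0 : 0 ≤ p := by positivity
    have hq0 : 0 ≤ q := by positivity
    have hpq : 0 < p + q := by
      rcases ha.lt_or_eq with ha | ha
      · have : 0 < p := by positivity
        linarith
      · have : 0 < q := by
          have : 0 < b := by linarith
          positivity
        linarith
    have hz : (p / (p + q)) • x + (q / (p + q)) • y ∈ C :=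
      hC.convex hx hy (by positivity) (by positivity) (by field_simp)
    refine ⟨_, hz, (projectiveMap_eq_of_apply_eq (inv_ne_zero hpq.ne') ?_).2⟩
    have e : (((p / (p + q)) • x + (q / (p + q)) • y, 1) : (𝔼 n) × ℝ) =
        (p + q)⁻¹ • (p • (x, 1) + q • (y, 1)) := by
      ext1
      · simp only [Prod.smul_mk, Prod.mk_add_mk, smul_add, smul_smul]
        congr 2 <;> ring
      · simp; field_simp
    rw [e, map_smul, map_add, map_smul, map_smul, apply_one_eq_smul hwx.ne',
      apply_one_eq_smul hwy.ne', smul_smul, smul_smul, hp, hq, div_mul_cancel₀ _ hwx.ne',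
      div_mul_cancel₀ _ hwy.ne']
    congr 1
    simp [hab]
  isCompact := hC.isCompact.image_of_continuousOn fun x hx =>
    (projectiveMap_hasStrictFDerivAt (h x hx).ne').continuousAt.continuousWithinAt
  interior_nonempty := by
    obtain ⟨x, hx⟩ := hC.interior_nonempty
    exact ⟨_, projectiveMap_mem_interior (h x (interior_subset hx)).ne' hx⟩

/-! ### Covariant densities -/

/-- A projectively covariant and monotone choice of a volume density on the interior of each convex
body, which is the hyperbolic density on the unit ball. -/
structure IsCovariantDensity (σ : Set (𝔼 n) → (𝔼 n) → ℝ) : Prop where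
  nonneg : ∀ C, IsConvexBody C → ∀ x ∈ interior C, 0 ≤ σ C x
  antitone : ∀ C C', IsConvexBody C → IsConvexBody C' → C ⊆ C' → ∀ x ∈ interior C, σ C' x ≤ σ C x
  covariant : ∀ C, IsConvexBody C → ∀ M : ((𝔼 n) × ℝ) ≃ₗ[ℝ] ((𝔼 n) × ℝ),
    (∀ x ∈ C, 0 < projectiveDenom M x) → ∀ x ∈ interior C,
    |LinearMap.det (projectiveDeriv M x)| * σ (projectiveMap M '' C) (projectiveMap M x) = σ C x
  ball : ∀ x ∈ Metric.ball (0 : 𝔼 n) 1, σ (Metric.closedBall 0 1) x = hyperbolicDensity x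

theorem isConvexBody_closedBall (c : 𝔼 n) {r : ℝ} (hr : 0 < r) :
    IsConvexBody (Metric.closedBall c r) where
  convex := convex_closedBall c r
  isCompact := isCompact_closedBall c r
  interior_nonempty := by
    rw [interior_closedBall c hr.ne']
    exact ⟨c, Metric.mem_ball_self hr⟩

/-- The affine map `x ↦ L x + b` in homogeneous coordinates. -/
def affineHomogeneous (L : (𝔼 n) ≃ₗ[ℝ] (𝔼 n)) (b : 𝔼 n) : ((𝔼 n) × ℝ) ≃ₗ[ℝ] ((𝔼 n) × ℝ) where
  toFun p := (L p.1 + p.2 • b, p.2)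
  invFun p := (L.symm (p.1 - p.2 • b), p.2)
  map_add' p q := by
    ext1
    · simp only [Prod.fst_add, Prod.snd_add, map_add]; module
    · simp
  map_smul' c p := by
    ext1
    · simp only [Prod.smul_fst, Prod.smul_snd, map_smul, RingHom.id_apply, smul_eq_mul]; module
    · simp
  left_inv p := by simp
  right_inv p := by simp

theorem projectiveDenom_affineHomogeneous (L : (𝔼 n) ≃ₗ[ℝ] (𝔼 n)) (b x : 𝔼 n) :
    projectiveDenom (affineHomogeneous L b) x = 1 := rfl

theorem projectiveMap_affineHomogeneous (L : (𝔼 n) ≃ₗ[ℝ] (𝔼 n)) (b : 𝔼 n) :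
    projectiveMap (affineHomogeneous L b) = fun x => L x + b := by
  ext1 x
  simp [projectiveMap, affineHomogeneous]

theorem projectiveDeriv_affineHomogeneous (L : (𝔼 n) ≃ₗ[ℝ] (𝔼 n)) (b x : 𝔼 n) :
    projectiveDeriv (affineHomogeneous L b) x = L := by
  ext1 v
  rw [projectiveDeriv_apply, projectiveDenom_affineHomogeneous]
  simp [affineHomogeneous]

theorem IsConvexBody.affine_image {C : Set (𝔼 n)} (hC : IsConvexBody C) (L : (𝔼 n) ≃ₗ[ℝ] (𝔼 n))
    (b : 𝔼 n) : IsConvexBody ((fun x => L x + b) '' C) := by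
  rw [← projectiveMap_affineHomogeneous]
  exact hC.projectiveMap_image fun x _ => by simp [projectiveDenom_affineHomogeneous]

theorem IsCovariantDensity.affine {σ : Set (𝔼 n) → (𝔼 n) → ℝ} (hσ : IsCovariantDensity σ)
    {C : Set (𝔼 n)} (hC : IsConvexBody C) (L : (𝔼 n) ≃ₗ[ℝ] (𝔼 n)) (b : 𝔼 n) {x : 𝔼 n}
    (hx : x ∈ interior C) :
    |LinearMap.det (L : (𝔼 n) →ₗ[ℝ] (𝔼 n))| * σ ((fun x => L x + b) '' C) (L x + b) = σ C x := by
  have := hσ.covariant C hC (affineHomogeneous L b)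
    (fun x _ => by simp [projectiveDenom_affineHomogeneous]) x hx
  rwa [projectiveDeriv_affineHomogeneous, projectiveMap_affineHomogeneous] at this


/-! ### The Hilbert norm -/

namespace IsConvexBody

variable {C : Set (𝔼 n)} {x v : 𝔼 n}

theorem isClosed (hC : IsConvexBody C) : IsClosed C := hC.isCompact.isClosed

theorem vadd_mem_nhds (hx : x ∈ interior C) : (-x +ᵥ C) ∈ 𝓝 (0 : 𝔼 n) := by
  simpa using (vadd_mem_nhds_vadd_iff (-x)).2 (mem_interior_iff_mem_nhds.1 hx)

theorem isCompact_vadd (hC : IsConvexBody C) (x : 𝔼 n) : IsCompact (-x +ᵥ C) :=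
  hC.isCompact.vadd (-x)

theorem mem_neg_vadd_iff : v ∈ (-x +ᵥ C) ↔ x + v ∈ C := by
  rw [mem_vadd_set_iff_neg_vadd_mem, neg_neg, vadd_eq_add]

theorem gauge_le_inv_iff (hC : IsConvexBody C) (hx : x ∈ interior C) {t : ℝ} (ht : 0 < t) :
    gauge (-x +ᵥ C) v ≤ t⁻¹ ↔ x + t • v ∈ C := by
  have h := gauge_le_one_iff_mem_closure (x := t • v) (hC.convex.vadd (-x)) (vadd_mem_nhds hx)
  rw [(hC.isCompact_vadd x).isClosed.closure_eq, mem_neg_vadd_iff, gauge_smul_of_nonneg ht.le,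
    smul_eq_mul] at h
  rw [← h, inv_eq_one_div, le_div_iff₀' ht]

theorem gauge_pos (hC : IsConvexBody C) (hx : x ∈ interior C) (hv : v ≠ 0) :
    0 < gauge (-x +ᵥ C) v :=
  (_root_.gauge_pos (absorbent_nhds_zero (vadd_mem_nhds hx))
    ((NormedSpace.isVonNBounded_iff ℝ).2 (hC.isCompact_vadd x).isBounded)).2 hv

theorem add_inv_gauge_smul_mem (hC : IsConvexBody C) (hx : x ∈ interior C) (hv : v ≠ 0) :
    x + (gauge (-x +ᵥ C) v)⁻¹ • v ∈ C :=
  (hC.gauge_le_inv_iff hx (inv_pos.2 (hC.gauge_pos hx hv))).1 (by rw [inv_inv])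

/-- The gauge at `v` is the reciprocal of the exit time from `x` in direction `v`. By the fractional
linear change of parameter along the line, the reciprocal exit time changes by a term that does not
depend on the body and is linear in `v`. One inequality follows by mapping the exit point of `C`
forward, the other by pulling the exit point of the image back. -/
theorem gauge_projective (hC : IsConvexBody C) {M : ((𝔼 n) × ℝ) ≃ₗ[ℝ] ((𝔼 n) × ℝ)}
    (hM : ∀ x ∈ C, 0 < projectiveDenom M x) (hx : x ∈ interior C) (v : 𝔼 n) :
    gauge (-(projectiveMap M x) +ᵥ projectiveMap M '' C) (projectiveDeriv M x v) =
      gauge (-x +ᵥ C) v + (M (v, 0)).2 / projectiveDenom M x := by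
  have hw := hM x (interior_subset hx)
  rcases eq_or_ne v 0 with rfl | hv
  · have : M ((0 : 𝔼 n), (0 : ℝ)) = 0 := map_zero M
    simp [this]
  have hPx := projectiveMap_mem_interior hw.ne' hx
  have hPC := hC.projectiveMap_image hM
  have hdv : projectiveDeriv M x v ≠ 0 := by
    intro h0
    have h1 := (LinearMap.isUnit_iff_ker_eq_bot _).1 ((LinearMap.isUnit_iff_isUnit_det _).2
      (isUnit_iff_ne_zero.2 (projectiveDeriv_det_ne_zero hw.ne')))
    exact hv ((LinearMap.ker_eq_bot'.1 h1) v h0)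
  apply le_antisymm
  · have hg := hC.gauge_pos hx hv
    have hmem := hC.add_inv_gauge_smul_mem hx hv
    set g := gauge (-x +ᵥ C) v
    have hw2 := hM _ hmem
    have e := projectiveMap_add_smul hw.ne' hw2.ne'
    have hs : 0 < g⁻¹ * projectiveDenom M x / projectiveDenom M (x + g⁻¹ • v) := by positivity
    have h3 := (hPC.gauge_le_inv_iff hPx hs (v := projectiveDeriv M x v)).2
      (e ▸ mem_image_of_mem _ hmem)
    refine h3.trans_eq ?_
    rw [projectiveDenom_add_smul]
    field_simp
  · have hg := hPC.gauge_pos hPx hdv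
    obtain ⟨z, hz, hPz⟩ := hPC.add_inv_gauge_smul_mem hPx hdv
    set g := gauge (-(projectiveMap M x) +ᵥ projectiveMap M '' C) (projectiveDeriv M x v)
    have hwz := hM z hz
    set w := projectiveDenom M x
    set w0 := (M (v, 0)).2 with hw0
    set wz := projectiveDenom M z
    -- Homogeneous coordinates of the preimage `z` of the exit point. The last coordinate of this
    -- identity shows that `z` lies on the line through `x` in direction `v` and yields its
    -- parameter.
    have h1 : M (z, 1) =
        M (wz • ((w⁻¹ - g⁻¹ * w⁻¹ * w⁻¹ * w0) • (x, 1) + (g⁻¹ * w⁻¹) • (v, 0))) := by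
      rw [map_smul, map_add, map_smul, map_smul, apply_one_eq_smul hwz.ne',
        apply_zero_eq hw.ne' v, apply_one_eq_smul hw.ne', hPz, ← hw0,
        show projectiveDenom M x = w from rfl]
      congr 1
      ext1
      · simp only [Prod.smul_mk, Prod.mk_add_mk]
        match_scalars
        · field_simp; ring
        · field_simp
      · simp only [Prod.smul_mk, Prod.mk_add_mk, smul_eq_mul]
        field_simp; ring
    have h2 := M.injective h1
    have h3 := congrArg Prod.fst h2
    have h4 := congrArg Prod.snd h2
    simp only [Prod.smul_mk, Prod.mk_add_mk, smul_eq_mul, mul_one, mul_zero, add_zero] at h3 h4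
    have h5 : z = x + (wz * (g⁻¹ * w⁻¹)) • v := by
      rw [h3, smul_add, smul_smul, smul_smul, ← h4, one_smul]
    have h6 := (hC.gauge_le_inv_iff hx (v := v) (t := wz * (g⁻¹ * w⁻¹)) (by positivity)).2 (h5 ▸ hz)
    have h7 : (wz * (g⁻¹ * w⁻¹))⁻¹ = g - w0 / w := by
      field_simp at h4 ⊢
      linarith
    linarith

/-- The correction term in `gauge_projective` is odd in `v` and cancels in the sum over `v` and
`-v`. -/
theorem hilbertNorm_projective (hC : IsConvexBody C) {M : ((𝔼 n) × ℝ) ≃ₗ[ℝ] ((𝔼 n) × ℝ)}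
    (hM : ∀ x ∈ C, 0 < projectiveDenom M x) (hx : x ∈ interior C) (v : 𝔼 n) :
    hilbertNorm (projectiveMap M '' C) (projectiveMap M x) (projectiveDeriv M x v) =
      hilbertNorm C x v := by
  have e : M (-v, 0) = - M (v, 0) := by rw [← map_neg]; simp
  rw [hilbertNorm, hilbertNorm, ← map_neg, hC.gauge_projective hM hx, hC.gauge_projective hM hx, e,
    Prod.snd_neg]
  ring

theorem hilbertNorm_antitone {C' : Set (𝔼 n)} (h : C ⊆ C') (hx : x ∈ interior C) (v : 𝔼 n) :
    hilbertNorm C' x v ≤ hilbertNorm C x v := by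
  have := gauge_mono (absorbent_nhds_zero (vadd_mem_nhds hx)) (vadd_set_mono (a := -x) h)
  unfold hilbertNorm
  gcongr <;> apply this

theorem hilbertNorm_le {δ : ℝ} (hδ : 0 < δ) (h : Metric.closedBall x δ ⊆ C) (v : 𝔼 n) :
    hilbertNorm C x v ≤ ‖v‖ / δ := by
  have h1 : Metric.closedBall 0 δ ⊆ (-x +ᵥ C) := fun w hw =>
    mem_neg_vadd_iff.2 (h (by simpa using hw))
  have h2 : ∀ w, gauge (-x +ᵥ C) w ≤ ‖w‖ / δ := fun w => by
    rw [← gauge_closedBall hδ.le]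
    exact gauge_mono (absorbent_nhds_zero (Metric.closedBall_mem_nhds 0 hδ)) h1 w
  have h3 := h2 v
  have h4 := h2 (-v)
  rw [norm_neg] at h4
  unfold hilbertNorm
  linarith

theorem le_hilbertNorm {R : ℝ} (hR : 0 ≤ R) (h : C ⊆ Metric.closedBall x R) (hx : x ∈ interior C)
    (v : 𝔼 n) : ‖v‖ / R ≤ hilbertNorm C x v := by
  have h1 : (-x +ᵥ C) ⊆ Metric.closedBall 0 R := fun w hw => by
    simpa using h (mem_neg_vadd_iff.1 hw)
  have h2 := fun w => le_gauge_of_subset_closedBall (x := w)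
    (absorbent_nhds_zero (vadd_mem_nhds hx)) hR h1
  have h3 := h2 v
  have h4 := h2 (-v)
  rw [norm_neg] at h4
  unfold hilbertNorm
  linarith

theorem exists_closedBall_subset (hx : x ∈ interior C) :
    ∃ δ, 0 < δ ∧ Metric.closedBall x δ ⊆ C :=
  Metric.nhds_basis_closedBall.mem_iff.1 (mem_interior_iff_mem_nhds.1 hx)

theorem exists_subset_closedBall (hC : IsConvexBody C) (x : 𝔼 n) :
    ∃ R, 0 < R ∧ C ⊆ Metric.closedBall x R := by
  obtain ⟨R, hR⟩ := hC.isCompact.isBounded.subset_closedBall x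
  exact ⟨max R 1, by positivity, hR.trans (Metric.closedBall_subset_closedBall (le_max_left _ _))⟩

theorem hilbertUnitBall_bounds (hC : IsConvexBody C) (hx : x ∈ interior C) :
    ∃ δ R, 0 < δ ∧ 0 < R ∧ Metric.closedBall 0 δ ⊆ hilbertUnitBall C x ∧
      hilbertUnitBall C x ⊆ Metric.closedBall 0 R := by
  obtain ⟨δ, hδ, h1⟩ := exists_closedBall_subset hx
  obtain ⟨R, hR, h2⟩ := hC.exists_subset_closedBall x
  refine ⟨δ, R, hδ, hR, fun v hv => (hilbertNorm_le hδ h1 v).trans ?_, fun v hv => ?_⟩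
  · rw [div_le_one hδ]; simpa using hv
  · have := (le_hilbertNorm hR.le h2 hx v).trans hv
    rw [div_le_one hR] at this
    simpa using this

end IsConvexBody

/-! ### Polar bodies -/

theorem polarBody_antitone {K K' : Set (𝔼 n)} (h : K ⊆ K') : polarBody K' ⊆ polarBody K :=
  fun _ hy x hx => hy x (h hx)

theorem polarBody_closedBall {r : ℝ} (hr : 0 < r) :
    polarBody (Metric.closedBall (0 : 𝔼 n) r) = Metric.closedBall 0 r⁻¹ := by
  ext y
  simp only [polarBody, mem_ofPred_eq, mem_closedBall_zero_iff]
  constructor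
  · intro h
    rcases eq_or_ne y 0 with rfl | hy
    · simpa using hr.le
    have hy' := norm_pos_iff.2 hy
    have := h ((r * ‖y‖⁻¹) • y) (by
      rw [norm_smul, Real.norm_of_nonneg (by positivity), inv_mul_cancel_right₀ hy'.ne'])
    rw [real_inner_smul_left, real_inner_self_eq_norm_sq] at this
    rw [← one_div, le_div_iff₀ hr]
    field_simp at this
    linarith
  · intro h x hx
    calc ⟪x, y⟫ ≤ ‖x‖ * ‖y‖ := real_inner_le_norm x y
      _ ≤ r * r⁻¹ := by gcongr
      _ = 1 := mul_inv_cancel₀ hr.ne'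

theorem det_adjoint_real {F : Type*} [NormedAddCommGroup F] [InnerProductSpace ℝ F]
    [FiniteDimensional ℝ F] (L : F →ₗ[ℝ] F) :
    LinearMap.det (LinearMap.adjoint L) = LinearMap.det L := by
  rw [← LinearMap.det_toMatrix (stdOrthonormalBasis ℝ F).toBasis,
    ← LinearMap.det_toMatrix (stdOrthonormalBasis ℝ F).toBasis, LinearMap.toMatrix_adjoint,
    Matrix.det_conjTranspose, star_trivial]

theorem volume_real_preimage {L : (𝔼 n) →ₗ[ℝ] (𝔼 n)} (hL : LinearMap.det L ≠ 0) (J : Set (𝔼 n)) :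
    volume.real (L ⁻¹' J) = |LinearMap.det L|⁻¹ * volume.real J := by
  rw [Measure.real, Measure.addHaar_preimage_linearMap volume hL, ENNReal.toReal_mul,
    ENNReal.toReal_ofReal (abs_nonneg _), abs_inv, Measure.real]

/-- The polar body of `J` is the preimage of the polar body of `L⁻¹ J` under the adjoint of `L`, and
the adjoint has the same determinant. So polar volumes scale inversely to volumes, which makes the
Holmes-Thompson density covariant in the same way as the Busemann density. -/
theorem volume_real_polarBody_preimage {L : (𝔼 n) →ₗ[ℝ] (𝔼 n)} (hL : LinearMap.det L ≠ 0)
    (J : Set (𝔼 n)) :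
    volume.real (polarBody (L ⁻¹' J)) = |LinearMap.det L| * volume.real (polarBody J) := by
  have h1 : polarBody J = (LinearMap.adjoint L) ⁻¹' (polarBody (L ⁻¹' J)) := by
    ext y
    simp only [polarBody, mem_ofPred_eq, mem_preimage, LinearMap.adjoint_inner_right]
    refine ⟨fun h x hx => h _ hx, fun h x hx => ?_⟩
    have hs := (LinearMap.isUnit_iff_range_eq_top _).1 ((LinearMap.isUnit_iff_isUnit_det _).2
      (isUnit_iff_ne_zero.2 hL))
    obtain ⟨z, rfl⟩ := LinearMap.range_eq_top.1 hs x
    exact h z hx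
  have h2 : LinearMap.det (LinearMap.adjoint L) ≠ 0 := by rwa [det_adjoint_real]
  rw [h1, volume_real_preimage h2, det_adjoint_real, mul_inv_cancel_left₀ (abs_ne_zero.2 hL)]


/-! ### The Busemann and the Holmes-Thompson density -/

theorem hilbertUnitBall_eq_preimage {C : Set (𝔼 n)} (hC : IsConvexBody C)
    {M : ((𝔼 n) × ℝ) ≃ₗ[ℝ] ((𝔼 n) × ℝ)} (hM : ∀ x ∈ C, 0 < projectiveDenom M x) {x : 𝔼 n}
    (hx : x ∈ interior C) :
    hilbertUnitBall C x =
      projectiveDeriv M x ⁻¹' hilbertUnitBall (projectiveMap M '' C) (projectiveMap M x) := by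
  ext v
  simp only [hilbertUnitBall, mem_preimage, mem_ofPred_eq, hC.hilbertNorm_projective hM hx]

/-- The linear map that takes the Hilbert norm of the unit ball at `x` to the Euclidean norm. -/
noncomputable def ballNormMap (x : 𝔼 n) : (𝔼 n) →ₗ[ℝ] (𝔼 n) :=
  (√(1 - ‖x‖ ^ 2))⁻¹ • LinearMap.transvection
    ((((√(1 - ‖x‖ ^ 2))⁻¹ ^ 2 / ((√(1 - ‖x‖ ^ 2))⁻¹ + 1)) • innerSL ℝ x : (𝔼 n) →L[ℝ] ℝ) :
      (𝔼 n) →ₗ[ℝ] ℝ) x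

theorem ballNormMap_apply (x v : 𝔼 n) : ballNormMap x v = (√(1 - ‖x‖ ^ 2))⁻¹ •
    (v + ((√(1 - ‖x‖ ^ 2))⁻¹ ^ 2 / ((√(1 - ‖x‖ ^ 2))⁻¹ + 1) * ⟪x, v⟫) • x) := by
  simp [ballNormMap, LinearMap.transvection.apply]

theorem sq_norm_eq_of_mem_ball {x : 𝔼 n} (hx : x ∈ Metric.ball (0 : 𝔼 n) 1) :
    0 < (√(1 - ‖x‖ ^ 2))⁻¹ ∧ (√(1 - ‖x‖ ^ 2))⁻¹ ^ 2 * (1 - ‖x‖ ^ 2) = 1 := by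
  have h1 : ‖x‖ < 1 := by simpa using hx
  have h2 : 0 < 1 - ‖x‖ ^ 2 := by nlinarith [norm_nonneg x]
  refine ⟨by positivity, ?_⟩
  rw [inv_pow, Real.sq_sqrt h2.le, inv_mul_cancel₀ h2.ne']

/-- With `a = (1 - ‖x‖²)^(-1/2)`, the map is `a` times a transvection of determinant `1 + a² ‖x‖² /
(a + 1) = a`; the product is `a^(n+1)`. -/
theorem det_ballNormMap {x : 𝔼 n} (hx : x ∈ Metric.ball (0 : 𝔼 n) 1) :
    LinearMap.det (ballNormMap x) = hyperbolicDensity x := by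
  obtain ⟨ha, ha2⟩ := sq_norm_eq_of_mem_ball hx
  have h1 : ‖x‖ < 1 := by simpa using hx
  have h2 : 0 < 1 - ‖x‖ ^ 2 := by nlinarith [norm_nonneg x]
  have e : hyperbolicDensity x = (√(1 - ‖x‖ ^ 2))⁻¹ ^ (n + 1) := by
    rw [hyperbolicDensity, Real.rpow_neg h2.le, inv_pow, Real.sqrt_eq_rpow, ← Real.rpow_natCast _ (n + 1),
      ← Real.rpow_mul h2.le]
    congr 2
    push_cast
    ring
  rw [e, ballNormMap, LinearMap.det_smul, LinearMap.transvection.det, finrank_euclideanSpace_fin,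
    pow_succ]
  congr 1
  simp only [ContinuousLinearMap.toLinearMap_smul, LinearMap.smul_apply, ContinuousLinearMap.coe_coe,
    innerSL_apply_apply, real_inner_self_eq_norm_sq, smul_eq_mul]
  have key : ∀ a : ℝ, 0 < a → a ^ 2 * (1 - ‖x‖ ^ 2) = 1 → 1 + a ^ 2 / (a + 1) * ‖x‖ ^ 2 = a := by
    intro a ha ha2
    field_simp
    linear_combination -ha2
  exact key _ ha ha2

theorem norm_ballNormMap_sq {x : 𝔼 n} (hx : x ∈ Metric.ball (0 : 𝔼 n) 1) (v : 𝔼 n) :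
    ‖ballNormMap x v‖ ^ 2 = (√(1 - ‖x‖ ^ 2))⁻¹ ^ 2 * ‖v‖ ^ 2 +
      ((√(1 - ‖x‖ ^ 2))⁻¹ ^ 2 * ⟪x, v⟫) ^ 2 := by
  obtain ⟨ha, ha2⟩ := sq_norm_eq_of_mem_ball hx
  rw [ballNormMap_apply, norm_smul, mul_pow, norm_add_sq_real, real_inner_smul_right, norm_smul,
    mul_pow, Real.norm_eq_abs, Real.norm_eq_abs, sq_abs, sq_abs, real_inner_comm x v]
  set a := (√(1 - ‖x‖ ^ 2))⁻¹
  have hc : 2 * (a ^ 2 / (a + 1)) + (a ^ 2 / (a + 1)) ^ 2 * ‖x‖ ^ 2 = a ^ 2 := by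
    field_simp
    nlinarith
  linear_combination (a ^ 2 * ⟪x, v⟫ ^ 2) * hc

/-- The reciprocal exit times from the unit ball are the roots of a quadratic equation, `N ± a² ⟪x,
v⟫` with `N = ‖ballNormMap x v‖` and `a = (1 - ‖x‖²)^(-1/2)`; their mean is `N`. -/
theorem hilbertNorm_closedBall {x : 𝔼 n} (hx : x ∈ Metric.ball (0 : 𝔼 n) 1) (v : 𝔼 n) :
    hilbertNorm (Metric.closedBall 0 1) x v = ‖ballNormMap x v‖ := by
  rcases eq_or_ne v 0 with rfl | hv
  · simp [hilbertNorm]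
  obtain ⟨ha, ha2⟩ := sq_norm_eq_of_mem_ball hx
  have hL := norm_ballNormMap_sq hx v
  set a := (√(1 - ‖x‖ ^ 2))⁻¹
  set N := ‖ballNormMap x v‖ with hN
  have hv' : 0 < ‖v‖ := norm_pos_iff.2 hv
  have hlt : |a ^ 2 * ⟪x, v⟫| < N := by
    apply abs_lt_of_sq_lt_sq _ (norm_nonneg _)
    rw [hL]
    have : 0 < a ^ 2 * ‖v‖ ^ 2 := by positivity
    linarith
  -- Stated for general `w` so that it serves both directions `v` and `-v`.
  have key : ∀ (w : 𝔼 n) (τ : ℝ), 0 < τ → (τ - a ^ 2 * ⟪x, w⟫) ^ 2 = N ^ 2 → ‖w‖ = ‖v‖ →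
      ⟪x, w⟫ ^ 2 = ⟪x, v⟫ ^ 2 → x + τ⁻¹ • w ∈ frontier (Metric.closedBall (0 : 𝔼 n) 1) := by
    intro w τ hτ h1 h2 h3
    rw [frontier_closedBall _ one_ne_zero, mem_sphere_zero_iff_norm]
    have h4 : ‖x + τ⁻¹ • w‖ ^ 2 = 1 := by
      rw [norm_add_sq_real, real_inner_smul_right, norm_smul, mul_pow, h2, Real.norm_eq_abs, sq_abs]
      have h5 : (τ ^ 2 * (1 - ‖x‖ ^ 2) - 2 * τ * ⟪x, w⟫ - ‖v‖ ^ 2) * a ^ 2 = 0 := by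
        rw [hL] at h1
        linear_combination h1 + τ ^ 2 * ha2 - a ^ 4 * h3
      have h6 := (mul_eq_zero.1 h5).resolve_right (by positivity)
      field_simp
      linarith
    exact (pow_eq_one_iff_of_nonneg (norm_nonneg _) two_ne_zero).1 h4
  have h1 := abs_lt.1 hlt
  have p1 : 0 < a ^ 2 * ⟪x, v⟫ + N := by linarith
  have p2 : 0 < -(a ^ 2 * ⟪x, v⟫) + N := by linarith
  have k1 := key v _ p1 (by ring) rfl rfl
  have k2 := key (-v) _ p2 (by rw [inner_neg_right]; ring) (norm_neg v)
    (by rw [inner_neg_right, neg_sq])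
  rw [smul_neg, ← sub_eq_add_neg] at k2
  rw [hilbertNorm_eq (isConvexBody_closedBall (0 : 𝔼 n) one_pos)
    (by rwa [interior_closedBall _ one_ne_zero]) (inv_pos.2 p1) (inv_pos.2 p2) k1 k2]
  simp only [one_div, inv_inv]
  ring

theorem hyperbolicDensity_pos {x : 𝔼 n} (hx : x ∈ Metric.ball (0 : 𝔼 n) 1) :
    0 < hyperbolicDensity x := by
  have h1 : ‖x‖ < 1 := by simpa using hx
  have h2 : 0 < 1 - ‖x‖ ^ 2 := by nlinarith [norm_nonneg x]
  exact Real.rpow_pos_of_pos h2 _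

theorem hilbertUnitBall_closedBall {x : 𝔼 n} (hx : x ∈ Metric.ball (0 : 𝔼 n) 1) :
    hilbertUnitBall (Metric.closedBall 0 1) x = ballNormMap x ⁻¹' Metric.closedBall 0 1 := by
  ext v
  simp [hilbertUnitBall, hilbertNorm_closedBall hx]

theorem volume_real_closedBall_pos (x : 𝔼 n) {r : ℝ} (hr : 0 < r) :
    0 < volume.real (Metric.closedBall x r) :=
  ENNReal.toReal_pos (Metric.measure_closedBall_pos volume x hr).ne' measure_closedBall_lt_top.ne

theorem isCovariantDensity_busemannDensity : IsCovariantDensity (n := n) busemannDensity where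
  nonneg C _ x _ := by unfold busemannDensity; positivity
  antitone C C' hC hC' hCC' x hx := by
    obtain ⟨δ, _, hδ, -, h1, -⟩ := hC.hilbertUnitBall_bounds hx
    obtain ⟨_, R, -, -, -, h2⟩ := hC'.hilbertUnitBall_bounds (interior_mono hCC' hx)
    have h3 : hilbertUnitBall C x ⊆ hilbertUnitBall C' x := fun v hv =>
      (IsConvexBody.hilbertNorm_antitone hCC' hx v).trans hv
    have h4 : volume (hilbertUnitBall C' x) ≠ ⊤ :=
      ((measure_mono h2).trans_lt measure_closedBall_lt_top).ne
    have h5 : 0 < volume.real (hilbertUnitBall C x) :=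
      (volume_real_closedBall_pos 0 hδ).trans_le
        (measureReal_mono h1 (ne_top_of_le_ne_top h4 (measure_mono h3)))
    unfold busemannDensity
    gcongr
  covariant C hC M hM x hx := by
    have hd := projectiveDeriv_det_ne_zero (hM x (interior_subset hx)).ne'
    rw [busemannDensity, busemannDensity, hilbertUnitBall_eq_preimage hC hM hx,
      volume_real_preimage hd]
    have := abs_pos.2 hd
    field_simp
  ball x hx := by
    have hp := hyperbolicDensity_pos hx
    have h1 := det_ballNormMap hx
    rw [busemannDensity, hilbertUnitBall_closedBall hx, volume_real_preimage (by rw [h1]; exact hp.ne'),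
      h1, abs_of_pos hp]
    have := volume_real_closedBall_pos (0 : 𝔼 n) one_pos
    field_simp

theorem isCovariantDensity_holmesThompsonDensity :
    IsCovariantDensity (n := n) holmesThompsonDensity where
  nonneg C _ x _ := by unfold holmesThompsonDensity; positivity
  antitone C C' hC hC' hCC' x hx := by
    obtain ⟨δ, _, hδ, -, h1, -⟩ := hC.hilbertUnitBall_bounds hx
    have h3 : hilbertUnitBall C x ⊆ hilbertUnitBall C' x := fun v hv =>
      (IsConvexBody.hilbertNorm_antitone hCC' hx v).trans hv
    have h4 : volume (polarBody (hilbertUnitBall C x)) ≠ ⊤ := by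
      refine ((measure_mono (polarBody_antitone h1)).trans_lt ?_).ne
      rw [polarBody_closedBall hδ]
      exact measure_closedBall_lt_top
    have h5 := measureReal_mono (polarBody_antitone h3) h4
    unfold holmesThompsonDensity
    gcongr
  covariant C hC M hM x hx := by
    have hd := projectiveDeriv_det_ne_zero (hM x (interior_subset hx)).ne'
    rw [holmesThompsonDensity, holmesThompsonDensity, hilbertUnitBall_eq_preimage hC hM hx,
      volume_real_polarBody_preimage hd, mul_div_assoc]
  ball x hx := by
    have hp := hyperbolicDensity_pos hx
    have h1 := det_ballNormMap hx
    rw [holmesThompsonDensity, hilbertUnitBall_closedBall hx,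
      volume_real_polarBody_preimage (by rw [h1]; exact hp.ne'), h1, abs_of_pos hp,
      polarBody_closedBall one_pos, inv_one]
    exact mul_div_cancel_right₀ _ (volume_real_closedBall_pos (0 : 𝔼 n) one_pos).ne'

/-! ### Notions of volume -/

theorem continuousOn_projectiveMap {M : ((𝔼 n) × ℝ) ≃ₗ[ℝ] ((𝔼 n) × ℝ)} {s : Set (𝔼 n)}
    (h : ∀ x ∈ s, projectiveDenom M x ≠ 0) : ContinuousOn (projectiveMap M) s := fun y hy =>
  (projectiveMap_hasStrictFDerivAt (h y hy)).continuousAt.continuousWithinAt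

theorem continuousOn_abs_det_projectiveDeriv {M : ((𝔼 n) × ℝ) ≃ₗ[ℝ] ((𝔼 n) × ℝ)} {s : Set (𝔼 n)}
    (h : ∀ x ∈ s, projectiveDenom M x ≠ 0) :
    ContinuousOn (fun y => |LinearMap.det (projectiveDeriv M y)|) s := by
  have h1 : ContinuousOn (fun y => LinearMap.toContinuousLinearMap (projectiveDeriv M y)) s := by
    refine continuousOn_clm_apply.2 fun v => ?_
    simp only [LinearMap.coe_toContinuousLinearMap', projectiveDeriv_apply]
    exact ((continuous_projectiveDenom M).continuousOn.inv₀ h).smul (continuousOn_const.sub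
      (ContinuousOn.fun_const_smul (continuousOn_projectiveMap h) (M (v, 0)).2))
  exact ((ContinuousLinearMap.continuous_det (𝕜 := ℝ) (E := 𝔼 n)).comp_continuousOn h1).abs

/-- Comparison of the integrals of continuous functions gives comparison of the functions. -/
theorem le_of_forall_setLIntegral_le {U : Set (𝔼 n)} (hU : IsOpen U) {f g : (𝔼 n) → ℝ}
    (hf : ContinuousOn f U) (hg : ContinuousOn g U) (hg0 : ∀ x ∈ U, 0 ≤ g x)
    (h : ∀ A, MeasurableSet A → A ⊆ U →
      ∫⁻ x in A, ENNReal.ofReal (f x) ≤ ∫⁻ x in A, ENNReal.ofReal (g x)) {x : 𝔼 n} (hx : x ∈ U) :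
    f x ≤ g x := by
  by_contra! hlt
  obtain ⟨c, hc1, hc2⟩ := exists_between hlt
  have h1 : ∀ᶠ y in 𝓝 x, g y < c ∧ c < f y ∧ y ∈ U :=
    ((hg.continuousAt (hU.mem_nhds hx)).eventually_lt_const hc1).and
      (((hf.continuousAt (hU.mem_nhds hx)).eventually_const_lt hc2).and (hU.mem_nhds hx))
  obtain ⟨c', hc3, hc4⟩ := exists_between hc2
  have h2 : ∀ᶠ y in 𝓝 x, c' < f y :=
    (hf.continuousAt (hU.mem_nhds hx)).eventually_const_lt hc4
  obtain ⟨δ, hδ, hball⟩ := Metric.eventually_nhds_iff_ball.1 (h1.and h2)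
  have h3 := h (Metric.ball x δ) measurableSet_ball fun y hy => (hball y hy).1.2.2
  have hc0 : 0 ≤ c := (hg0 x hx).trans hc1.le
  have h4 : ENNReal.ofReal c' * volume (Metric.ball x δ) ≤
      ∫⁻ y in Metric.ball x δ, ENNReal.ofReal (f y) := by
    rw [← setLIntegral_const]
    exact setLIntegral_mono' measurableSet_ball fun y hy =>
      ENNReal.ofReal_le_ofReal (hball y hy).2.le
  have h5 : ∫⁻ y in Metric.ball x δ, ENNReal.ofReal (g y) ≤
      ENNReal.ofReal c * volume (Metric.ball x δ) := by
    rw [← setLIntegral_const]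
    exact setLIntegral_mono' measurableSet_ball fun y hy =>
      ENNReal.ofReal_le_ofReal (hball y hy).1.1.le
  have h6 := (h4.trans h3).trans h5
  rw [ENNReal.mul_le_mul_iff_left (Metric.measure_ball_pos volume x hδ).ne'
    measure_ball_lt_top.ne, ENNReal.ofReal_le_ofReal_iff hc0] at h6
  linarith

/-- Each axiom on measures becomes a pointwise statement on densities, since continuous functions
whose integrals over all Borel subsets compare are themselves comparable. Covariance uses the change
of variables formula for the projective map. -/
theorem IsHilbertVolume.isCovariantDensity
    {vol : Set (𝔼 n) → Measure (𝔼 n)} {σ : Set (𝔼 n) → (𝔼 n) → ℝ} (h : IsHilbertVolume vol σ) :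
    IsCovariantDensity σ where
  nonneg := h.density_nonneg
  antitone C C' hC hC' hCC' x hx := by
    refine le_of_forall_setLIntegral_le isOpen_interior
      ((h.density_continuousOn C' hC').mono (interior_mono hCC')) (h.density_continuousOn C hC)
      (h.density_nonneg C hC) (fun A hA hAC => ?_) hx
    rw [← h.vol_eq C hC A hA hAC, ← h.vol_eq C' hC' A hA (hAC.trans (interior_mono hCC'))]
    exact h.antitone C C' hC hC' hCC' A hA hAC
  covariant C hC M hM x hx := by
    have hM' : ∀ x ∈ interior C, projectiveDenom M x ≠ 0 := fun x hx =>
      (hM x (interior_subset hx)).ne'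
    have hPC := hC.projectiveMap_image hM
    have hmaps : MapsTo (projectiveMap M) (interior C) (interior (projectiveMap M '' C)) :=
      fun y hy => projectiveMap_mem_interior (hM' y hy) hy
    have hcP := continuousOn_projectiveMap hM'
    have hinj := projectiveMap_injOn M hM'
    have hcdet := continuousOn_abs_det_projectiveDeriv hM'
    have heq : ∀ A, MeasurableSet A → A ⊆ interior C →
        ∫⁻ y in A, ENNReal.ofReal (|LinearMap.det (projectiveDeriv M y)| *
          σ (projectiveMap M '' C) (projectiveMap M y)) = ∫⁻ y in A, ENNReal.ofReal (σ C y) := by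
      intro A hA hAC
      have h1 : MeasurableSet (projectiveMap M '' A) :=
        hA.image_of_continuousOn_injOn (hcP.mono hAC) (hinj.mono hAC)
      have h2 := h.projective_invariant C hC M (fun x hx => (hM x hx).ne') A hA hAC
      rw [h.vol_eq C hC A hA hAC, h.vol_eq _ hPC _ h1 ((hmaps.mono_left hAC).image_subset),
        lintegral_image_eq_lintegral_abs_det_fderiv_mul volume hA
          (fun y hy => (projectiveMap_hasStrictFDerivAt
            (hM' y (hAC hy))).hasFDerivAt.hasFDerivWithinAt) (hinj.mono hAC)] at h2
      rw [← h2]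
      refine lintegral_congr fun y => ?_
      rw [ENNReal.ofReal_mul (abs_nonneg _)]
      rfl
    have hc1 := hcdet.mul ((h.density_continuousOn _ hPC).comp hcP hmaps)
    refine le_antisymm ?_ ?_
    · exact le_of_forall_setLIntegral_le isOpen_interior hc1 (h.density_continuousOn C hC)
        (h.density_nonneg C hC) (fun A hA hAC => (heq A hA hAC).le) hx
    · exact le_of_forall_setLIntegral_le isOpen_interior (h.density_continuousOn C hC) hc1
        (fun y hy => mul_nonneg (abs_nonneg _) (h.density_nonneg _ hPC _ (hmaps hy)))
        (fun A hA hAC => (heq A hA hAC).ge) hx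
  ball x hx := by
    have hB := isConvexBody_closedBall (0 : 𝔼 n) one_pos
    have hi : interior (Metric.closedBall (0 : 𝔼 n) 1) = Metric.ball 0 1 :=
      interior_closedBall _ one_ne_zero
    have hc1 := h.density_continuousOn _ hB
    rw [hi] at hc1
    have heq : ∀ A, MeasurableSet A → A ⊆ Metric.ball (0 : 𝔼 n) 1 →
        ∫⁻ y in A, ENNReal.ofReal (σ (Metric.closedBall 0 1) y) =
          ∫⁻ y in A, ENNReal.ofReal (hyperbolicDensity y) := by
      intro A hA hAB
      have := h.ellipsoid (AffineEquiv.refl ℝ (𝔼 n)) A hA hAB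
      simp only [AffineEquiv.coe_refl, image_id] at this
      rw [← this, h.vol_eq _ hB A hA (hi.symm ▸ hAB)]
    have hc2 : ContinuousOn (hyperbolicDensity (n := n)) (Metric.ball 0 1) := by
      unfold hyperbolicDensity
      refine ContinuousOn.rpow_const (by fun_prop) fun y hy => Or.inl ?_
      have h1 : ‖y‖ < 1 := by simpa using hy
      nlinarith [norm_nonneg y]
    refine le_antisymm ?_ ?_
    · exact le_of_forall_setLIntegral_le Metric.isOpen_ball hc1 hc2
        (fun y hy => (hyperbolicDensity_pos hy).le) (fun A hA hAC => (heq A hA hAC).le) hx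
    · exact le_of_forall_setLIntegral_le Metric.isOpen_ball hc2 hc1
        (fun y hy => h.density_nonneg _ hB y (hi.symm ▸ hy)) (fun A hA hAC => (heq A hA hAC).ge) hx


/-! ### Continuity of covariant densities -/

theorem smul_mem_of_closedBall_subset {C : Set (𝔼 n)} (hC : Convex ℝ C) {x₀ z w : 𝔼 n} {δ ε : ℝ}
    (hball : Metric.closedBall x₀ δ ⊆ C) (hε : 0 ≤ ε) (hε1 : ε ≤ 1)
    (hw : ‖w‖ ≤ ε * δ) (hz : z ∈ C) : (1 - ε) • z + ε • x₀ + w ∈ C := by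
  rcases hε.eq_or_lt with rfl | hε
  · have : w = 0 := by simpa using hw
    simpa [this] using hz
  have h1 : x₀ + ε⁻¹ • w ∈ C := hball (by
    rw [mem_closedBall_iff_norm, add_sub_cancel_left, norm_smul, norm_inv, Real.norm_of_nonneg hε.le,
      inv_mul_le_iff₀ hε]
    exact hw)
  have h2 := hC hz h1 (sub_nonneg.2 hε1) hε.le (by ring)
  rwa [smul_add, smul_inv_smul₀ hε.ne', ← add_assoc] at h2

theorem IsCovariantDensity.homothety {σ : Set (𝔼 n) → (𝔼 n) → ℝ} (hσ : IsCovariantDensity σ)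
    {C : Set (𝔼 n)} (hC : IsConvexBody C) {c : ℝ} (hc : 0 < c) {x₀ : 𝔼 n} (x : 𝔼 n)
    (hx₀ : x₀ ∈ interior C) :
    IsConvexBody ((fun z => c • z + (x - c • x₀)) '' C) ∧
    x ∈ interior ((fun z => c • z + (x - c • x₀)) '' C) ∧
    c ^ n * σ ((fun z => c • z + (x - c • x₀)) '' C) x = σ C x₀ := by
  let L := LinearEquiv.smulOfNeZero ℝ (𝔼 n) c hc.ne'
  have h1 := hσ.affine hC L (x - c • x₀) hx₀
  have h2 := projectiveMap_mem_interior (M := affineHomogeneous L (x - c • x₀))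
    (by simp [projectiveDenom_affineHomogeneous]) hx₀
  rw [projectiveMap_affineHomogeneous] at h2
  have hL : ∀ z, L z = c • z := fun z => rfl
  have hdet : |LinearMap.det (L : (𝔼 n) →ₗ[ℝ] (𝔼 n))| = c ^ n := by
    have : (L : (𝔼 n) →ₗ[ℝ] (𝔼 n)) = c • LinearMap.id := rfl
    rw [this, LinearMap.det_smul, LinearMap.det_id, finrank_euclideanSpace_fin, mul_one,
      abs_of_pos (by positivity)]
  simp only [hL, hdet, add_sub_cancel] at h1 h2
  exact ⟨hC.affine_image L _, h2, h1⟩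

/-- Continuity follows from monotonicity and affine covariance alone. The homothets of `C` with
factors `1 ± ‖x - x₀‖ / δ` that carry `x₀` to `x` contain `C`, respectively lie in `C`, so `σ C x`
is caught between multiples of `σ C x₀` with factors tending to `1`. -/
theorem IsCovariantDensity.continuousOn {σ : Set (𝔼 n) → (𝔼 n) → ℝ} (hσ : IsCovariantDensity σ)
    {C : Set (𝔼 n)} (hC : IsConvexBody C) : ContinuousOn (σ C) (interior C) := by
  intro x₀ hx₀
  apply ContinuousAt.continuousWithinAt
  obtain ⟨δ, hδ, hball⟩ := IsConvexBody.exists_closedBall_subset hx₀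
  have hdist : Tendsto (fun x : 𝔼 n => ‖x - x₀‖ / δ) (𝓝 x₀) (𝓝 0) := by
    have : Continuous fun x : 𝔼 n => ‖x - x₀‖ / δ := by fun_prop
    simpa using this.tendsto x₀
  have hup : Tendsto (fun x : 𝔼 n => ((1 - ‖x - x₀‖ / δ) ^ n)⁻¹ * σ C x₀) (𝓝 x₀)
      (𝓝 (σ C x₀)) := by
    have := ((((tendsto_const_nhds (x := (1 : ℝ))).sub hdist).pow n).inv₀
      (by simp)).mul_const (σ C x₀)
    simpa using this
  have hlo : Tendsto (fun x : 𝔼 n => ((1 + ‖x - x₀‖ / δ) ^ n)⁻¹ * σ C x₀) (𝓝 x₀)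
      (𝓝 (σ C x₀)) := by
    have := ((((tendsto_const_nhds (x := (1 : ℝ))).add hdist).pow n).inv₀
      (by simp)).mul_const (σ C x₀)
    simpa using this
  refine tendsto_of_tendsto_of_tendsto_of_le_of_le' hlo hup ?_ ?_
  · filter_upwards [isOpen_interior.mem_nhds hx₀] with x hx
    set ε := ‖x - x₀‖ / δ with hε
    have hε0 : 0 ≤ ε := by positivity
    have hpos : 0 < 1 + ε := by positivity
    obtain ⟨h1, h2, h3⟩ := hσ.homothety hC hpos x hx₀
    rw [← h3, inv_mul_cancel_left₀ (by positivity)]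
    refine hσ.antitone _ _ hC h1 (fun z hz => ?_) x hx
    have h4 := smul_mem_of_closedBall_subset hC.convex (w := -((1 + ε)⁻¹ • (x - x₀)))
      (ε := ε / (1 + ε)) hball (by positivity) (by rw [div_le_one hpos]; linarith)
      (by
        rw [norm_neg, norm_smul, norm_inv, Real.norm_of_nonneg hpos.le, hε]
        field_simp; rfl) hz
    refine ⟨_, h4, ?_⟩
    simp only [smul_add, smul_smul, smul_neg]
    rw [mul_inv_cancel₀ hpos.ne', mul_div_cancel₀ _ hpos.ne']
    have : (1 + ε) * (1 - ε / (1 + ε)) = 1 := by field_simp; ring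
    rw [this]
    module
  · filter_upwards [hdist.eventually_lt_const one_pos] with x hx
    set ε := ‖x - x₀‖ / δ with hε
    have hε0 : 0 ≤ ε := by positivity
    have hpos : 0 < 1 - ε := by linarith
    obtain ⟨h1, h2, h3⟩ := hσ.homothety hC hpos x hx₀
    rw [← h3, inv_mul_cancel_left₀ (by positivity)]
    refine hσ.antitone _ _ h1 hC ?_ x h2
    rintro _ ⟨z, hz, rfl⟩
    have h4 := smul_mem_of_closedBall_subset hC.convex (w := x - x₀) hball hε0 hx.le
      (by rw [hε]; field_simp; rfl) hz
    convert h4 using 1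
    simp only
    module

/-! ### Square roots and block determinants -/

theorem exists_norm_sq_eq_inner {F : Type*} [NormedAddCommGroup F] [InnerProductSpace ℝ F]
    [FiniteDimensional ℝ F] {G : F →ₗ[ℝ] F} (hG : G.IsSymmetric) (hpos : ∀ x, 0 ≤ ⟪G x, x⟫) :
    ∃ R : F →ₗ[ℝ] F, (∀ x, ⟪G x, x⟫ = ‖R x‖ ^ 2) ∧ LinearMap.det G = LinearMap.det R ^ 2 := by
  let b := stdOrthonormalBasis ℝ F
  have h1 : (LinearMap.toMatrix b.toBasis b.toBasis G).PosSemidef :=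
    (LinearMap.posSemidef_toMatrix_iff b).2 ⟨hG, hpos⟩
  obtain ⟨B, hB⟩ : ∃ B : Matrix _ _ ℝ, LinearMap.toMatrix b.toBasis b.toBasis G = star B * B := by
    open scoped MatrixOrder Matrix.Norms.L2Operator in
    exact CStarAlgebra.nonneg_iff_eq_star_mul_self.mp h1.nonneg
  let R := Matrix.toLin b.toBasis b.toBasis B
  have h2 : G = LinearMap.adjoint R ∘ₗ R := by
    apply (LinearMap.toMatrix b.toBasis b.toBasis).injective
    rw [LinearMap.toMatrix_comp b.toBasis b.toBasis b.toBasis, LinearMap.toMatrix_adjoint, hB,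
      LinearMap.toMatrix_toLin]
    rfl
  refine ⟨R, fun x => ?_, ?_⟩
  · rw [h2, LinearMap.comp_apply, LinearMap.adjoint_inner_left, real_inner_self_eq_norm_sq]
  · rw [h2, LinearMap.det_comp, det_adjoint_real, sq]

/-! ### The splitting of the space into a hyperplane and its unit normal. -/

section Hyperplane

variable {u : 𝔼 n}

/-- The orthogonal projection onto the hyperplane `u^⊥`, for a unit vector `u`. -/
noncomputable def hyperplaneProj (hu : ‖u‖ = 1) : (𝔼 n) →ₗ[ℝ] (ℝ ∙ u)ᗮ where
  toFun x := ⟨x - ⟪u, x⟫ • u, by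
    rw [Submodule.mem_orthogonal_singleton_iff_inner_right, inner_sub_right, real_inner_smul_right,
      real_inner_self_eq_norm_sq, hu]; ring⟩
  map_add' x y := by
    ext1
    simp only [Submodule.coe_add, inner_add_right]
    module
  map_smul' c x := by
    ext1
    simp only [Submodule.coe_smul, real_inner_smul_right, RingHom.id_apply]
    module

theorem coe_hyperplaneProj (hu : ‖u‖ = 1) (x : 𝔼 n) :
    (hyperplaneProj hu x : 𝔼 n) = x - ⟪u, x⟫ • u := rfl

theorem inner_coe_hyperplane (v : (ℝ ∙ u)ᗮ) : ⟪u, (v : 𝔼 n)⟫ = 0 :=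
  (Submodule.mem_orthogonal_singleton_iff_inner_right).1 v.2

theorem inner_self_unit (hu : ‖u‖ = 1) : ⟪u, u⟫ = 1 := by
  rw [real_inner_self_eq_norm_sq, hu, one_pow]

theorem hyperplaneProj_coe (hu : ‖u‖ = 1) (v : (ℝ ∙ u)ᗮ) : hyperplaneProj hu v = v := by
  ext1
  rw [coe_hyperplaneProj, inner_coe_hyperplane, zero_smul, sub_zero]

theorem hyperplaneProj_self (hu : ‖u‖ = 1) : hyperplaneProj hu u = 0 := by
  ext1
  rw [coe_hyperplaneProj, inner_self_unit hu, one_smul, sub_self]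
  rfl

theorem norm_sq_eq_hyperplane (hu : ‖u‖ = 1) (x : 𝔼 n) :
    ‖x‖ ^ 2 = ‖hyperplaneProj hu x‖ ^ 2 + ⟪u, x⟫ ^ 2 := by
  have h : x = (hyperplaneProj hu x : 𝔼 n) + ⟪u, x⟫ • u := by
    rw [coe_hyperplaneProj]; module
  nth_rewrite 1 [h]
  rw [norm_add_sq_real, real_inner_smul_right, real_inner_comm u,
    inner_coe_hyperplane, norm_smul, hu, Real.norm_eq_abs, mul_one, sq_abs, Submodule.norm_coe]
  ring

theorem norm_hyperplaneProj_le (hu : ‖u‖ = 1) (x : 𝔼 n) : ‖hyperplaneProj hu x‖ ≤ ‖x‖ := by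
  apply le_of_sq_le_sq _ (norm_nonneg _)
  rw [norm_sq_eq_hyperplane hu x]
  nlinarith [sq_nonneg ⟪u, x⟫]

/-- The decomposition of the space into `u^⊥` and the line spanned by `u`. -/
noncomputable def hyperplaneEquiv (hu : ‖u‖ = 1) : (𝔼 n) ≃ₗ[ℝ] (ℝ ∙ u)ᗮ × ℝ where
  toFun x := (hyperplaneProj hu x, ⟪u, x⟫)
  invFun p := (p.1 : 𝔼 n) + p.2 • u
  map_add' x y := by simp [inner_add_right]
  map_smul' c x := by simp [real_inner_smul_right]
  left_inv x := by simp [coe_hyperplaneProj]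
  right_inv p := by
    ext1
    · simp [hyperplaneProj_coe, hyperplaneProj_self]
    · simp [inner_add_right, real_inner_smul_right, inner_coe_hyperplane, hu]

theorem finrank_hyperplane (hu : ‖u‖ = 1) : Module.finrank ℝ (ℝ ∙ u)ᗮ + 1 = n := by
  have := (hyperplaneEquiv hu).finrank_eq
  rw [Module.finrank_prod, Module.finrank_self, finrank_euclideanSpace_fin] at this
  exact this.symm

/-- The extension of an operator on `u^⊥` to the whole space by `u ↦ b u`. -/
noncomputable def hyperplaneExtend (hu : ‖u‖ = 1) (A : (ℝ ∙ u)ᗮ →ₗ[ℝ] (ℝ ∙ u)ᗮ) (b : ℝ) :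
    (𝔼 n) →ₗ[ℝ] (𝔼 n) :=
  ((hyperplaneEquiv hu).symm : (ℝ ∙ u)ᗮ × ℝ →ₗ[ℝ] (𝔼 n)) ∘ₗ
    (A.prodMap (b • LinearMap.id)) ∘ₗ (hyperplaneEquiv hu : (𝔼 n) →ₗ[ℝ] (ℝ ∙ u)ᗮ × ℝ)

theorem hyperplaneExtend_apply (hu : ‖u‖ = 1) (A : (ℝ ∙ u)ᗮ →ₗ[ℝ] (ℝ ∙ u)ᗮ) (b : ℝ) (x : 𝔼 n) :
    hyperplaneExtend hu A b x = (A (hyperplaneProj hu x) : 𝔼 n) + (b * ⟪u, x⟫) • u := rfl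

theorem det_hyperplaneExtend (hu : ‖u‖ = 1) (A : (ℝ ∙ u)ᗮ →ₗ[ℝ] (ℝ ∙ u)ᗮ) (b : ℝ) :
    LinearMap.det (hyperplaneExtend hu A b) = b * LinearMap.det A := by
  have := LinearMap.det_conj (A.prodMap (b • (LinearMap.id : ℝ →ₗ[ℝ] ℝ))) (hyperplaneEquiv hu).symm
  rw [LinearEquiv.symm_symm] at this
  rw [hyperplaneExtend, this, LinearMap.det_prodMap, LinearMap.det_smul, LinearMap.det_id,
    Module.finrank_self]
  ring

theorem inner_hyperplaneExtend (hu : ‖u‖ = 1) (A : (ℝ ∙ u)ᗮ →ₗ[ℝ] (ℝ ∙ u)ᗮ) (b : ℝ) (x y : 𝔼 n) :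
    ⟪hyperplaneExtend hu A b x, y⟫ =
      ⟪A (hyperplaneProj hu x), hyperplaneProj hu y⟫ + b * ⟪u, x⟫ * ⟪u, y⟫ := by
  have h : y = (hyperplaneProj hu y : 𝔼 n) + ⟪u, y⟫ • u := by
    rw [coe_hyperplaneProj]; module
  rw [hyperplaneExtend_apply]
  nth_rewrite 1 [h]
  rw [inner_add_left, inner_add_right, real_inner_smul_right, real_inner_comm u,
    inner_coe_hyperplane, real_inner_smul_left, inner_add_right, inner_coe_hyperplane,
    real_inner_smul_right, inner_self_unit hu, Submodule.coe_inner]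
  ring

/-! ### Ellipsoids -/

/-- The quadratic polynomial `2 t - ⟨B v, v⟩ - t² / s` at `x = y + v - t u`. -/
noncomputable def ellipsoidPoly (hu : ‖u‖ = 1) (y : 𝔼 n) (B : (ℝ ∙ u)ᗮ →ₗ[ℝ] (ℝ ∙ u)ᗮ) (s : ℝ)
    (x : 𝔼 n) : ℝ :=
  -2 * ⟪u, x - y⟫ - ⟪B (hyperplaneProj hu (x - y)), hyperplaneProj hu (x - y)⟫ - ⟪u, x - y⟫ ^ 2 / s

theorem continuous_ellipsoidPoly (hu : ‖u‖ = 1) (y : 𝔼 n) (B : (ℝ ∙ u)ᗮ →ₗ[ℝ] (ℝ ∙ u)ᗮ) (s : ℝ) :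
    Continuous (ellipsoidPoly hu y B s) := by
  have h1 := LinearMap.continuous_of_finiteDimensional B
  have h2 := LinearMap.continuous_of_finiteDimensional (hyperplaneProj hu)
  unfold ellipsoidPoly
  fun_prop

/-- The ellipsoid is the preimage of the unit ball under `x ↦ R (x - c)`, where `R` is a square root
of the form `B / s` on `u^⊥` plus `1 / s²` along `u`, and `‖R (x - c)‖² = 1 - q / s`. Since `det R²
= s^(-(n+1)) det B`, the powers of `s` cancel, and the density depends on `s` only through `q`. This
lets `s` be chosen freely in the comparisons. -/
theorem isConvexBody_ellipsoid_and_density {σ : Set (𝔼 n) → (𝔼 n) → ℝ}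
    (hσ : IsCovariantDensity σ) (hu : ‖u‖ = 1) (y : 𝔼 n)
    {B : (ℝ ∙ u)ᗮ →ₗ[ℝ] (ℝ ∙ u)ᗮ} (hB : B.IsSymmetric) (hpos : ∀ v, v ≠ 0 → 0 < ⟪B v, v⟫) {s : ℝ}
    (hs : 0 < s) :
    IsConvexBody {x | 0 ≤ ellipsoidPoly hu y B s x} ∧
    ∀ x, 0 < ellipsoidPoly hu y B s x → x ∈ interior {x | 0 ≤ ellipsoidPoly hu y B s x} ∧
      σ {x | 0 ≤ ellipsoidPoly hu y B s x} x =
        √(LinearMap.det B) * ellipsoidPoly hu y B s x ^ (-(((n : ℝ) + 1) / 2)) := by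
  have hpos' : ∀ v, 0 ≤ ⟪B v, v⟫ := fun v => by
    rcases eq_or_ne v 0 with rfl | hv
    · simp
    · exact (hpos v hv).le
  set G := hyperplaneExtend hu (s⁻¹ • B) (s⁻¹ ^ 2) with hG
  have hGxx : ∀ x, ⟪G x, x⟫ = s⁻¹ * ⟪B (hyperplaneProj hu x), hyperplaneProj hu x⟫ +
      s⁻¹ ^ 2 * ⟪u, x⟫ ^ 2 := fun x => by
    rw [hG, inner_hyperplaneExtend, LinearMap.smul_apply, real_inner_smul_left]; ring
  have hGsym : G.IsSymmetric := fun x z => by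
    rw [real_inner_comm (G z) x, hG, inner_hyperplaneExtend, inner_hyperplaneExtend,
      LinearMap.smul_apply, LinearMap.smul_apply, real_inner_smul_left, real_inner_smul_left, hB,
      real_inner_comm]
    ring
  obtain ⟨R, hR, hdet⟩ := exists_norm_sq_eq_inner hGsym fun x => by
    rw [hGxx]
    have := hpos' (hyperplaneProj hu x)
    positivity
  have hBdet : LinearMap.det B ≠ 0 := by
    rw [← isUnit_iff_ne_zero, ← LinearMap.isUnit_iff_isUnit_det, LinearMap.isUnit_iff_ker_eq_bot,
      LinearMap.ker_eq_bot']
    intro v hv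
    by_contra hv0
    have := hpos v hv0
    rw [hv, inner_zero_left] at this
    exact this.false
  have hGdet : LinearMap.det G = s⁻¹ ^ (n + 1) * LinearMap.det B := by
    have h1 := finrank_hyperplane hu
    rw [hG, det_hyperplaneExtend, LinearMap.det_smul, ← mul_assoc, ← pow_add]
    congr 2
    omega
  have hRdet : LinearMap.det R ≠ 0 := by
    intro h0
    rw [h0, hGdet] at hdet
    have : s⁻¹ ^ (n + 1) ≠ 0 := by positivity
    exact mul_ne_zero this hBdet (by simpa using hdet)
  let Re : (𝔼 n) ≃ₗ[ℝ] (𝔼 n) := LinearEquiv.ofIsUnitDet (f := R)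
    (v := (EuclideanSpace.basisFun (Fin n) ℝ).toBasis) (v' := (EuclideanSpace.basisFun (Fin n) ℝ).toBasis)
    (by rw [LinearMap.det_toMatrix]; exact isUnit_iff_ne_zero.2 hRdet)
  have hRe : ∀ x, Re x = R x := fun x => rfl
  have hRe' : (Re : (𝔼 n) →ₗ[ℝ] (𝔼 n)) = R := rfl
  -- The centre of the ellipsoid, from completing the square: `2t - t² / s = s - (t - s)² / s`.
  set c := y - s • u with hc
  have hT : ∀ x, ‖Re x + -(Re c)‖ ^ 2 = 1 - ellipsoidPoly hu y B s x / s := by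
    intro x
    have e1 : x - c = (x - y) + s • u := by rw [hc]; module
    rw [← sub_eq_add_neg, ← map_sub, hRe, ← hR, hGxx, e1, map_add, map_smul, hyperplaneProj_self,
      smul_zero, add_zero, inner_add_right, real_inner_smul_right, inner_self_unit hu, ellipsoidPoly]
    field_simp
    ring
  have hmem : ∀ x, 0 ≤ ellipsoidPoly hu y B s x ↔ Re x + -(Re c) ∈ Metric.closedBall (0 : 𝔼 n) 1 := by
    intro x
    rw [mem_closedBall_zero_iff, ← sq_le_one_iff₀ (norm_nonneg _), hT]
    have : 0 ≤ ellipsoidPoly hu y B s x ↔ 0 ≤ ellipsoidPoly hu y B s x / s := by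
      rw [le_div_iff₀ hs, zero_mul]
    rw [this]
    constructor <;> intro h <;> linarith
  have hbody : IsConvexBody {x | 0 ≤ ellipsoidPoly hu y B s x} := by
    have h1 := (isConvexBody_closedBall (0 : 𝔼 n) one_pos).affine_image Re.symm c
    convert h1 using 1
    ext x
    simp only [mem_ofPred_eq, hmem, mem_image]
    constructor
    · intro hx
      exact ⟨_, hx, by simp⟩
    · rintro ⟨z, hz, rfl⟩
      simpa using hz
  refine ⟨hbody, fun x hx => ?_⟩
  have hint : x ∈ interior {x | 0 ≤ ellipsoidPoly hu y B s x} :=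
    mem_interior.2 ⟨{x | 0 < ellipsoidPoly hu y B s x}, fun z hz => le_of_lt (show (0 : ℝ) < _ from hz),
      isOpen_lt continuous_const (continuous_ellipsoidPoly hu y B s), hx⟩
  refine ⟨hint, ?_⟩
  have himg : (fun x => Re x + -(Re c)) '' {x | 0 ≤ ellipsoidPoly hu y B s x} =
      Metric.closedBall 0 1 := by
    ext z
    simp only [mem_image, mem_ofPred_eq, hmem]
    constructor
    · rintro ⟨x, hx, rfl⟩; exact hx
    · intro hz
      exact ⟨Re.symm (z + Re c), by simpa using hz, by simp⟩
  rw [← hσ.affine hbody Re (-(Re c)) hint, himg, hσ.ball _ (by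
    rw [mem_ball_zero_iff, ← sq_lt_one_iff₀ (norm_nonneg _), hT]
    have : 0 < ellipsoidPoly hu y B s x / s := by positivity
    linarith), hyperbolicDensity, hT, sub_sub_cancel, hRe']
  have h1 : |LinearMap.det R| = √(LinearMap.det B) * s ^ (-(((n : ℝ) + 1) / 2)) := by
    rw [← Real.sqrt_sq_eq_abs, ← hdet, hGdet, mul_comm, Real.sqrt_mul' _ (by positivity)]
    congr 1
    rw [Real.rpow_neg hs.le, inv_pow, Real.sqrt_inv, Real.sqrt_eq_rpow, ← Real.rpow_natCast s (n + 1),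
      ← Real.rpow_mul hs.le]
    congr 2
    push_cast; ring
  rw [h1, Real.div_rpow hx.le hs.le, mul_assoc, mul_div_cancel₀]
  exact (Real.rpow_pos_of_pos hs _).ne'

end Hyperplane


/-! ### Rolling balls -/

/-- A ball of radius `ρ` rolls freely inside `C`. -/
def HasRollingBall (C : Set (𝔼 n)) (ρ : ℝ) : Prop :=
  ∀ y ∈ frontier C, ∃ u, IsOuterUnitNormal C y u ∧ Metric.closedBall (y - ρ • u) ρ ⊆ C

theorem closedBall_sub_smul_subset {y u : 𝔼 n} (hu : ‖u‖ = 1) {ρ ρ' : ℝ} (h : ρ' ≤ ρ) :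
    Metric.closedBall (y - ρ' • u) ρ' ⊆ Metric.closedBall (y - ρ • u) ρ := by
  apply Metric.closedBall_subset_closedBall'
  have : y - ρ' • u - (y - ρ • u) = (ρ - ρ') • u := by module
  rw [dist_eq_norm, this, norm_smul, hu, Real.norm_of_nonneg (sub_nonneg.2 h)]
  linarith

/-- With `p` the gradient of `g` at `y` and `u = p / ‖p‖`, the Lipschitz bound gives `g z ≤ ‖p‖ ⟪u,
z - y⟫ + L ‖z - y‖²`, while `z` in the tangent ball means `2ρ ⟪u, z - y⟫ ≤ -‖z - y‖²`. If `2ρL ≤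
‖p‖`, then `g z ≤ 0`. -/
theorem HasC11Boundary.exists_local_rollingBall {C : Set (𝔼 n)} (hC : IsConvexBody C)
    (h : HasC11Boundary C) {x₀ : 𝔼 n} (hx₀ : x₀ ∈ frontier C) :
    ∃ V ∈ 𝓝 x₀, ∃ ρ, 0 < ρ ∧ ∀ y ∈ frontier C ∩ V, ∃ u, IsOuterUnitNormal C y u ∧
      Metric.closedBall (y - ρ • u) ρ ⊆ C := by
  obtain ⟨U, g, L, hU, hxU, hg, hL, hne, hCU⟩ := h x₀ hx₀
  have hm : 0 < ‖fderiv ℝ g x₀‖ := norm_pos_iff.2 hne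
  set m := ‖fderiv ℝ g x₀‖ / 2 with hmdef
  have hev : ∀ᶠ y in 𝓝 x₀, y ∈ U ∧ m < ‖fderiv ℝ g y‖ :=
    (hU.eventually_mem hxU).and (((hL.continuousOn.continuousAt (hU.mem_nhds hxU)).norm).eventually_const_lt
      (by linarith))
  obtain ⟨δ', hδ', hball⟩ := Metric.eventually_nhds_iff_ball.1 hev
  set δ := δ' / 2 with hδdef
  have hδ : 0 < δ := by positivity
  have hm' : 0 < m := by positivity
  -- The first bound keeps the tangent ball within distance `δ` of `y`, hence in the region where
  -- `g` is controlled; the second gives `2ρ(L + 1) ≤ m < ‖fderiv ℝ g y‖`.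
  set ρ := min (δ / 4) (m / (2 * (L + 1))) with hρ
  have hρ0 : 0 < ρ := by positivity
  have hρ1 : ρ ≤ δ / 4 := min_le_left _ _
  have hρ2 : ρ * (2 * (L + 1)) ≤ m := by
    rw [← le_div_iff₀ (by positivity)]; exact min_le_right _ _
  refine ⟨Metric.ball x₀ δ, Metric.ball_mem_nhds _ hδ, ρ, hρ0, fun y hy => ?_⟩
  have hyC : y ∈ C := hC.isClosed.frontier_subset hy.1
  have hyδ : dist y x₀ < δ := hy.2
  have hyU : y ∈ U ∧ m < ‖fderiv ℝ g y‖ := hball y (by rw [Metric.mem_ball]; linarith)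
  have hgd : HasFDerivAt g (fderiv ℝ g y) y := (hg.differentiableAt (hU.mem_nhds hyU.1)).hasFDerivAt
  have hmemC : ∀ z ∈ U, (z ∈ C ↔ g z ≤ 0) := fun z hz => by
    have : z ∈ C ∩ U ↔ z ∈ {y ∈ U | g y ≤ 0} := by rw [hCU]
    simpa [hz] using this
  have hgy : g y = 0 := by
    refine le_antisymm ((hmemC y hyU.1).1 hyC) ?_
    by_contra! hlt
    apply hy.1.2
    rw [mem_interior_iff_mem_nhds]
    filter_upwards [hU.mem_nhds hyU.1, hgd.continuousAt.eventually_lt_const hlt] with z hz hz2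
    exact (hmemC z hz).2 hz2.le
  set p := (InnerProductSpace.toDual ℝ (𝔼 n)).symm (fderiv ℝ g y) with hp
  have hpn : ‖p‖ = ‖fderiv ℝ g y‖ := LinearIsometryEquiv.norm_map _ _
  have hpi : ∀ z, fderiv ℝ g y z = ⟪p, z⟫ := fun z =>
    (InnerProductSpace.toDual_symm_apply (x := z) (y := fderiv ℝ g y)).symm
  have hp0 : 0 < ‖p‖ := by rw [hpn]; linarith [hyU.2]
  have hu : ‖‖p‖⁻¹ • p‖ = 1 := by
    rw [norm_smul, norm_inv, norm_norm, inv_mul_cancel₀ hp0.ne']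
  refine ⟨‖p‖⁻¹ • p, ⟨hu, fun z hz => ?_⟩, fun z hz => ?_⟩
  · have hmax : IsLocalMaxOn g C y := by
      filter_upwards [inter_mem_nhdsWithin C (hU.mem_nhds hyU.1)] with w hw
      rw [hgy]
      exact (hmemC w hw.2).1 hw.1
    have h1 := hmax.hasFDerivWithinAt_nonpos hgd.hasFDerivWithinAt
      (sub_mem_posTangentConeAt_of_segment_subset (hC.convex.segment_subset hyC hz))
    rw [hpi] at h1
    rw [real_inner_smul_right, real_inner_comm]
    exact mul_nonpos_of_nonneg_of_nonpos (by positivity) h1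
  · set u := ‖p‖⁻¹ • p with hudef
    have hpu : p = ‖p‖ • u := by rw [hudef, smul_inv_smul₀ hp0.ne']
    have h1 : ‖(z - y) + ρ • u‖ ≤ ρ := by
      have e : z - y + ρ • u = z - (y - ρ • u) := by module
      rwa [mem_closedBall_iff_norm, ← e] at hz
    have h2 : ‖z - y‖ ^ 2 + 2 * ρ * ⟪u, z - y⟫ ≤ 0 := by
      have h3 := pow_le_pow_left₀ (norm_nonneg _) h1 2
      rw [norm_add_sq_real, real_inner_smul_right, norm_smul, hu, Real.norm_of_nonneg hρ0.le,
        real_inner_comm] at h3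
      linarith
    have h3 : ‖z - y‖ < δ := by
      have : ‖z - y‖ ≤ 2 * ρ := by
        calc ‖z - y‖ = ‖((z - y) + ρ • u) - ρ • u‖ := by rw [add_sub_cancel_right]
          _ ≤ ‖(z - y) + ρ • u‖ + ‖ρ • u‖ := norm_sub_le _ _
          _ ≤ ρ + ρ := by
              rw [norm_smul ρ u, hu, Real.norm_of_nonneg hρ0.le, mul_one]; linarith
          _ = 2 * ρ := by ring
      linarith
    have hsub : ∀ w ∈ Metric.closedBall y ‖z - y‖, w ∈ U := fun w hw => by
      refine (hball w ?_).1
      rw [Metric.mem_ball]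
      rw [Metric.mem_closedBall] at hw
      linarith [dist_triangle w y x₀]
    have hzm : z ∈ Metric.closedBall y ‖z - y‖ := by rw [mem_closedBall_iff_norm]
    have h4 := (convex_closedBall y ‖z - y‖).norm_image_sub_le_of_norm_hasFDerivWithin_le'
      (f := g) (f' := fderiv ℝ g) (φ := fderiv ℝ g y) (C := L * ‖z - y‖)
      (fun w hw => (hg.differentiableAt (hU.mem_nhds (hsub w hw))).hasFDerivAt.hasFDerivWithinAt)
      (fun w hw => by
        have := hL.dist_le_mul w (hsub w hw) y hyU.1
        rw [dist_eq_norm] at this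
        refine this.trans ?_
        gcongr
        exact hw) (Metric.mem_closedBall_self (norm_nonneg _)) hzm
    rw [hgy, sub_zero, hpi] at h4
    have h5 := (abs_le.1 h4).2
    rw [hmemC z (hsub z hzm)]
    have h6 : ⟪p, z - y⟫ = ‖p‖ * ⟪u, z - y⟫ := by
      nth_rewrite 1 [hpu]; rw [real_inner_smul_left]
    have h7 : (ρ * (2 * (L + 1))) * ‖z - y‖ ^ 2 ≤ ‖p‖ * ‖z - y‖ ^ 2 := by
      gcongr
      rw [hpn]; linarith [hyU.2]
    have h8 : ‖p‖ * (‖z - y‖ ^ 2 + 2 * ρ * ⟪u, z - y⟫) ≤ 0 :=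
      mul_nonpos_of_nonneg_of_nonpos hp0.le h2
    have h9 : 2 * ρ * g z ≤ 0 := by
      have : g z ≤ ‖p‖ * ⟪u, z - y⟫ + L * ‖z - y‖ * ‖z - y‖ := by rw [← h6]; linarith
      have h10 := mul_le_mul_of_nonneg_left this (by positivity : (0:ℝ) ≤ 2 * ρ)
      have h11 : 0 ≤ ρ * ‖z - y‖ ^ 2 := by positivity
      nlinarith
    nlinarith

/-- Compactness of the boundary turns the local radii into one radius; a minimum of radii is
admissible because the tangent balls at a point are nested. -/
theorem HasC11Boundary.exists_rollingBall {C : Set (𝔼 n)} (hC : IsConvexBody C)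
    (h : HasC11Boundary C) : ∃ ρ, 0 < ρ ∧ HasRollingBall C ρ := by
  have hcomp : IsCompact (frontier C) :=
    hC.isCompact.of_isClosed_subset isClosed_frontier hC.isClosed.frontier_subset
  suffices H : ∃ ρ, 0 < ρ ∧ ∀ y ∈ frontier C ∩ frontier C, ∃ u, IsOuterUnitNormal C y u ∧
      Metric.closedBall (y - ρ • u) ρ ⊆ C by
    obtain ⟨ρ, hρ, h1⟩ := H
    exact ⟨ρ, hρ, fun y hy => h1 y ⟨hy, hy⟩⟩
  refine hcomp.induction_on (p := fun S => ∃ ρ, 0 < ρ ∧ ∀ y ∈ frontier C ∩ S, ∃ u,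
    IsOuterUnitNormal C y u ∧ Metric.closedBall (y - ρ • u) ρ ⊆ C) ?_ ?_ ?_ ?_
  · exact ⟨1, one_pos, fun y hy => absurd hy.2 (notMem_empty y)⟩
  · rintro S T hST ⟨ρ, hρ, h1⟩
    exact ⟨ρ, hρ, fun y hy => h1 y ⟨hy.1, hST hy.2⟩⟩
  · rintro S T ⟨ρ, hρ, h1⟩ ⟨ρ', hρ', h2⟩
    refine ⟨min ρ ρ', lt_min hρ hρ', ?_⟩
    rintro y ⟨hy, hyS | hyT⟩
    · obtain ⟨u, hu, h3⟩ := h1 y ⟨hy, hyS⟩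
      exact ⟨u, hu, (closedBall_sub_smul_subset hu.1 (min_le_left _ _)).trans h3⟩
    · obtain ⟨u, hu, h3⟩ := h2 y ⟨hy, hyT⟩
      exact ⟨u, hu, (closedBall_sub_smul_subset hu.1 (min_le_right _ _)).trans h3⟩
  · intro x hx
    obtain ⟨V, hV, ρ, hρ, h1⟩ := h.exists_local_rollingBall hC hx
    exact ⟨V, mem_nhdsWithin_of_mem_nhds hV, ρ, hρ, h1⟩

namespace HasRollingBall

variable {C : Set (𝔼 n)} {ρ : ℝ} {y : 𝔼 n}

/-- If `w` is also a normal at `y`, the point of the tangent ball farthest in direction `w` lies in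
`C`, and the supporting inequality for `w` forces `⟪u, w⟫ ≥ 1`. -/
theorem existsUnique (h : HasRollingBall C ρ) (hρ : 0 < ρ) (hy : y ∈ frontier C) :
    ∃! u, IsOuterUnitNormal C y u := by
  obtain ⟨u, hu, hb⟩ := h y hy
  refine ⟨u, hu, fun w hw => ?_⟩
  have h1 : y - ρ • u + ρ • w ∈ C := hb (by
    rw [mem_closedBall_iff_norm, add_sub_cancel_left, norm_smul, hw.1, mul_one,
      Real.norm_of_nonneg hρ.le])
  have h2 := hw.2 _ h1
  have h3 : y - ρ • u + ρ • w - y = ρ • (w - u) := by module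
  rw [h3, real_inner_smul_left, inner_sub_left, inner_self_unit hw.1] at h2
  have h4 : 1 ≤ ⟪u, w⟫ := by nlinarith
  have h5 : ‖w - u‖ ^ 2 ≤ 0 := by
    rw [norm_sub_sq_real, hw.1, hu.1, real_inner_comm]; linarith
  have h6 : ‖w - u‖ = 0 := by nlinarith [norm_nonneg (w - u)]
  exact sub_eq_zero.1 (norm_eq_zero.1 h6)

theorem isOuterUnitNormal (h : HasRollingBall C ρ) (hρ : 0 < ρ) (hy : y ∈ frontier C) :
    IsOuterUnitNormal C y (outerNormal C y) := by
  have h1 := h.existsUnique hρ hy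
  rw [outerNormal, dif_pos h1]
  exact h1.choose_spec.1

theorem outerNormal_eq (h : HasRollingBall C ρ) (hρ : 0 < ρ) (hy : y ∈ frontier C) {u : 𝔼 n}
    (hu : IsOuterUnitNormal C y u) : outerNormal C y = u :=
  (h.existsUnique hρ hy).unique (h.isOuterUnitNormal hρ hy) hu

theorem closedBall_subset (h : HasRollingBall C ρ) (hρ : 0 < ρ) (hy : y ∈ frontier C) :
    Metric.closedBall (y - ρ • outerNormal C y) ρ ⊆ C := by
  obtain ⟨u, hu, hb⟩ := h y hy
  rwa [h.outerNormal_eq hρ hy hu]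

theorem continuousOn_outerNormal (h : HasRollingBall C ρ) (hρ : 0 < ρ) :
    ContinuousOn (outerNormal C) (frontier C) := by
  -- The uniqueness argument with the normal at a second boundary point `z`: the normal is Hölder
  -- continuous of exponent `1/2`.
  have key : ∀ y ∈ frontier C, ∀ z ∈ frontier C,
      ρ / 2 * ‖outerNormal C y - outerNormal C z‖ ^ 2 ≤ ‖z - y‖ := by
    intro y hy z hz
    have hny := h.isOuterUnitNormal hρ hy
    have hnz := h.isOuterUnitNormal hρ hz
    set u := outerNormal C y
    set w := outerNormal C z
    have h1 : y - ρ • u + ρ • w ∈ C := h.closedBall_subset hρ hy (by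
      rw [mem_closedBall_iff_norm, add_sub_cancel_left, norm_smul, hnz.1, mul_one,
        Real.norm_of_nonneg hρ.le])
    have h2 := hnz.2 _ h1
    have h3 : y - ρ • u + ρ • w - z = ρ • (w - u) - (z - y) := by module
    rw [h3, inner_sub_left, real_inner_smul_left, inner_sub_left, inner_self_unit hnz.1] at h2
    rw [norm_sub_sq_real, hny.1, hnz.1]
    have h4 := real_inner_le_norm (z - y) w
    rw [hnz.1, mul_one] at h4
    linarith
  intro y hy
  rw [ContinuousWithinAt, tendsto_iff_norm_sub_tendsto_zero]
  have h1 : Tendsto (fun z => √(2 / ρ * ‖z - y‖)) (𝓝[frontier C] y) (𝓝 0) := by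
    have : Continuous fun z : 𝔼 n => √(2 / ρ * ‖z - y‖) := by fun_prop
    have h2 := this.tendsto y
    simp only [sub_self, norm_zero, mul_zero, Real.sqrt_zero] at h2
    exact h2.mono_left nhdsWithin_le_nhds
  refine squeeze_zero' (Eventually.of_forall fun z => norm_nonneg _) ?_ h1
  filter_upwards [self_mem_nhdsWithin] with z hz
  apply Real.le_sqrt_of_sq_le
  have := key z hz y hy
  rw [norm_sub_rev y z] at this
  rw [div_mul_eq_mul_div, le_div_iff₀ hρ]
  linarith

end HasRollingBall

theorem IsOuterUnitNormal.le_inner {C : Set (𝔼 n)} {y u : 𝔼 n} (hu : IsOuterUnitNormal C y u)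
    {r : ℝ} (hr : 0 < r) (h : Metric.closedBall 0 r ⊆ C) : r ≤ ⟪u, y⟫ := by
  have h1 := hu.2 (r • u) (h (by simp [norm_smul, hu.1, abs_of_pos hr]))
  rw [inner_sub_left, real_inner_smul_left, inner_self_unit hu.1, real_inner_comm] at h1
  linarith


/-! ### The boundary graph and the second fundamental form -/

section Graph

variable {C : Set (𝔼 n)} {y u : 𝔼 n} {ρ : ℝ}

theorem IsOuterUnitNormal.nonneg_of_mem (hu : IsOuterUnitNormal C y u) {v : (ℝ ∙ u)ᗮ} {t : ℝ}
    (h : y + (v : 𝔼 n) - t • u ∈ C) : 0 ≤ t := by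
  have h1 := hu.2 _ h
  have e : y + (v : 𝔼 n) - t • u - y = (v : 𝔼 n) - t • u := by module
  rw [e, inner_sub_left, real_inner_comm, inner_coe_hyperplane, real_inner_smul_left,
    inner_self_unit hu.1] at h1
  linarith

theorem IsOuterUnitNormal.boundaryGraph_le (hu : IsOuterUnitNormal C y u) {v : (ℝ ∙ u)ᗮ} {t : ℝ}
    (h : y + (v : 𝔼 n) - t • u ∈ C) : boundaryGraph C y u v ≤ t :=
  csInf_le ⟨0, fun _ hs => hu.nonneg_of_mem hs⟩ h

theorem add_sub_smul_mem_of_closedBall (hball : Metric.closedBall (y - ρ • u) ρ ⊆ C)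
    {v : (ℝ ∙ u)ᗮ} (hv : ‖v‖ ≤ ρ) : y + (v : 𝔼 n) - ρ • u ∈ C := by
  apply hball
  have e : y + (v : 𝔼 n) - ρ • u - (y - ρ • u) = (v : 𝔼 n) := by module
  rwa [mem_closedBall_iff_norm, e, Submodule.norm_coe]

theorem IsOuterUnitNormal.boundaryGraph_mem (hu : IsOuterUnitNormal C y u) (hC : IsClosed C)
    (hball : Metric.closedBall (y - ρ • u) ρ ⊆ C) {v : (ℝ ∙ u)ᗮ} (hv : ‖v‖ ≤ ρ) :
    y + (v : 𝔼 n) - boundaryGraph C y u v • u ∈ C := by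
  have hc : IsClosed {t : ℝ | y + (v : 𝔼 n) - t • u ∈ C} :=
    hC.preimage (f := fun t : ℝ => y + (v : 𝔼 n) - t • u) (by fun_prop)
  exact hc.csInf_mem ⟨ρ, add_sub_smul_mem_of_closedBall hball hv⟩
    ⟨0, fun _ hs => hu.nonneg_of_mem hs⟩

/-- On the line over `v` in direction `u`, the graph point and the point at depth `ρ` both belong to
`C`, hence so does the segment between them. -/
theorem IsOuterUnitNormal.mem_of_boundaryGraph_le (hu : IsOuterUnitNormal C y u)
    (hC : IsConvexBody C) (hball : Metric.closedBall (y - ρ • u) ρ ⊆ C) {v : (ℝ ∙ u)ᗮ}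
    (hv : ‖v‖ ≤ ρ) {t : ℝ} (h1 : boundaryGraph C y u v ≤ t) (h2 : t ≤ ρ) :
    y + (v : 𝔼 n) - t • u ∈ C := by
  have hconv : Convex ℝ {t : ℝ | y + (v : 𝔼 n) - t • u ∈ C} := by
    intro a ha b hb p q hp hq hpq
    have := hC.convex ha hb hp hq hpq
    have e : y + (v : 𝔼 n) - (p • a + q • b) • u =
        p • (y + (v : 𝔼 n) - a • u) + q • (y + (v : 𝔼 n) - b • u) := by
      obtain rfl : p = 1 - q := by linarith
      module
    rwa [mem_ofPred_eq, e]
  exact hconv.ordConnected.out (hu.boundaryGraph_mem hC.isClosed hball hv)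
    (add_sub_smul_mem_of_closedBall hball hv) ⟨h1, h2⟩

theorem eq_add_hyperplaneProj (hu : ‖u‖ = 1) (x : 𝔼 n) :
    x = y + (hyperplaneProj hu (x - y) : 𝔼 n) - (-⟪u, x - y⟫) • u := by
  rw [coe_hyperplaneProj]; module

theorem IsSecondFundamentalForm.exists_bound {A : (ℝ ∙ u)ᗮ →ₗ[ℝ] (ℝ ∙ u)ᗮ}
    (hA : IsSecondFundamentalForm C y u A) {ε : ℝ} (hε : 0 < ε) :
    ∃ δ, 0 < δ ∧ ∀ v : (ℝ ∙ u)ᗮ, ‖v‖ < δ →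
      |boundaryGraph C y u v - 1 / 2 * ⟪A v, v⟫| ≤ ε * ‖v‖ ^ 2 := by
  obtain ⟨δ, hδ, h⟩ := Metric.eventually_nhds_iff.1 (hA.2.bound hε)
  refine ⟨δ, hδ, fun v hv => ?_⟩
  have := h (by rwa [dist_zero_right])
  rwa [Real.norm_eq_abs, Real.norm_eq_abs, abs_of_nonneg (sq_nonneg ‖v‖)] at this

theorem exists_pos_smul_norm_lt {F : Type*} [NormedAddCommGroup F] [NormedSpace ℝ F] (v : F) {δ : ℝ}
    (hδ : 0 < δ) : ∃ t : ℝ, 0 < t ∧ t ≤ 1 ∧ ‖t • v‖ < δ := by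
  refine ⟨min 1 (δ / (2 * (‖v‖ + 1))), by positivity, min_le_left _ _, ?_⟩
  rw [norm_smul, Real.norm_of_nonneg (by positivity)]
  calc min 1 (δ / (2 * (‖v‖ + 1))) * ‖v‖ ≤ (δ / (2 * (‖v‖ + 1))) * (‖v‖ + 1) := by
        gcongr
        · exact min_le_right _ _
        · linarith
    _ = δ / 2 := by field_simp
    _ < δ := by linarith

theorem IsSecondFundamentalForm.nonneg {A : (ℝ ∙ u)ᗮ →ₗ[ℝ] (ℝ ∙ u)ᗮ}
    (hA : IsSecondFundamentalForm C y u A) (hu : IsOuterUnitNormal C y u) (v : (ℝ ∙ u)ᗮ) :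
    0 ≤ ⟪A v, v⟫ := by
  by_contra! hlt
  have hv : 0 < ‖v‖ := by
    rw [norm_pos_iff]; rintro rfl; simp at hlt
  set ε := -⟪A v, v⟫ / (4 * ‖v‖ ^ 2) with hε
  have hε0 : 0 < ε := by have : 0 < -⟪A v, v⟫ := by linarith
                         positivity
  obtain ⟨δ, hδ, h⟩ := hA.exists_bound hε0
  obtain ⟨t, ht, -, htv⟩ := exists_pos_smul_norm_lt v hδ
  have h1 := h _ htv
  have h2 : 0 ≤ boundaryGraph C y u (t • v) :=
    Real.sInf_nonneg fun s hs => hu.nonneg_of_mem hs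
  rw [map_smul, real_inner_smul_left, real_inner_smul_right, norm_smul, mul_pow, Real.norm_eq_abs,
    sq_abs] at h1
  have h3 := (abs_le.1 h1).2
  have h4 : ε * (t ^ 2 * ‖v‖ ^ 2) = t ^ 2 * (-⟪A v, v⟫ / 4) := by rw [hε]; field_simp
  rw [h4] at h3
  have : 0 < t ^ 2 * -⟪A v, v⟫ := mul_pos (by positivity) (by linarith)
  nlinarith

theorem LinearMap.IsSymmetric.eq_zero_of_inner_self {F : Type*} [NormedAddCommGroup F]
    [InnerProductSpace ℝ F] {A : F →ₗ[ℝ] F} (hA : A.IsSymmetric) (h : ∀ v, ⟪A v, v⟫ = 0) : A = 0 := by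
  ext v
  have h1 := h (v + A v)
  rw [map_add, inner_add_left, inner_add_right, inner_add_right, h, h, hA (A v) v] at h1
  have : ⟪A v, A v⟫ = 0 := by linarith
  simpa using inner_self_eq_zero.1 this

theorem IsSecondFundamentalForm.unique {A B : (ℝ ∙ u)ᗮ →ₗ[ℝ] (ℝ ∙ u)ᗮ}
    (hA : IsSecondFundamentalForm C y u A) (hB : IsSecondFundamentalForm C y u B) : A = B := by
  rw [← sub_eq_zero]
  refine (hA.1.sub hB.1).eq_zero_of_inner_self fun v => ?_
  rcases eq_or_ne v 0 with rfl | hv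
  · simp
  have hv : 0 < ‖v‖ := norm_pos_iff.2 hv
  by_contra hne
  have hpos := abs_pos.2 hne
  set ε := |⟪(A - B) v, v⟫| / (8 * ‖v‖ ^ 2) with hε
  have hε0 : 0 < ε := by positivity
  obtain ⟨δ, hδ, h⟩ := hA.exists_bound hε0
  obtain ⟨δ', hδ', h'⟩ := hB.exists_bound hε0
  obtain ⟨t, ht, -, htv⟩ := exists_pos_smul_norm_lt v (lt_min hδ hδ')
  have h1 := h _ (htv.trans_le (min_le_left _ _))
  have h2 := h' _ (htv.trans_le (min_le_right _ _))
  rw [map_smul, real_inner_smul_left, real_inner_smul_right, norm_smul, mul_pow, Real.norm_eq_abs,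
    sq_abs] at h1 h2
  have h4 : ε * (t ^ 2 * ‖v‖ ^ 2) = t ^ 2 * |⟪(A - B) v, v⟫| / 8 := by rw [hε]; field_simp
  rw [h4] at h1 h2
  have h5 : t ^ 2 * |⟪(A - B) v, v⟫| = |t * (t * ⟪A v, v⟫) - t * (t * ⟪B v, v⟫)| := by
    rw [LinearMap.sub_apply, inner_sub_left, ← abs_of_pos (pow_pos ht 2), ← abs_mul]
    congr 1; ring
  have h6 : 0 < t ^ 2 * |⟪(A - B) v, v⟫| := by positivity
  have h1' := abs_le.1 h1
  have h2' := abs_le.1 h2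
  have : |t * (t * ⟪A v, v⟫) - t * (t * ⟪B v, v⟫)| ≤ t ^ 2 * |⟪(A - B) v, v⟫| / 2 := by
    rw [abs_le]; constructor <;> linarith
  linarith

theorem IsSecondFundamentalForm.gaussKroneckerCurvature_eq
    {A : (ℝ ∙ u)ᗮ →ₗ[ℝ] (ℝ ∙ u)ᗮ} (hA : IsSecondFundamentalForm C y u A)
    (hu : outerNormal C y = u) : gaussKroneckerCurvature C y = LinearMap.det A := by
  subst hu
  have h : ∃ A, IsSecondFundamentalForm C y (outerNormal C y) A := ⟨A, hA⟩
  rw [gaussKroneckerCurvature, dif_pos h, h.choose_spec.unique hA]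

theorem exists_inner_ge_of_det_ne_zero {F : Type*} [NormedAddCommGroup F] [InnerProductSpace ℝ F]
    [FiniteDimensional ℝ F] {A : F →ₗ[ℝ] F} (hA : A.IsSymmetric) (hpos : ∀ x, 0 ≤ ⟪A x, x⟫)
    (hdet : LinearMap.det A ≠ 0) : ∃ a, 0 < a ∧ ∀ v, a * ‖v‖ ^ 2 ≤ ⟪A v, v⟫ := by
  obtain ⟨R, hR, hRd⟩ := exists_norm_sq_eq_inner hA hpos
  have h1 : LinearMap.det R ≠ 0 := fun h => hdet (by rw [hRd, h]; simp)
  have h2 : LinearMap.ker R = ⊥ := (LinearMap.isUnit_iff_ker_eq_bot _).1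
    ((LinearMap.isUnit_iff_isUnit_det _).2 (isUnit_iff_ne_zero.2 h1))
  obtain ⟨K, hK, hanti⟩ := R.exists_antilipschitzWith h2
  refine ⟨(K : ℝ)⁻¹ ^ 2, by positivity, fun v => ?_⟩
  rw [hR, ← mul_pow]
  gcongr
  have := hanti.le_mul_dist v 0
  rw [map_zero, dist_zero_right, dist_zero_right] at this
  rwa [inv_mul_le_iff₀ (by positivity)]

/-- The inner comparison body. For small `s` the whole ellipsoid is so close to `y` that the Taylor
estimate applies, and there `f(v) ≤ ½⟨Av, v⟩ + ½ε‖v‖² ≤ ½⟨Bv, v⟩ ≤ t`. -/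
theorem ellipsoid_subset_of_secondFundamentalForm (hC : IsConvexBody C)
    (hu : IsOuterUnitNormal C y u) (hρ : 0 < ρ) (hball : Metric.closedBall (y - ρ • u) ρ ⊆ C)
    {A B : (ℝ ∙ u)ᗮ →ₗ[ℝ] (ℝ ∙ u)ᗮ} (hA : IsSecondFundamentalForm C y u A) {ε : ℝ} (hε : 0 < ε)
    (hB : ∀ v, ⟪A v, v⟫ + ε * ‖v‖ ^ 2 ≤ ⟪B v, v⟫) :
    ∃ s, 0 < s ∧ {x | 0 ≤ ellipsoidPoly hu.1 y B s x} ⊆ C := by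
  obtain ⟨δ, hδ, h⟩ := hA.exists_bound (half_pos hε)
  set μ := min δ ρ with hμ
  have hμ0 : 0 < μ := lt_min hδ hρ
  -- On the ellipsoid `t ≤ 2s` and `ε‖v‖² ≤ 2t ≤ 4s`; these choices of `s` give `t ≤ ρ` and `‖v‖² ≤
  -- μ² / 2`.
  refine ⟨min (ρ / 2) (ε * μ ^ 2 / 8), by positivity, fun x hx => ?_⟩
  set s := min (ρ / 2) (ε * μ ^ 2 / 8) with hs
  have hs0 : 0 < s := by positivity
  have hs1 : s ≤ ρ / 2 := min_le_left _ _
  have hs2 : s ≤ ε * μ ^ 2 / 8 := min_le_right _ _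
  rw [mem_ofPred_eq, ellipsoidPoly] at hx
  rw [eq_add_hyperplaneProj (y := y) hu.1 x]
  set v := hyperplaneProj hu.1 (x - y)
  obtain ⟨t, ht⟩ : ∃ t, t = -⟪u, x - y⟫ := ⟨_, rfl⟩
  have ht' : ⟪u, x - y⟫ = -t := by rw [ht]; ring
  rw [ht', neg_neg]
  rw [ht'] at hx
  have hAv := hA.nonneg hu v
  have hBv := hB v
  have hεv : 0 ≤ ε * ‖v‖ ^ 2 := by positivity
  have hq : 0 ≤ (-t) ^ 2 / s := by positivity
  have ht0 : 0 ≤ t := by linarith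
  have hts : t ≤ 2 * s := by
    have h1 : (-t) ^ 2 / s ≤ 2 * t := by linarith
    rw [div_le_iff₀ hs0] at h1
    rcases ht0.eq_or_lt with h0 | h0
    · linarith
    · by_contra! hlt; nlinarith
  have hv2 : ‖v‖ ^ 2 < μ ^ 2 := by
    have h1 : ε * ‖v‖ ^ 2 ≤ ε * (μ ^ 2 / 2) := by linarith
    have h2 := le_of_mul_le_mul_left h1 hε
    have : 0 < μ ^ 2 := by positivity
    linarith
  have hv : ‖v‖ < μ := lt_of_pow_lt_pow_left₀ 2 hμ0.le hv2
  have h3 := (abs_le.1 (h v (hv.trans_le (min_le_left _ _)))).2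
  exact hu.mem_of_boundaryGraph_le hC hball (hv.le.trans (min_le_right _ _)) (by linarith)
    (by linarith)

/-- The outer comparison. Near `y` the Taylor estimate gives the inequality even without the
quadratic term. Away from `y`, convexity and `B ≥ b > 0` bound the depth `t` from below, so a large
multiple of `t²` dominates the form on the bounded set `C`. The resulting region is not an
ellipsoid, but projectively equivalent to part of one. -/
theorem le_of_secondFundamentalForm_of_mem (hC : IsConvexBody C)
    (hu : IsOuterUnitNormal C y u) (hy : y ∈ C)
    {A B : (ℝ ∙ u)ᗮ →ₗ[ℝ] (ℝ ∙ u)ᗮ} (hA : IsSecondFundamentalForm C y u A) {ε b : ℝ} (hε : 0 < ε)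
    (hB : ∀ v, ⟪B v, v⟫ + ε * ‖v‖ ^ 2 ≤ ⟪A v, v⟫) (hb : 0 < b) (hBb : ∀ v, b * ‖v‖ ^ 2 ≤ ⟪B v, v⟫) :
    ∃ k, 0 < k ∧ ∀ x ∈ C, ⟪B (hyperplaneProj hu.1 (x - y)), hyperplaneProj hu.1 (x - y)⟫ ≤
      -2 * ⟪u, x - y⟫ + k * ⟪u, x - y⟫ ^ 2 := by
  obtain ⟨δ, hδ, h⟩ := hA.exists_bound (half_pos hε)
  obtain ⟨R, hR, hCR⟩ := hC.exists_subset_closedBall y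
  have key : ∀ x ∈ C, ‖hyperplaneProj hu.1 (x - y)‖ < δ →
      ⟪B (hyperplaneProj hu.1 (x - y)), hyperplaneProj hu.1 (x - y)⟫ ≤ -2 * ⟪u, x - y⟫ := by
    intro x hx hv
    have h1 := (abs_le.1 (h _ hv)).1
    rw [eq_add_hyperplaneProj (y := y) hu.1 x] at hx
    have h2 := hu.boundaryGraph_le hx
    have h3 := hB (hyperplaneProj hu.1 (x - y))
    linarith
  set N := ‖LinearMap.toContinuousLinearMap B‖
  -- Lower bound for the depth of the far points: contracted towards `y` until its projection has
  -- norm `δ / 2`, such a point satisfies the local inequality, so `b (δ / 2)² ≤ 2t`.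
  set τ := b * (δ / 2) ^ 2 / 2 with hτ
  have hτ0 : 0 < τ := by positivity
  refine ⟨N * R ^ 2 / τ ^ 2 + 1, by positivity, fun x hx => ?_⟩
  have ht0 : 0 ≤ -⟪u, x - y⟫ := by
    have := hu.2 x hx
    rw [real_inner_comm] at this
    linarith
  rcases lt_or_ge ‖hyperplaneProj hu.1 (x - y)‖ δ with hv | hv
  · have := key x hx hv
    have h2 : 0 ≤ (N * R ^ 2 / τ ^ 2 + 1) * ⟪u, x - y⟫ ^ 2 := by positivity
    linarith
  · have hv0 : 0 < ‖hyperplaneProj hu.1 (x - y)‖ := hδ.trans_le hv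
    set θ := δ / 2 / ‖hyperplaneProj hu.1 (x - y)‖ with hθ
    have hθ0 : 0 < θ := by positivity
    have hθ1 : θ ≤ 1 := by rw [hθ, div_le_one hv0]; linarith
    have hx' : y + θ • (x - y) ∈ C := hC.convex.add_smul_sub_mem hy hx ⟨hθ0.le, hθ1⟩
    have hnorm : ‖hyperplaneProj hu.1 (y + θ • (x - y) - y)‖ = δ / 2 := by
      rw [add_sub_cancel_left, map_smul, norm_smul, Real.norm_of_nonneg hθ0.le, hθ,
        div_mul_cancel₀ _ hv0.ne']
    have h1 := key _ hx' (by rw [hnorm]; linarith)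
    have h2 := hBb (hyperplaneProj hu.1 (y + θ • (x - y) - y))
    rw [hnorm] at h2
    have h3 := h2.trans h1
    rw [add_sub_cancel_left, real_inner_smul_right] at h3
    have h4 : τ ≤ -⟪u, x - y⟫ := by
      have : θ * -⟪u, x - y⟫ ≤ 1 * -⟪u, x - y⟫ := by gcongr
      linarith
    have h5 : ⟪B (hyperplaneProj hu.1 (x - y)), hyperplaneProj hu.1 (x - y)⟫ ≤ N * R ^ 2 := by
      have h6 := (LinearMap.toContinuousLinearMap B).le_opNorm (hyperplaneProj hu.1 (x - y))
      have h7 : ‖hyperplaneProj hu.1 (x - y)‖ ≤ R :=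
        (norm_hyperplaneProj_le hu.1 _).trans (by simpa [dist_eq_norm] using hCR hx)
      calc _ ≤ ‖B (hyperplaneProj hu.1 (x - y))‖ * ‖hyperplaneProj hu.1 (x - y)‖ :=
            real_inner_le_norm _ _
        _ ≤ (N * ‖hyperplaneProj hu.1 (x - y)‖) * ‖hyperplaneProj hu.1 (x - y)‖ := by
            gcongr; exact h6
        _ ≤ N * R * R := by gcongr
        _ = N * R ^ 2 := by ring
    have h8 : N * R ^ 2 ≤ (N * R ^ 2 / τ ^ 2) * ⟪u, x - y⟫ ^ 2 := by
      have h9 : τ ^ 2 ≤ ⟪u, x - y⟫ ^ 2 := by rw [← neg_sq ⟪u, x - y⟫]; gcongr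
      calc N * R ^ 2 = (N * R ^ 2 / τ ^ 2) * τ ^ 2 := by field_simp
        _ ≤ _ := by gcongr
    nlinarith [sq_nonneg ⟪u, x - y⟫]

end Graph


/-! ### The density near the boundary -/

section Limit

variable {C : Set (𝔼 n)} {y u : 𝔼 n} {ρ : ℝ} {σ : Set (𝔼 n) → (𝔼 n) → ℝ}

theorem ellipsoidPoly_sub_smul (hu : ‖u‖ = 1) (B : (ℝ ∙ u)ᗮ →ₗ[ℝ] (ℝ ∙ u)ᗮ) (s c : ℝ) :
    ellipsoidPoly hu y B s (y - c • y) = c * (2 * ⟪u, y⟫ -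
      c * (⟪B (hyperplaneProj hu y), hyperplaneProj hu y⟫ + ⟪u, y⟫ ^ 2 / s)) := by
  have e : y - c • y - y = (-c) • y := by module
  rw [ellipsoidPoly, e, map_smul, map_smul, real_inner_smul_left, real_inner_smul_right,
    real_inner_smul_right]
  ring

theorem tendsto_one_sub_nhdsLT : Tendsto (fun r : ℝ => 1 - r) (𝓝[<] 1) (𝓝 0) := by
  have : Continuous fun r : ℝ => 1 - r := by fun_prop
  simpa using (this.tendsto 1).mono_left nhdsWithin_le_nhds

theorem eventually_one_sub_pos : ∀ᶠ r : ℝ in 𝓝[<] 1, 0 < 1 - r := by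
  filter_upwards [self_mem_nhdsWithin] with r hr
  exact sub_pos.2 hr

/-- Along the ray to the origin the polynomial is `2c ⟪u, y⟫` to first order in `c`. The general `c
r ~ 1 - r` is needed because the projective map of the outer comparison moves `r • y` along this
ray. -/
theorem tendsto_ellipsoidPoly (hu : ‖u‖ = 1) (hy : 0 < ⟪u, y⟫) (B : (ℝ ∙ u)ᗮ →ₗ[ℝ] (ℝ ∙ u)ᗮ) (s : ℝ)
    {c : ℝ → ℝ} (hc : Tendsto (fun r => c r / (1 - r)) (𝓝[<] 1) (𝓝 1)) (p : ℝ) :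
    (∀ᶠ r in 𝓝[<] 1, 0 < ellipsoidPoly hu y B s (y - c r • y)) ∧
    Tendsto (fun r => ellipsoidPoly hu y B s (y - c r • y) ^ (-p) * (1 - r) ^ p) (𝓝[<] 1)
      (𝓝 ((2 * ⟪u, y⟫) ^ (-p))) := by
  set κ := ⟪B (hyperplaneProj hu y), hyperplaneProj hu y⟫ + ⟪u, y⟫ ^ 2 / s with hκ
  have hc0 : Tendsto c (𝓝[<] 1) (𝓝 0) := by
    have h1 := hc.mul tendsto_one_sub_nhdsLT
    rw [mul_zero] at h1
    refine h1.congr' ?_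
    filter_upwards [eventually_one_sub_pos] with r hr
    exact div_mul_cancel₀ _ hr.ne'
  have hq : Tendsto (fun r => ellipsoidPoly hu y B s (y - c r • y) / (1 - r)) (𝓝[<] 1)
      (𝓝 (2 * ⟪u, y⟫)) := by
    have h1 := hc.mul (tendsto_const_nhds (x := 2 * ⟪u, y⟫) |>.sub (hc0.mul_const κ))
    rw [zero_mul, sub_zero, one_mul] at h1
    refine h1.congr fun r => ?_
    rw [ellipsoidPoly_sub_smul, ← hκ]
    ring
  have hpos : ∀ᶠ r in 𝓝[<] 1, 0 < ellipsoidPoly hu y B s (y - c r • y) := by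
    filter_upwards [eventually_one_sub_pos, hq.eventually_const_lt (by positivity)] with r hr h1
    exact (div_pos_iff_of_pos_right hr).1 h1
  refine ⟨hpos, ?_⟩
  refine (hq.rpow_const (p := -p) (Or.inl (by positivity))).congr' ?_
  filter_upwards [eventually_one_sub_pos, hpos] with r hr h1
  rw [Real.div_rpow h1.le hr.le, Real.rpow_neg hr.le p, div_inv_eq_mul]

theorem tendsto_det_add_smul {F : Type*} [NormedAddCommGroup F] [NormedSpace ℝ F]
    [FiniteDimensional ℝ F] (A : F →ₗ[ℝ] F) :
    Tendsto (fun ε : ℝ => √(LinearMap.det (A + ε • LinearMap.id))) (𝓝 0) (𝓝 (√(LinearMap.det A))) := by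
  have h1 : Continuous fun ε : ℝ => (LinearMap.toContinuousLinearMap A +
      ε • ContinuousLinearMap.id ℝ F) := by fun_prop
  have h2 := Real.continuous_sqrt.comp (ContinuousLinearMap.continuous_det.comp h1)
  have h3 := h2.tendsto 0
  simp only [Function.comp_def, zero_smul, add_zero] at h3
  exact h3

theorem smul_mem_interior_of_mem (hC : Convex ℝ C) (h0 : (0 : 𝔼 n) ∈ interior C)
    (hy : y ∈ C) {r : ℝ} (hr0 : 0 ≤ r) (hr : r < 1) : r • y ∈ interior C := by
  have := hC.add_smul_sub_mem_interior hy h0 (t := 1 - r) ⟨by linarith, by linarith⟩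
  convert this using 1
  module

theorem inner_add_smul_id (A : (ℝ ∙ u)ᗮ →ₗ[ℝ] (ℝ ∙ u)ᗮ) (ε : ℝ) (v : (ℝ ∙ u)ᗮ) :
    ⟪(A + ε • LinearMap.id : (ℝ ∙ u)ᗮ →ₗ[ℝ] (ℝ ∙ u)ᗮ) v, v⟫ = ⟪A v, v⟫ + ε * ‖v‖ ^ 2 := by
  rw [LinearMap.add_apply, LinearMap.smul_apply, LinearMap.id_apply, inner_add_left,
    real_inner_smul_left, real_inner_self_eq_norm_sq]

theorem isSymmetric_add_smul_id {A : (ℝ ∙ u)ᗮ →ₗ[ℝ] (ℝ ∙ u)ᗮ} (hA : A.IsSymmetric) (ε : ℝ) :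
    (A + ε • LinearMap.id : (ℝ ∙ u)ᗮ →ₗ[ℝ] (ℝ ∙ u)ᗮ).IsSymmetric :=
  hA.add (LinearMap.IsSymmetric.id.smul rfl)

theorem eventually_density_le (hσ : IsCovariantDensity σ) (hC : IsConvexBody C)
    (hy : 0 < ⟪u, y⟫) (hu : IsOuterUnitNormal C y u) (hρ : 0 < ρ)
    (hball : Metric.closedBall (y - ρ • u) ρ ⊆ C) {A : (ℝ ∙ u)ᗮ →ₗ[ℝ] (ℝ ∙ u)ᗮ}
    (hA : IsSecondFundamentalForm C y u A) {ε : ℝ} (hε : 0 < ε) {a : ℝ}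
    (ha : √(LinearMap.det (A + ε • LinearMap.id)) * (2 * ⟪u, y⟫) ^ (-(((n : ℝ) + 1) / 2)) < a) :
    ∀ᶠ r in 𝓝[<] 1, σ C (r • y) * (1 - r) ^ (((n : ℝ) + 1) / 2) < a := by
  set B : (ℝ ∙ u)ᗮ →ₗ[ℝ] (ℝ ∙ u)ᗮ := A + ε • LinearMap.id with hBdef
  have hBv := inner_add_smul_id A ε
  rw [← hBdef] at hBv
  obtain ⟨s, hs, hsub⟩ := ellipsoid_subset_of_secondFundamentalForm hC hu hρ hball hA hε
    (B := B) (fun v => (hBv v).ge)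
  obtain ⟨hE, hσE⟩ := isConvexBody_ellipsoid_and_density hσ hu.1 y (isSymmetric_add_smul_id hA.1 ε)
    (fun v hv => by
      rw [hBv]
      have := hA.nonneg hu v
      have := norm_pos_iff.2 hv
      positivity) hs
  rw [← hBdef] at hE hσE
  have hc : Tendsto (fun r : ℝ => (1 - r) / (1 - r)) (𝓝[<] 1) (𝓝 1) :=
    (tendsto_const_nhds (x := (1 : ℝ))).congr' (by
      filter_upwards [eventually_one_sub_pos] with r hr
      rw [div_self hr.ne'])
  obtain ⟨hpos, hlim⟩ := tendsto_ellipsoidPoly hu.1 hy B s hc (((n : ℝ) + 1) / 2)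
  filter_upwards [hpos, eventually_one_sub_pos,
    (hlim.const_mul (√(LinearMap.det B))).eventually_lt_const ha] with r hr hr1 hr2
  refine lt_of_le_of_lt ?_ hr2
  have e : y - (1 - r) • y = r • y := by module
  rw [e] at hr ⊢
  obtain ⟨h1, h2⟩ := hσE _ hr
  rw [← mul_assoc, ← h2]
  gcongr
  exact hσ.antitone _ _ hE hC hsub _ h1

/-- The linear map that induces `x ↦ y + (x - y) / (1 - k ⟨u, x - y⟩)`. -/
noncomputable def osculatingHomogeneous (y u : 𝔼 n) (k : ℝ) :
    ((𝔼 n) × ℝ) ≃ₗ[ℝ] ((𝔼 n) × ℝ) where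
  toFun p := ((p.1 - p.2 • y) + (p.2 - k * ⟪u, p.1 - p.2 • y⟫) • y, p.2 - k * ⟪u, p.1 - p.2 • y⟫)
  invFun p := ((p.1 - p.2 • y) + (p.2 + k * ⟪u, p.1 - p.2 • y⟫) • y, p.2 + k * ⟪u, p.1 - p.2 • y⟫)
  map_add' p q := by
    ext1
    · simp only [Prod.fst_add, Prod.snd_add, inner_add_right, inner_sub_right, real_inner_smul_right]
      module
    · simp only [Prod.fst_add, Prod.snd_add, inner_add_right, inner_sub_right, real_inner_smul_right]
      ring
  map_smul' c p := by
    ext1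
    · simp only [Prod.smul_fst, Prod.smul_snd, inner_sub_right, real_inner_smul_right,
        RingHom.id_apply, smul_eq_mul]
      module
    · simp only [Prod.smul_fst, Prod.smul_snd, inner_sub_right, real_inner_smul_right,
        RingHom.id_apply, smul_eq_mul]
      ring
  left_inv p := by
    ext1
    · simp
    · simp
  right_inv p := by
    ext1
    · simp
    · simp

theorem projectiveDenom_osculating (y u : 𝔼 n) (k : ℝ) (x : 𝔼 n) :
    projectiveDenom (osculatingHomogeneous y u k) x = 1 - k * ⟪u, x - y⟫ := by
  simp [projectiveDenom, osculatingHomogeneous]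

theorem projectiveMap_osculating {k : ℝ} {x : 𝔼 n} (h : 1 - k * ⟪u, x - y⟫ ≠ 0) :
    projectiveMap (osculatingHomogeneous y u k) x = y + (1 - k * ⟪u, x - y⟫)⁻¹ • (x - y) := by
  refine (projectiveMap_eq_of_apply_eq h ?_).2
  ext1
  · simp only [osculatingHomogeneous, LinearEquiv.coe_mk, LinearMap.coe_mk, AddHom.coe_mk, one_smul,
      Prod.smul_mk, smul_add, smul_inv_smul₀ h]
    abel
  · simp [osculatingHomogeneous]

theorem projectiveDeriv_osculating_self (y u : 𝔼 n) (k : ℝ) :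
    projectiveDeriv (osculatingHomogeneous y u k) y = LinearMap.id := by
  ext1 v
  rw [projectiveDeriv_apply, projectiveMap_osculating (by simp), projectiveDenom_osculating]
  simp [osculatingHomogeneous]

/-- The map `x ↦ y + (x - y) / (1 + k t)` takes the region `⟨Bv, v⟩ ≤ 2t + k t²`, `t ≥ 0`, into the
ellipsoid `⟨Bv, v⟩ ≤ 2t - k t²`. So the image of `C` lies in an ellipsoid with `s = 1 / k`, and
monotonicity and covariance bound the density of `C` from below. -/
theorem eventually_lt_density (hσ : IsCovariantDensity σ) (hC : IsConvexBody C)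
    (h0 : (0 : 𝔼 n) ∈ interior C) (hyC : y ∈ C)
    (hy : 0 < ⟪u, y⟫) (hu : IsOuterUnitNormal C y u)
    {A : (ℝ ∙ u)ᗮ →ₗ[ℝ] (ℝ ∙ u)ᗮ} (hA : IsSecondFundamentalForm C y u A) {ε b : ℝ} (hε : 0 < ε)
    (hb : 0 < b) (hAb : ∀ v, (b + ε) * ‖v‖ ^ 2 ≤ ⟪A v, v⟫) {a : ℝ}
    (ha : a < √(LinearMap.det (A + (-ε) • LinearMap.id)) * (2 * ⟪u, y⟫) ^ (-(((n : ℝ) + 1) / 2))) :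
    ∀ᶠ r in 𝓝[<] 1, a < σ C (r • y) * (1 - r) ^ (((n : ℝ) + 1) / 2) := by
  set B : (ℝ ∙ u)ᗮ →ₗ[ℝ] (ℝ ∙ u)ᗮ := A + (-ε) • LinearMap.id with hBdef
  have hBv := inner_add_smul_id A (-ε)
  rw [← hBdef] at hBv
  have hBb : ∀ v, b * ‖v‖ ^ 2 ≤ ⟪B v, v⟫ := fun v => by
    rw [hBv]; linarith [hAb v]
  obtain ⟨k, hk, hsub⟩ := le_of_secondFundamentalForm_of_mem hC hu hyC hA hε (B := B)
    (fun v => by rw [hBv]; linarith) hb hBb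
  obtain ⟨hE, hσE⟩ := isConvexBody_ellipsoid_and_density hσ hu.1 y
    (isSymmetric_add_smul_id hA.1 (-ε))
    (fun v hv => by
      rw [← hBdef]
      have := norm_pos_iff.2 hv
      exact lt_of_lt_of_le (by positivity) (hBb v)) (inv_pos.2 hk)
  rw [← hBdef] at hE hσE
  set M := osculatingHomogeneous y u k with hM
  have hw1 : ∀ x ∈ C, 1 ≤ 1 - k * ⟪u, x - y⟫ := fun x hx => by
    have h1 := hu.2 x hx
    rw [real_inner_comm] at h1
    nlinarith
  have hden : ∀ x ∈ C, 0 < projectiveDenom M x := fun x hx => by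
    rw [hM, projectiveDenom_osculating]; linarith [hw1 x hx]
  have hPE : projectiveMap M '' C ⊆ {x | 0 ≤ ellipsoidPoly hu.1 y B k⁻¹ x} := by
    rintro _ ⟨x, hx, rfl⟩
    have hw := hw1 x hx
    have h1 := hsub x hx
    rw [hM, projectiveMap_osculating (by linarith), mem_ofPred_eq, ellipsoidPoly, add_sub_cancel_left,
      map_smul, map_smul, real_inner_smul_left, real_inner_smul_right, real_inner_smul_right,
      div_inv_eq_mul]
    set w := 1 - k * ⟪u, x - y⟫ with hwdef
    have hw0 : 0 < w := by linarith
    have : -2 * (w⁻¹ * ⟪u, x - y⟫) -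
        w⁻¹ * (w⁻¹ * ⟪B (hyperplaneProj hu.1 (x - y)), hyperplaneProj hu.1 (x - y)⟫) -
        (w⁻¹ * ⟪u, x - y⟫) ^ 2 * k = w⁻¹ ^ 2 * (-2 * ⟪u, x - y⟫ + k * ⟪u, x - y⟫ ^ 2 -
          ⟪B (hyperplaneProj hu.1 (x - y)), hyperplaneProj hu.1 (x - y)⟫) := by
      field_simp
      rw [hwdef]
      ring
    rw [this]
    have : 0 ≤ w⁻¹ ^ 2 := by positivity
    exact mul_nonneg this (by linarith)
  have hPC := hC.projectiveMap_image hden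
  -- The image of `r • y` is `y - c r • y`, since `r • y` has depth `t = (1 - r) ⟪u, y⟫`.
  set c : ℝ → ℝ := fun r => (1 + k * ⟪u, y⟫ * (1 - r))⁻¹ * (1 - r) with hcdef
  have hc : Tendsto (fun r => c r / (1 - r)) (𝓝[<] 1) (𝓝 1) := by
    have h1 := ((tendsto_one_sub_nhdsLT.const_mul (k * ⟪u, y⟫)).const_add 1).inv₀ (by simp)
    rw [mul_zero, add_zero, inv_one] at h1
    refine h1.congr' ?_
    filter_upwards [eventually_one_sub_pos] with r hr
    rw [hcdef, mul_div_cancel_right₀ _ hr.ne']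
  obtain ⟨hpos, hlim⟩ := tendsto_ellipsoidPoly hu.1 hy B k⁻¹ hc (((n : ℝ) + 1) / 2)
  -- The Jacobian is continuous and equals `1` at `y`, so it does not affect the limit.
  have hdet : Tendsto (fun r : ℝ => |LinearMap.det (projectiveDeriv M (r • y))|) (𝓝[<] 1) (𝓝 1) := by
    have hopen : IsOpen {x | projectiveDenom M x ≠ 0} :=
      isOpen_ne_fun (continuous_projectiveDenom M) continuous_const
    have h1 := (continuousOn_abs_det_projectiveDeriv (M := M) (s := {x | projectiveDenom M x ≠ 0})
      (fun x hx => hx)).continuousAt (hopen.mem_nhds (hden y hyC).ne')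
    rw [ContinuousAt, hM, projectiveDeriv_osculating_self, LinearMap.det_id, abs_one] at h1
    have h2 : Tendsto (fun r : ℝ => r • y) (𝓝[<] 1) (𝓝 y) := by
      have : Continuous fun r : ℝ => r • y := by fun_prop
      simpa using (this.tendsto 1).mono_left nhdsWithin_le_nhds
    exact h1.comp h2
  have hlim2 := hdet.mul (hlim.const_mul (√(LinearMap.det B)))
  rw [one_mul] at hlim2
  have hr0 : ∀ᶠ r : ℝ in 𝓝[<] 1, 0 < r :=
    nhdsWithin_le_nhds (eventually_gt_nhds one_pos)
  filter_upwards [hpos, eventually_one_sub_pos, hr0, hlim2.eventually_const_lt ha] with r hr hr1 hr3 hr2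
  refine hr2.trans_le ?_
  have hrint : r • y ∈ interior C :=
    smul_mem_interior_of_mem hC.convex h0 hyC hr3.le (by linarith)
  have hrC := interior_subset hrint
  have e1 : r • y - y = -((1 - r) • y) := by module
  have e : y - c r • y = projectiveMap M (r • y) := by
    rw [hM, projectiveMap_osculating (by linarith [hw1 _ hrC]), e1, inner_neg_right,
      real_inner_smul_right]
    have : 1 - k * -((1 - r) * ⟪u, y⟫) = 1 + k * ⟪u, y⟫ * (1 - r) := by ring
    rw [this, hcdef]
    module
  rw [e] at hr ⊢
  obtain ⟨h1, h2⟩ := hσE _ hr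
  rw [← hσ.covariant C hC M hden _ hrint, mul_assoc]
  refine mul_le_mul_of_nonneg_left ?_ (abs_nonneg _)
  rw [← mul_assoc, ← h2]
  gcongr
  exact hσ.antitone _ _ hPC hE hPE _ (projectiveMap_mem_interior (hden _ hrC).ne' hrint)

theorem tendsto_density_mul (hσ : IsCovariantDensity σ) (hC : IsConvexBody C)
    (h0 : (0 : 𝔼 n) ∈ interior C) (hyC : y ∈ C)
    (hy : 0 < ⟪u, y⟫) (hu : IsOuterUnitNormal C y u) (hρ : 0 < ρ)
    (hball : Metric.closedBall (y - ρ • u) ρ ⊆ C) {A : (ℝ ∙ u)ᗮ →ₗ[ℝ] (ℝ ∙ u)ᗮ}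
    (hA : IsSecondFundamentalForm C y u A) :
    Tendsto (fun r => σ C (r • y) * (1 - r) ^ (((n : ℝ) + 1) / 2)) (𝓝[<] 1)
      (𝓝 (√(LinearMap.det A) * (2 * ⟪u, y⟫) ^ (-(((n : ℝ) + 1) / 2)))) := by
  have hdet := (tendsto_det_add_smul A).mul_const ((2 * ⟪u, y⟫) ^ (-(((n : ℝ) + 1) / 2)))
  refine tendsto_order.2 ⟨fun a ha => ?_, fun a ha => ?_⟩
  -- For degenerate `A` the form `A - ε` is not positive definite and gives no ellipsoid, but the
  -- limit is then `0` and non-negativity suffices.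
  · by_cases hA0 : LinearMap.det A = 0
    · rw [hA0, Real.sqrt_zero, zero_mul] at ha
      have hr0 : ∀ᶠ r : ℝ in 𝓝[<] 1, 0 < r := nhdsWithin_le_nhds (eventually_gt_nhds one_pos)
      filter_upwards [hr0, eventually_one_sub_pos] with r h1 h2
      have := hσ.nonneg C hC (r • y)
        (smul_mem_interior_of_mem hC.convex h0 hyC h1.le (by linarith))
      exact ha.trans_le (by positivity)
    · obtain ⟨b, hb, hAb⟩ := exists_inner_ge_of_det_ne_zero hA.1 (hA.nonneg hu) hA0
      have h1 : Tendsto (fun ε : ℝ => -ε) (𝓝[>] 0) (𝓝 0) := by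
        have : Continuous fun ε : ℝ => -ε := by fun_prop
        simpa using (this.tendsto 0).mono_left nhdsWithin_le_nhds
      have h2 := (hdet.comp h1).eventually_const_lt ha
      have h3 : ∀ᶠ ε : ℝ in 𝓝[>] 0, ε < b := nhdsWithin_le_nhds (eventually_lt_nhds hb)
      obtain ⟨ε, h4, h5, h6⟩ := (h2.and (h3.and self_mem_nhdsWithin)).exists
      exact eventually_lt_density hσ hC h0 hyC hy hu hA h6 (b := b - ε) (by linarith)
        (fun v => by rw [sub_add_cancel]; exact hAb v) h4
  · have h2 := (hdet.mono_left (nhdsWithin_le_nhds (s := Ioi 0))).eventually_lt_const ha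
    obtain ⟨ε, h4, h5⟩ := (h2.and self_mem_nhdsWithin).exists
    exact eventually_density_le hσ hC hy hu hρ hball hA h5 h4

end Limit


/-! ### Uniform bounds -/

section Bounds

variable {C : Set (𝔼 n)} {y u : 𝔼 n} {ρ : ℝ} {σ : Set (𝔼 n) → (𝔼 n) → ℝ}

/-- The rolling ball itself is the ellipsoid with `B = ρ⁻¹` and `s = ρ`. Comparison with it bounds
the rescaled density by a constant that does not depend on the boundary point; this supplies the
domination. -/
theorem density_mul_le (hσ : IsCovariantDensity σ) (hC : IsConvexBody C)
    (hu : IsOuterUnitNormal C y u) (hρ : 0 < ρ)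
    (hball : Metric.closedBall (y - ρ • u) ρ ⊆ C) {b : ℝ} (hb : 0 < b) (hbu : b ≤ ⟪u, y⟫) {r : ℝ}
    (hr : r < 1) (hr' : (1 - r) * (‖y‖ ^ 2 / ρ) ≤ b) :
    σ C (r • y) * (1 - r) ^ (((n : ℝ) + 1) / 2) ≤
      √(ρ⁻¹ ^ (n - 1)) * b ^ (-(((n : ℝ) + 1) / 2)) := by
  set B : (ℝ ∙ u)ᗮ →ₗ[ℝ] (ℝ ∙ u)ᗮ := ρ⁻¹ • LinearMap.id with hBdef
  have hBv : ∀ v, ⟪B v, v⟫ = ρ⁻¹ * ‖v‖ ^ 2 := fun v => by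
    rw [hBdef, LinearMap.smul_apply, real_inner_smul_left, LinearMap.id_apply,
      real_inner_self_eq_norm_sq]
  obtain ⟨hE, hσE⟩ := isConvexBody_ellipsoid_and_density hσ hu.1 y (B := B)
    (LinearMap.IsSymmetric.id.smul rfl) (fun v hv => by
      have := norm_pos_iff.2 hv
      rw [hBv]; positivity) hρ
  have hdet : LinearMap.det B = ρ⁻¹ ^ (n - 1) := by
    have := finrank_hyperplane hu.1
    rw [hBdef, LinearMap.det_smul, LinearMap.det_id, mul_one]
    congr 1; omega
  have hpoly : ∀ x, ellipsoidPoly hu.1 y B ρ x = -2 * ⟪u, x - y⟫ - ‖x - y‖ ^ 2 / ρ := fun x => by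
    rw [ellipsoidPoly, hBv, norm_sq_eq_hyperplane hu.1 (x - y)]; ring
  have hsub : {x | 0 ≤ ellipsoidPoly hu.1 y B ρ x} ⊆ C := fun x hx => by
    apply hball
    rw [mem_ofPred_eq, hpoly] at hx
    have e : x - (y - ρ • u) = (x - y) + ρ • u := by module
    rw [mem_closedBall_iff_norm, e]
    apply le_of_sq_le_sq _ hρ.le
    rw [norm_add_sq_real, norm_smul, hu.1, real_inner_smul_right, real_inner_comm,
      Real.norm_of_nonneg hρ.le]
    have := mul_nonneg hρ.le hx
    have h2 : ρ * (‖x - y‖ ^ 2 / ρ) = ‖x - y‖ ^ 2 := by field_simp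
    nlinarith
  have hr0 : 0 < 1 - r := by linarith
  -- The polynomial equals `2(1 - r)⟪u, y⟫ - (1 - r)² ‖y‖² / ρ`; `hr'` lets the second term use up
  -- at most half of the lower bound `2b(1 - r)` for the first.
  have hq : b * (1 - r) ≤ ellipsoidPoly hu.1 y B ρ (r • y) := by
    have e : r • y - y = -((1 - r) • y) := by module
    rw [hpoly, e, inner_neg_right, norm_neg, norm_smul, Real.norm_of_nonneg hr0.le,
      real_inner_smul_right]
    have h1 : ((1 - r) * ‖y‖) ^ 2 / ρ = (1 - r) * ((1 - r) * (‖y‖ ^ 2 / ρ)) := by ring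
    have h2 := mul_le_mul_of_nonneg_left hr' hr0.le
    have h3 := mul_le_mul_of_nonneg_left hbu hr0.le
    rw [h1]
    linarith
  have hq0 : 0 < ellipsoidPoly hu.1 y B ρ (r • y) := lt_of_lt_of_le (by positivity) hq
  obtain ⟨h1, h2⟩ := hσE _ hq0
  have hb1 : b ^ (-(((n : ℝ) + 1) / 2)) =
      (b * (1 - r)) ^ (-(((n : ℝ) + 1) / 2)) * (1 - r) ^ (((n : ℝ) + 1) / 2) := by
    rw [Real.mul_rpow hb.le hr0.le, mul_assoc, ← Real.rpow_add hr0]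
    simp
  rw [hb1, ← mul_assoc]
  gcongr
  refine (hσ.antitone _ _ hE hC hsub _ h1).trans ?_
  rw [h2, hdet]
  refine mul_le_mul_of_nonneg_left ?_ (Real.sqrt_nonneg _)
  exact Real.rpow_le_rpow_of_nonpos (by positivity) hq (neg_nonpos.2 (by positivity))

theorem HasRollingBall.exists_density_bound (h : HasRollingBall C ρ) (hρ : 0 < ρ)
    (hC : IsConvexBody C) (h0 : (0 : 𝔼 n) ∈ interior C) (hσ : IsCovariantDensity σ) :
    ∃ K, ∀ᶠ r in 𝓝[<] 1, ∀ y ∈ frontier C,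
      σ C (r • y) * (1 - r) ^ (((n : ℝ) + 1) / 2) ≤ K := by
  obtain ⟨b, hb, hbC⟩ := IsConvexBody.exists_closedBall_subset h0
  obtain ⟨R, hR, hCR⟩ := hC.exists_subset_closedBall 0
  refine ⟨√(ρ⁻¹ ^ (n - 1)) * b ^ (-(((n : ℝ) + 1) / 2)), ?_⟩
  have h1 := tendsto_one_sub_nhdsLT.mul_const (R ^ 2 / ρ)
  rw [zero_mul] at h1
  filter_upwards [eventually_one_sub_pos, h1.eventually_le_const hb] with r hr hr2 y hy
  have hu := h.isOuterUnitNormal hρ hy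
  refine density_mul_le hσ hC hu hρ (h.closedBall_subset hρ hy) hb (hu.le_inner hb hbC)
    (by linarith) (le_trans ?_ hr2)
  have : ‖y‖ ≤ R := by simpa using hCR (hC.isClosed.frontier_subset hy)
  gcongr

theorem HasRollingBall.tendsto_density_mul (h : HasRollingBall C ρ) (hρ : 0 < ρ)
    (hC : IsConvexBody C) (h0 : (0 : 𝔼 n) ∈ interior C) (hσ : IsCovariantDensity σ)
    (hy : y ∈ frontier C) (hA : ∃ A, IsSecondFundamentalForm C y (outerNormal C y) A) :
    Tendsto (fun r => σ C (r • y) * (1 - r) ^ (((n : ℝ) + 1) / 2)) (𝓝[<] 1)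
      (𝓝 (√(gaussKroneckerCurvature C y) *
        (2 * ⟪outerNormal C y, y⟫) ^ (-(((n : ℝ) + 1) / 2)))) := by
  obtain ⟨A, hA⟩ := hA
  obtain ⟨b, hb, hbC⟩ := IsConvexBody.exists_closedBall_subset h0
  have hu := h.isOuterUnitNormal hρ hy
  rw [hA.gaussKroneckerCurvature_eq rfl]
  exact _root_.tendsto_density_mul hσ hC h0 (hC.isClosed.frontier_subset hy)
    (hb.trans_le (hu.le_inner hb hbC)) hu hρ (h.closedBall_subset hρ hy) hA

theorem gaussKroneckerCurvature_eq_zero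
    (h : ¬ ∃ A, IsSecondFundamentalForm C y (outerNormal C y) A) :
    gaussKroneckerCurvature C y = 0 := by
  rw [gaussKroneckerCurvature, dif_neg h]

theorem HasRollingBall.gaussKroneckerCurvature_nonneg (h : HasRollingBall C ρ) (hρ : 0 < ρ)
    (hy : y ∈ frontier C) : 0 ≤ gaussKroneckerCurvature C y := by
  by_cases hA : ∃ A, IsSecondFundamentalForm C y (outerNormal C y) A
  · obtain ⟨A, hA⟩ := hA
    obtain ⟨R, -, hR⟩ := exists_norm_sq_eq_inner hA.1 (hA.nonneg (h.isOuterUnitNormal hρ hy))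
    rw [hA.gaussKroneckerCurvature_eq rfl, hR]
    positivity
  · exact (gaussKroneckerCurvature_eq_zero hA).ge

/-- The curvature is read off from the limit of the rescaled Busemann density, so the uniform bound
for that density passes to the curvature. -/
theorem HasRollingBall.exists_curvature_bound (h : HasRollingBall C ρ) (hρ : 0 < ρ)
    (hC : IsConvexBody C) (h0 : (0 : 𝔼 n) ∈ interior C) :
    ∃ K, ∀ y ∈ frontier C, gaussKroneckerCurvature C y ≤ K := by
  obtain ⟨K, hK⟩ := h.exists_density_bound hρ hC h0 isCovariantDensity_busemannDensity
  obtain ⟨R, hR, hCR⟩ := hC.exists_subset_closedBall 0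
  obtain ⟨b, hb, hbC⟩ := IsConvexBody.exists_closedBall_subset h0
  refine ⟨(K * (2 * R) ^ (((n : ℝ) + 1) / 2)) ^ 2, fun y hy => ?_⟩
  by_cases hA : ∃ A, IsSecondFundamentalForm C y (outerNormal C y) A
  · have h1 := le_of_tendsto
      (h.tendsto_density_mul hρ hC h0 isCovariantDensity_busemannDensity hy hA)
      (hK.mono fun r hr => hr y hy)
    have hu := h.isOuterUnitNormal hρ hy
    have hpos : 0 < ⟪outerNormal C y, y⟫ := hb.trans_le (hu.le_inner hb hbC)
    have hle : ⟪outerNormal C y, y⟫ ≤ R := by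
      have h2 := real_inner_le_norm (outerNormal C y) y
      rw [hu.1, one_mul] at h2
      exact h2.trans (by simpa using hCR (hC.isClosed.frontier_subset hy))
    rw [← Real.sq_sqrt (h.gaussKroneckerCurvature_nonneg hρ hy)]
    apply pow_le_pow_left₀ (Real.sqrt_nonneg _)
    rw [Real.rpow_neg (by positivity), ← div_eq_mul_inv, div_le_iff₀ (by positivity)] at h1
    have hK0 : 0 ≤ K := by
      by_contra! hlt
      have h3 : K * (2 * ⟪outerNormal C y, y⟫) ^ (((n : ℝ) + 1) / 2) < 0 :=
        mul_neg_of_neg_of_pos hlt (by positivity)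
      linarith [Real.sqrt_nonneg (gaussKroneckerCurvature C y)]
    refine h1.trans ?_
    gcongr
  · rw [gaussKroneckerCurvature_eq_zero hA]
    positivity

end Bounds

/-! ### Homothets -/

section Scaling

variable {C : Set (𝔼 n)} {y u : 𝔼 n} {ρ r : ℝ}

theorem isOuterUnitNormal_smul_iff (hr : 0 < r) :
    IsOuterUnitNormal (r • C) (r • y) u ↔ IsOuterUnitNormal C y u := by
  refine and_congr_right fun _ => ?_
  constructor
  · intro h z hz
    have := h (r • z) (smul_mem_smul_set hz)
    rw [← smul_sub, real_inner_smul_left] at this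
    exact nonpos_of_mul_nonpos_right this hr
  · rintro h _ ⟨z, hz, rfl⟩
    simp only [← smul_sub, real_inner_smul_left]
    exact mul_nonpos_of_nonneg_of_nonpos hr.le (h z hz)

theorem outerNormal_smul (hr : 0 < r) : outerNormal (r • C) (r • y) = outerNormal C y := by
  have hiff : (∃! u, IsOuterUnitNormal (r • C) (r • y) u) ↔ ∃! u, IsOuterUnitNormal C y u :=
    existsUnique_congr fun _ => isOuterUnitNormal_smul_iff hr
  by_cases h : ∃! u, IsOuterUnitNormal C y u
  · have h' := hiff.2 h
    rw [outerNormal, outerNormal, dif_pos h, dif_pos h']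
    exact h.unique ((isOuterUnitNormal_smul_iff hr).1 h'.choose_spec.1) h.choose_spec.1
  · rw [outerNormal, outerNormal, dif_neg h, dif_neg (mt hiff.1 h)]

theorem boundaryGraph_smul (hr : 0 < r) (v : (ℝ ∙ u)ᗮ) :
    boundaryGraph (r • C) (r • y) u (r • v) = r * boundaryGraph C y u v := by
  have : {t : ℝ | r • y + ((r • v : (ℝ ∙ u)ᗮ) : 𝔼 n) - t • u ∈ r • C} =
      r • {t : ℝ | y + (v : 𝔼 n) - t • u ∈ C} := by
    ext t
    rw [mem_smul_set_iff_inv_smul_mem₀ hr.ne', mem_ofPred_eq, mem_ofPred_eq,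
      mem_smul_set_iff_inv_smul_mem₀ hr.ne', smul_sub, smul_add, Submodule.coe_smul,
      inv_smul_smul₀ hr.ne', inv_smul_smul₀ hr.ne', smul_smul, smul_eq_mul]
  rw [boundaryGraph, this, Real.sInf_smul_of_nonneg hr.le, smul_eq_mul, boundaryGraph]

theorem IsSecondFundamentalForm.smul {A : (ℝ ∙ u)ᗮ →ₗ[ℝ] (ℝ ∙ u)ᗮ}
    (hA : IsSecondFundamentalForm C y u A) (hr : 0 < r) :
    IsSecondFundamentalForm (r • C) (r • y) u (r⁻¹ • A) := by
  refine ⟨hA.1.smul rfl, ?_⟩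
  refine Asymptotics.IsLittleO.of_bound fun c hc => ?_
  obtain ⟨δ, hδ, h⟩ := hA.exists_bound (ε := c * r) (by positivity)
  refine Metric.eventually_nhds_iff.2 ⟨r * δ, by positivity, fun v hv => ?_⟩
  rw [dist_zero_right] at hv
  have hn : ‖r⁻¹ • v‖ = r⁻¹ * ‖v‖ := by rw [norm_smul, Real.norm_of_nonneg (by positivity)]
  have h1 := h (r⁻¹ • v) (by rw [hn, inv_mul_lt_iff₀ hr]; exact hv)
  have h2 := boundaryGraph_smul (C := C) (y := y) hr (r⁻¹ • v)
  rw [smul_inv_smul₀ hr.ne'] at h2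
  rw [h2, Real.norm_eq_abs, Real.norm_of_nonneg (sq_nonneg ‖v‖), LinearMap.smul_apply,
    real_inner_smul_left]
  rw [hn, map_smul, real_inner_smul_left, real_inner_smul_right] at h1
  have e : r * boundaryGraph C y u (r⁻¹ • v) - 1 / 2 * (r⁻¹ * ⟪A v, v⟫) =
      r * (boundaryGraph C y u (r⁻¹ • v) - 1 / 2 * (r⁻¹ * (r⁻¹ * ⟪A v, v⟫))) := by
    field_simp
  rw [e, abs_mul, abs_of_pos hr]
  calc _ ≤ r * (c * r * (r⁻¹ * ‖v‖) ^ 2) := by gcongr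
    _ = c * ‖v‖ ^ 2 := by field_simp

theorem gaussKroneckerCurvature_smul (hr : 0 < r) (hu : ‖outerNormal C y‖ = 1) :
    gaussKroneckerCurvature (r • C) (r • y) = r⁻¹ ^ (n - 1) * gaussKroneckerCurvature C y := by
  have hn := outerNormal_smul (C := C) (y := y) hr
  have hfin := finrank_hyperplane hu
  by_cases hA : ∃ A, IsSecondFundamentalForm C y (outerNormal C y) A
  · obtain ⟨A, hA⟩ := hA
    have h1 := hA.smul hr
    rw [h1.gaussKroneckerCurvature_eq hn, hA.gaussKroneckerCurvature_eq rfl, LinearMap.det_smul]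
    congr 2; omega
  · rw [gaussKroneckerCurvature_eq_zero hA, gaussKroneckerCurvature_eq_zero, mul_zero]
    rw [hn]
    rintro ⟨A, h1⟩
    have h2 := h1.smul (inv_pos.2 hr)
    rw [inv_smul_smul₀ hr.ne', inv_smul_smul₀ hr.ne'] at h2
    exact hA ⟨_, h2⟩

end Scaling


/-! ### Measurability of the curvature -/

section Measurability

variable {C : Set (𝔼 n)} {y u : 𝔼 n} {ρ : ℝ}

theorem boundaryGraph_le_norm_sq_div (hu : IsOuterUnitNormal C y u) (hρ : 0 < ρ)
    (hball : Metric.closedBall (y - ρ • u) ρ ⊆ C) {v : (ℝ ∙ u)ᗮ} (hv : ‖v‖ ≤ ρ) :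
    boundaryGraph C y u v ≤ ‖v‖ ^ 2 / ρ := by
  apply hu.boundaryGraph_le
  apply hball
  have e : y + (v : 𝔼 n) - (‖v‖ ^ 2 / ρ) • u - (y - ρ • u) = (v : 𝔼 n) + (ρ - ‖v‖ ^ 2 / ρ) • u := by
    module
  rw [mem_closedBall_iff_norm, e]
  apply le_of_sq_le_sq _ hρ.le
  rw [norm_add_sq_real, real_inner_smul_right, real_inner_comm, inner_coe_hyperplane, norm_smul,
    hu.1, Submodule.norm_coe, Real.norm_eq_abs, mul_one, sq_abs]
  have h1 : ‖v‖ ^ 2 / ρ ≤ ρ := by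
    rw [div_le_iff₀ hρ, ← sq]; gcongr
  have h2 : ‖v‖ ^ 2 = ρ * (‖v‖ ^ 2 / ρ) := by field_simp
  have h3 : 0 ≤ ‖v‖ ^ 2 / ρ := by positivity
  nlinarith

theorem IsOuterUnitNormal.boundaryGraph_mem_frontier (hu : IsOuterUnitNormal C y u) (hC : IsClosed C)
    (hball : Metric.closedBall (y - ρ • u) ρ ⊆ C) {v : (ℝ ∙ u)ᗮ} (hv : ‖v‖ ≤ ρ) :
    y + (v : 𝔼 n) - boundaryGraph C y u v • u ∈ frontier C := by
  refine ⟨subset_closure (hu.boundaryGraph_mem hC hball hv), fun hint => ?_⟩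
  have hcont : Continuous fun s : ℝ => y + (v : 𝔼 n) - (boundaryGraph C y u v - s) • u := by fun_prop
  have h1 : ∀ᶠ s : ℝ in 𝓝 0, y + (v : 𝔼 n) - (boundaryGraph C y u v - s) • u ∈ C :=
    hcont.continuousAt.eventually_mem (by rw [sub_zero]; exact mem_interior_iff_mem_nhds.1 hint)
  obtain ⟨s, h2, h3⟩ :=
    ((h1.filter_mono (nhdsWithin_le_nhds (s := Ioi 0))).and self_mem_nhdsWithin).exists
  have := hu.boundaryGraph_le h2
  have h4 : 0 < s := h3
  linarith

/-- A boundary point near `y` strictly deeper than the graph would lie between a graph point and an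
interior point of the tangent ball, hence would be interior to `C`. -/
theorem IsOuterUnitNormal.boundaryGraph_eq_of_mem_frontier (hu : IsOuterUnitNormal C y u)
    (hC : IsConvexBody C) (hball : Metric.closedBall (y - ρ • u) ρ ⊆ C) {x : 𝔼 n}
    (hx : x ∈ frontier C) (hxy : ‖x - y‖ < ρ) :
    boundaryGraph C y u (hyperplaneProj hu.1 (x - y)) = -⟪u, x - y⟫ := by
  have hv : ‖hyperplaneProj hu.1 (x - y)‖ < ρ := (norm_hyperplaneProj_le hu.1 _).trans_lt hxy
  have hxC := hC.isClosed.frontier_subset hx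
  rw [eq_add_hyperplaneProj (y := y) hu.1 x] at hxC
  refine (hu.boundaryGraph_le hxC).antisymm ?_
  by_contra! hlt
  set v := hyperplaneProj hu.1 (x - y) with hvdef
  set f := boundaryGraph C y u v
  have htρ : -⟪u, x - y⟫ < ρ := by
    have := (neg_le_abs ⟪u, x - y⟫).trans (abs_real_inner_le_norm u (x - y))
    rw [hu.1, one_mul] at this
    linarith
  have hfC := hu.boundaryGraph_mem hC.isClosed hball hv.le
  have hint : y + (v : 𝔼 n) - ρ • u ∈ interior C := by
    refine mem_interior.2 ⟨Metric.ball (y - ρ • u) ρ, Metric.ball_subset_closedBall.trans hball,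
      Metric.isOpen_ball, ?_⟩
    have e : y + (v : 𝔼 n) - ρ • u - (y - ρ • u) = (v : 𝔼 n) := by module
    rwa [mem_ball_iff_norm, e, Submodule.norm_coe]
  have h1 := hC.convex.add_smul_sub_mem_interior hfC hint
    (t := (-⟪u, x - y⟫ - f) / (ρ - f)) ⟨div_pos (by linarith) (by linarith), by
      rw [div_le_one (by linarith)]; linarith⟩
  apply hx.2
  convert h1 using 1
  have e2 : (-⟪u, x - y⟫ - f) / (ρ - f) * (ρ - f) = -⟪u, x - y⟫ - f :=
    div_mul_cancel₀ _ (by linarith)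
  have e3 : y + (v : 𝔼 n) - ρ • u - (y + (v : 𝔼 n) - f • u) = (-(ρ - f)) • u := by module
  rw [e3, smul_smul, mul_neg, e2, hvdef, coe_hyperplaneProj]
  module

/-- The boundary points at which the quadratic form of `q` approximates the boundary up to `κ`, on
the scale `δ`. -/
def osculationSet (C : Set (𝔼 n)) (q : (𝔼 n) →L[ℝ] (𝔼 n)) (κ δ : ℝ) : Set (𝔼 n) :=
  {y ∈ frontier C | ∀ x ∈ frontier C, dist x y < δ →
    |⟪outerNormal C y, x - y⟫ +
      1 / 2 * ⟪q (x - y - ⟪outerNormal C y, x - y⟫ • outerNormal C y),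
        x - y - ⟪outerNormal C y, x - y⟫ • outerNormal C y⟫| ≤ κ * ‖x - y‖ ^ 2}

/-- For fixed `x` the inequality is a closed condition on `y` because the normal is continuous, and
`dist x y < δ` fails on a closed set. -/
theorem isClosed_osculationSet (hn : ContinuousOn (outerNormal C) (frontier C))
    (q : (𝔼 n) →L[ℝ] (𝔼 n)) (κ δ : ℝ) : IsClosed (osculationSet C q κ δ) := by
  have h1 : osculationSet C q κ δ = frontier C ∩ ⋂ x ∈ frontier C, ({y | δ ≤ dist x y} ∪
      {y ∈ frontier C | |⟪outerNormal C y, x - y⟫ +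
      1 / 2 * ⟪q (x - y - ⟪outerNormal C y, x - y⟫ • outerNormal C y),
        x - y - ⟪outerNormal C y, x - y⟫ • outerNormal C y⟫| - κ * ‖x - y‖ ^ 2 ∈ Iic 0}) := by
    ext y
    simp only [osculationSet, mem_inter_iff, mem_iInter, mem_union, mem_ofPred_eq, mem_Iic,
      sub_nonpos]
    refine and_congr_right fun hy => forall₂_congr fun x hx => ?_
    rw [or_iff_not_imp_left, not_le]
    exact imp_congr_right fun _ => by simp [hy]
  rw [h1]
  refine isClosed_frontier.inter (isClosed_biInter fun x _ => ?_)
  refine (isClosed_le continuous_const (by fun_prop)).union ?_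
  refine ContinuousOn.preimage_isClosed_of_isClosed ?_ isClosed_frontier (isClosed_Iic (a := (0 : ℝ)))
  fun_prop

theorem mem_osculationSet_of_secondFundamentalForm (h : HasRollingBall C ρ) (hρ : 0 < ρ)
    (hC : IsConvexBody C) (hy : y ∈ frontier C)
    {A : (ℝ ∙ outerNormal C y)ᗮ →ₗ[ℝ] (ℝ ∙ outerNormal C y)ᗮ}
    (hA : IsSecondFundamentalForm C y (outerNormal C y) A) :
    ∃ q : (𝔼 n) →L[ℝ] (𝔼 n), ∀ κ, 0 < κ → ∀ q', ‖q' - q‖ ≤ κ →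
      ∃ δ, 0 < δ ∧ y ∈ osculationSet C q' κ δ := by
  have hu := h.isOuterUnitNormal hρ hy
  refine ⟨LinearMap.toContinuousLinearMap (hyperplaneExtend hu.1 A 0), fun κ hκ q' hq' => ?_⟩
  obtain ⟨δ, hδ, hb⟩ := hA.exists_bound (half_pos hκ)
  refine ⟨min δ ρ, lt_min hδ hρ, hy, fun x hx hxy => ?_⟩
  rw [dist_eq_norm] at hxy
  rw [← coe_hyperplaneProj hu.1]
  have hf := hu.boundaryGraph_eq_of_mem_frontier hC (h.closedBall_subset hρ hy) hx
    (hxy.trans_le (min_le_right _ _))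
  set v := hyperplaneProj hu.1 (x - y) with hv
  have hvn : ‖v‖ ≤ ‖x - y‖ := norm_hyperplaneProj_le hu.1 _
  have h1 := hb v (hvn.trans_lt (hxy.trans_le (min_le_left _ _)))
  rw [hf] at h1
  set Q := LinearMap.toContinuousLinearMap (hyperplaneExtend hu.1 A 0)
  have hQ : ⟪Q v, (v : 𝔼 n)⟫ = ⟪A v, v⟫ := by
    have := inner_hyperplaneExtend hu.1 A 0 (v : 𝔼 n) v
    rw [hyperplaneProj_coe, zero_mul, zero_mul, add_zero] at this
    exact this
  have hd : |⟪(q' - Q) v, (v : 𝔼 n)⟫| ≤ κ * ‖v‖ ^ 2 := by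
    calc _ ≤ ‖(q' - Q) (v : 𝔼 n)‖ * ‖(v : 𝔼 n)‖ := abs_real_inner_le_norm _ _
      _ ≤ (‖q' - Q‖ * ‖(v : 𝔼 n)‖) * ‖(v : 𝔼 n)‖ := by
          gcongr; exact ContinuousLinearMap.le_opNorm _ _
      _ ≤ (κ * ‖(v : 𝔼 n)‖) * ‖(v : 𝔼 n)‖ := by gcongr
      _ = κ * ‖v‖ ^ 2 := by rw [Submodule.norm_coe]; ring
  have e : ⟪q' v, (v : 𝔼 n)⟫ = ⟪(q' - Q) v, (v : 𝔼 n)⟫ + ⟪A v, v⟫ := by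
    rw [← hQ, ← inner_add_left, _root_.sub_apply, sub_add_cancel]
  rw [e]
  have h2 : ‖v‖ ^ 2 ≤ ‖x - y‖ ^ 2 := by gcongr
  have h3 := abs_le.1 h1
  have h4 := abs_le.1 hd
  have h5 : κ * ‖v‖ ^ 2 ≤ κ * ‖x - y‖ ^ 2 := by gcongr
  rw [abs_le]
  constructor <;> linarith

/-- The converse of `mem_osculationSet_of_secondFundamentalForm`: the compression of the symmetric
part of `q` to the tangent hyperplane is the second fundamental form, as only the values `⟪q v, v⟫`
enter. -/
theorem exists_secondFundamentalForm_of_osculation (h : HasRollingBall C ρ) (hρ : 0 < ρ)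
    (hC : IsConvexBody C) (hy : y ∈ frontier C) {q : (𝔼 n) →L[ℝ] (𝔼 n)}
    (hq : ∀ κ, 0 < κ → ∃ q' δ, ‖q' - q‖ ≤ κ ∧ 0 < δ ∧ y ∈ osculationSet C q' κ δ) :
    ∃ A, IsSecondFundamentalForm C y (outerNormal C y) A := by
  have hu := h.isOuterUnitNormal hρ hy
  have hball := h.closedBall_subset hρ hy
  set u := outerNormal C y with hudef
  let S : (𝔼 n) →ₗ[ℝ] (𝔼 n) := (1 / 2 : ℝ) • ((q : (𝔼 n) →ₗ[ℝ] (𝔼 n)) + LinearMap.adjoint (q : (𝔼 n) →ₗ[ℝ] (𝔼 n)))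
  let A : (ℝ ∙ u)ᗮ →ₗ[ℝ] (ℝ ∙ u)ᗮ := hyperplaneProj hu.1 ∘ₗ S ∘ₗ (ℝ ∙ u)ᗮ.subtype
  have hproj : ∀ (z : 𝔼 n) (w : (ℝ ∙ u)ᗮ), ⟪hyperplaneProj hu.1 z, w⟫ = ⟪z, (w : 𝔼 n)⟫ := by
    intro z w
    rw [Submodule.coe_inner, coe_hyperplaneProj, inner_sub_left, real_inner_smul_left,
      inner_coe_hyperplane, mul_zero, sub_zero]
  have hAvw : ∀ v w : (ℝ ∙ u)ᗮ, ⟪A v, w⟫ = 1 / 2 * (⟪q v, (w : 𝔼 n)⟫ + ⟪(v : 𝔼 n), q w⟫) := by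
    intro v w
    have : A v = hyperplaneProj hu.1 (S v) := rfl
    rw [this, hproj]
    simp only [S, LinearMap.smul_apply, LinearMap.add_apply, real_inner_smul_left, inner_add_left,
      LinearMap.adjoint_inner_left, ContinuousLinearMap.coe_coe]
  have hAv : ∀ v : (ℝ ∙ u)ᗮ, ⟪A v, v⟫ = ⟪q v, (v : 𝔼 n)⟫ := fun v => by
    rw [hAvw, real_inner_comm (q v)]; ring
  refine ⟨A, fun v w => ?_, Asymptotics.IsLittleO.of_bound fun c hc => ?_⟩
  · rw [hAvw, ← real_inner_comm v, hAvw, real_inner_comm (q v), real_inner_comm (q w)]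
    ring
  -- The error is at most `(c / 5) · 4‖v‖²` from the osculation, as `‖x - y‖ ≤ 2‖v‖`, plus `(c /
  -- 10)‖v‖²` from replacing `q'` by `q`.
  obtain ⟨q', δ, hq', hδ, -, hosc⟩ := hq (c / 5) (by positivity)
  refine Metric.eventually_nhds_iff.2 ⟨min ρ (δ / 2), by positivity, fun v hv => ?_⟩
  rw [dist_zero_right] at hv
  have hvρ : ‖v‖ ≤ ρ := hv.le.trans (min_le_left _ _)
  have hvδ : ‖v‖ < δ / 2 := hv.trans_le (min_le_right _ _)
  have hmem := hu.boundaryGraph_mem_frontier hC.isClosed hball hvρ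
  have hfle := boundaryGraph_le_norm_sq_div hu hρ hball hvρ
  have hf0 : 0 ≤ boundaryGraph C y u v := hu.nonneg_of_mem (hC.isClosed.frontier_subset hmem)
  set f := boundaryGraph C y u v
  have hfv : f ≤ ‖v‖ := hfle.trans (by
    rw [div_le_iff₀ hρ, sq]
    gcongr)
  have e : y + (v : 𝔼 n) - f • u - y = (v : 𝔼 n) - f • u := by module
  have hnorm : ‖(v : 𝔼 n) - f • u‖ ≤ 2 * ‖v‖ := by
    refine (norm_sub_le _ _).trans ?_
    rw [norm_smul, hu.1, Submodule.norm_coe, Real.norm_of_nonneg hf0]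
    linarith
  have h1 := hosc _ hmem (by rw [dist_eq_norm, e]; linarith)
  have hin : ⟪u, (v : 𝔼 n) - f • u⟫ = -f := by
    rw [inner_sub_right, inner_coe_hyperplane, real_inner_smul_right, inner_self_unit hu.1]; ring
  have htp : (v : 𝔼 n) - f • u - (-f) • u = v := by module
  rw [e, ← hudef, hin, htp] at h1
  have hd : |⟪(q' - q) v, (v : 𝔼 n)⟫| ≤ c / 5 * ‖v‖ ^ 2 := by
    calc _ ≤ ‖(q' - q) (v : 𝔼 n)‖ * ‖(v : 𝔼 n)‖ := abs_real_inner_le_norm _ _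
      _ ≤ (‖q' - q‖ * ‖(v : 𝔼 n)‖) * ‖(v : 𝔼 n)‖ := by
          gcongr; exact ContinuousLinearMap.le_opNorm _ _
      _ ≤ (c / 5 * ‖(v : 𝔼 n)‖) * ‖(v : 𝔼 n)‖ := by gcongr
      _ = c / 5 * ‖v‖ ^ 2 := by rw [Submodule.norm_coe]; ring
  have e2 : ⟪q' v, (v : 𝔼 n)⟫ = ⟪(q' - q) v, (v : 𝔼 n)⟫ + ⟪A v, v⟫ := by
    rw [hAv, ← inner_add_left, _root_.sub_apply, sub_add_cancel]
  rw [e2] at h1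
  have h2 : ‖(v : 𝔼 n) - f • u‖ ^ 2 ≤ 4 * ‖v‖ ^ 2 := by
    calc _ ≤ (2 * ‖v‖) ^ 2 := by gcongr
      _ = _ := by ring
  have h5 : c / 5 * ‖(v : 𝔼 n) - f • u‖ ^ 2 ≤ c / 5 * (4 * ‖v‖ ^ 2) := by gcongr
  have h3 := abs_le.1 h1
  have h4 := abs_le.1 hd
  have h6 : 0 ≤ c * ‖v‖ ^ 2 := by positivity
  rw [Real.norm_eq_abs, Real.norm_of_nonneg (sq_nonneg ‖v‖), abs_le]
  constructor <;> linarith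

/-- The boundary points at which the second fundamental form exists. -/
def normalPoints (C : Set (𝔼 n)) : Set (𝔼 n) :=
  {y ∈ frontier C | ∃ A, IsSecondFundamentalForm C y (outerNormal C y) A}

theorem HasRollingBall.measurableSet_normalPoints (h : HasRollingBall C ρ) (hρ : 0 < ρ)
    (hC : IsConvexBody C) : MeasurableSet (normalPoints C) := by
  let d : ℕ → ((𝔼 n) →L[ℝ] (𝔼 n)) := TopologicalSpace.denseSeq _
  have hd : DenseRange d := TopologicalSpace.denseRange_denseSeq _
  -- Approximate osculation by countably many forms, at every precision. The bound `N` on the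
  -- operators is uniform in the precision `k`, so that a subsequence of the approximating operators
  -- converges to an exact form.
  have key : normalPoints C = ⋃ N : ℕ, ⋂ k : ℕ, ⋃ j : ℕ, ⋃ _ : ‖d j‖ ≤ N, ⋃ m : ℕ,
      osculationSet C (d j) (1 / ((k : ℝ) + 1)) (1 / ((m : ℝ) + 1)) := by
    ext y
    simp only [mem_iUnion, mem_iInter]
    constructor
    · rintro ⟨hy, A, hA⟩
      obtain ⟨q, hq⟩ := mem_osculationSet_of_secondFundamentalForm h hρ hC hy hA
      obtain ⟨N, hN⟩ := exists_nat_ge (‖q‖ + 1)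
      refine ⟨N, fun k => ?_⟩
      obtain ⟨j, hj⟩ := hd.exists_dist_lt q (ε := 1 / ((k : ℝ) + 1)) (by positivity)
      rw [dist_comm, dist_eq_norm] at hj
      have hk : 1 / ((k : ℝ) + 1) ≤ 1 := by
        rw [div_le_one (by positivity)]; linarith [k.cast_nonneg (α := ℝ)]
      obtain ⟨δ, hδ, -, hosc⟩ := hq _ (by positivity : 0 < 1 / ((k : ℝ) + 1)) (d j) hj.le
      obtain ⟨m, hm⟩ := exists_nat_one_div_lt hδ
      refine ⟨j, ?_, m, hy, fun x hx hxy => hosc x hx (hxy.trans hm)⟩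
      have : ‖d j‖ ≤ ‖d j - q‖ + ‖q‖ := by simpa using norm_add_le (d j - q) q
      linarith
    · rintro ⟨N, hN⟩
      choose j hj m hm using hN
      have hy : y ∈ frontier C := (hm 0).1
      obtain ⟨q, -, φ, hφ, hlim⟩ := (isCompact_closedBall (0 : (𝔼 n) →L[ℝ] (𝔼 n)) N).tendsto_subseq
        (x := fun k => d (j k)) (fun k => by simpa using hj k)
      refine ⟨hy, exists_secondFundamentalForm_of_osculation h hρ hC hy (q := q) fun κ hκ => ?_⟩
      have h1 : ∀ᶠ k in atTop, dist (d (j (φ k))) q < κ := Metric.tendsto_nhds.1 hlim κ hκ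
      have h2 : ∀ᶠ k in atTop, 1 / ((φ k : ℝ) + 1) < κ :=
        (tendsto_one_div_add_atTop_nhds_zero_nat.comp hφ.tendsto_atTop).eventually_lt_const hκ
      obtain ⟨k, h3, h4⟩ := (h1.and h2).exists
      refine ⟨d (j (φ k)), 1 / ((m (φ k) : ℝ) + 1), by rw [← dist_eq_norm]; exact h3.le,
        by positivity, hy, fun x hx hxy => ((hm (φ k)).2 x hx hxy).trans ?_⟩
      gcongr
  rw [key]
  have hcl := fun q κ δ =>
    (isClosed_osculationSet (h.continuousOn_outerNormal hρ) q κ δ).measurableSet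
  exact .iUnion fun N => .iInter fun k => .iUnion fun j => .iUnion fun _ => .iUnion fun m => hcl _ _ _

/-- Where the second fundamental form exists, the curvature is obtained from a pointwise limit of
the continuous functions `y ↦ σ(r_k y)(1 - r_k)^p`, with `σ` the Busemann density; at the other
boundary points it is `0`. -/
theorem HasRollingBall.aemeasurable_gaussKroneckerCurvature (h : HasRollingBall C ρ) (hρ : 0 < ρ)
    (hC : IsConvexBody C) (h0 : (0 : 𝔼 n) ∈ interior C) (μ : Measure (𝔼 n)) :
    AEMeasurable (gaussKroneckerCurvature C) (μ.restrict (frontier C)) := by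
  have hE := h.measurableSet_normalPoints hρ hC
  have hEsub : normalPoints C ⊆ frontier C := fun y hy => hy.1
  obtain ⟨b, hb, hbC⟩ := IsConvexBody.exists_closedBall_subset h0
  have hpos : ∀ y ∈ frontier C, 0 < ⟪outerNormal C y, y⟫ := fun y hy =>
    hb.trans_le ((h.isOuterUnitNormal hρ hy).le_inner hb hbC)
  have hnE := (h.continuousOn_outerNormal hρ).mono hEsub
  let p : ℝ := ((n : ℝ) + 1) / 2
  have hGm : AEMeasurable (fun y => √(gaussKroneckerCurvature C y) *
      (2 * ⟪outerNormal C y, y⟫) ^ (-p)) (μ.restrict (normalPoints C)) := by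
    let r : ℕ → ℝ := fun k => 1 - 1 / ((k : ℝ) + 2)
    have hr : ∀ k, 0 ≤ r k ∧ r k < 1 := fun k => by
      have h1 : 0 < 1 / ((k : ℝ) + 2) := by positivity
      have h2 : 1 / ((k : ℝ) + 2) ≤ 1 := by
        rw [div_le_one (by positivity)]; linarith [k.cast_nonneg (α := ℝ)]
      exact ⟨by simp only [r]; linarith, by simp only [r]; linarith⟩
    have hrlim : Tendsto r atTop (𝓝[<] 1) := by
      refine tendsto_nhdsWithin_iff.2 ⟨?_, Eventually.of_forall fun k => (hr k).2⟩
      have h1 : Tendsto (fun k : ℕ => (k : ℝ) + 2) atTop atTop :=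
        tendsto_atTop_add_const_right _ _ tendsto_natCast_atTop_atTop
      have h2 := (tendsto_const_nhds (x := (1 : ℝ))).div_atTop h1
      simpa [r] using h2.const_sub 1
    refine aemeasurable_of_tendsto_metrizable_ae atTop
      (f := fun k y => busemannDensity C (r k • y) * (1 - r k) ^ p) (fun k => ?_) ?_
    · refine ContinuousOn.aemeasurable (ContinuousOn.mul ?_ continuousOn_const) hE
      refine (isCovariantDensity_busemannDensity.continuousOn hC).comp (by fun_prop) fun y hy => ?_
      exact smul_mem_interior_of_mem hC.convex h0 (hC.isClosed.frontier_subset hy.1) (hr k).1 (hr k).2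
    · filter_upwards [ae_restrict_mem hE] with y hy
      exact (h.tendsto_density_mul hρ hC h0 isCovariantDensity_busemannDensity hy.1 hy.2).comp hrlim
  have h2 : AEMeasurable (fun y => (2 * ⟪outerNormal C y, y⟫) ^ p) (μ.restrict (normalPoints C)) := by
    refine ContinuousOn.aemeasurable ?_ hE
    refine ContinuousOn.rpow_const (by fun_prop) fun y hy => Or.inl ?_
    have := hpos y hy.1
    positivity
  have hm1 : AEMeasurable (gaussKroneckerCurvature C) (μ.restrict (normalPoints C)) := by
    refine ((hGm.mul h2).pow_const 2).congr ?_
    filter_upwards [ae_restrict_mem hE] with y hy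
    have := hpos y hy.1
    rw [Pi.mul_apply, mul_assoc, ← Real.rpow_add (by positivity), neg_add_cancel, Real.rpow_zero,
      mul_one, Real.sq_sqrt (h.gaussKroneckerCurvature_nonneg hρ hy.1)]
  have hm2 : AEMeasurable (gaussKroneckerCurvature C)
      (μ.restrict (frontier C \ normalPoints C)) := by
    refine (aemeasurable_const (b := (0 : ℝ))).congr ?_
    filter_upwards [ae_restrict_mem (isClosed_frontier.measurableSet.diff hE)] with y hy
    exact (gaussKroneckerCurvature_eq_zero fun hA => hy.2 ⟨hy.1, hA⟩).symm
  have := aemeasurable_union_iff.2 ⟨hm1, hm2⟩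
  rwa [union_sdiff_cancel hEsub] at this

end Measurability


/-! ### The Hausdorff measure of the boundary -/

section Hausdorff

/-- The parametrization of a face of the cube. -/
noncomputable def cubeFace {m : ℕ} (i : Fin (m + 1)) (s : ℝ) (a : Fin m → ℝ) : 𝔼 (m + 1) :=
  WithLp.toLp 2 (i.insertNth s a)

theorem exists_lipschitzWith_cubeFace {m : ℕ} (i : Fin (m + 1)) (s : ℝ) :
    ∃ K, LipschitzWith K (cubeFace i s) := by
  have h1 : LipschitzWith 1 (fun a : Fin m → ℝ => (i.insertNth s a : Fin (m + 1) → ℝ)) := by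
    refine LipschitzWith.of_dist_le_mul fun a b => ?_
    rw [NNReal.coe_one, one_mul, dist_pi_le_iff dist_nonneg]
    intro j
    rcases Fin.eq_self_or_eq_succAbove i j with rfl | ⟨k, rfl⟩
    · simp
    · simpa using dist_le_pi_dist a b k
  exact ⟨_, (PiLp.lipschitzWith_toLp 2 (fun _ : Fin (m + 1) => ℝ)).comp h1⟩

theorem abs_le_norm_cubeFace {m : ℕ} (i : Fin (m + 1)) (s : ℝ) (a : Fin m → ℝ) :
    |s| ≤ ‖cubeFace i s a‖ := by
  have := PiLp.norm_apply_le (cubeFace i s a) i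
  simpa [cubeFace] using this

theorem exists_eq_smul_cubeFace {m : ℕ} {y : 𝔼 (m + 1)} (hy : y ≠ 0) :
    ∃ (i : Fin (m + 1)) (s : ℝ), (s = 1 ∨ s = -1) ∧ ∃ a ∈ Metric.closedBall (0 : Fin m → ℝ) 1,
      ∃ t : ℝ, 0 < t ∧ y = t • cubeFace i s a := by
  obtain ⟨i, hi⟩ := Finite.exists_max fun j => |y j|
  have hpos : 0 < |y i| := by
    by_contra! h
    apply hy
    ext j
    exact abs_nonpos_iff.1 ((hi j).trans h)
  refine ⟨i, y i / |y i|, ?_, fun k => y (i.succAbove k) / |y i|, ?_, |y i|, hpos, ?_⟩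
  · rcases le_total 0 (y i) with h | h
    · left
      rw [abs_of_nonneg h] at hpos ⊢
      exact div_self hpos.ne'
    · right
      rw [abs_of_nonpos h] at hpos ⊢
      rw [div_neg, div_self (by linarith)]
  · rw [mem_closedBall_zero_iff, pi_norm_le_iff_of_nonneg zero_le_one]
    intro k
    rw [Real.norm_eq_abs, abs_div, abs_abs, div_le_one hpos]
    exact hi _
  · ext j
    rcases Fin.eq_self_or_eq_succAbove i j with rfl | ⟨k, rfl⟩
    · simp [cubeFace, mul_div_cancel₀ _ hpos.ne']
    · simp [cubeFace, mul_div_cancel₀ _ hpos.ne']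

theorem lipschitzOnWith_inv_smul {F : Type*} [NormedAddCommGroup F] [NormedSpace ℝ F] {g : F → ℝ}
    {L : ℝ≥0} (hg : LipschitzWith L g) {c R : ℝ≥0} (hc : 0 < c) {S : Set F} (hS : ∀ z ∈ S, c ≤ g z)
    (hR : ∀ z ∈ S, ‖z‖ ≤ R) : LipschitzOnWith (c⁻¹ + R * (L * c⁻¹ ^ 2)) (fun z => (g z)⁻¹ • z) S := by
  refine LipschitzOnWith.of_dist_le_mul fun z hz w hw => ?_
  have hc' : (0 : ℝ) < c := hc
  have hgz := hc'.trans_le (hS z hz)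
  have hgw := hc'.trans_le (hS w hw)
  have h1 : |(g z)⁻¹ - (g w)⁻¹| ≤ L * (c : ℝ)⁻¹ ^ 2 * ‖z - w‖ := by
    have h2 := hg.dist_le_mul w z
    rw [Real.dist_eq, dist_comm, dist_eq_norm] at h2
    rw [inv_sub_inv hgz.ne' hgw.ne', abs_div, abs_of_pos (mul_pos hgz hgw), div_eq_mul_inv]
    calc |g w - g z| * (g z * g w)⁻¹ ≤ (L * ‖z - w‖) * (c * c : ℝ)⁻¹ := by
          gcongr
          · exact hS z hz
          · exact hS w hw
      _ = _ := by rw [mul_inv]; ring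
  have e : (g z)⁻¹ • z - (g w)⁻¹ • w = (g z)⁻¹ • (z - w) + ((g z)⁻¹ - (g w)⁻¹) • w := by module
  rw [dist_eq_norm, dist_eq_norm, e]
  refine (norm_add_le _ _).trans ?_
  rw [norm_smul, norm_smul, Real.norm_of_nonneg (by positivity), Real.norm_eq_abs]
  calc _ ≤ (c : ℝ)⁻¹ * ‖z - w‖ + (L * (c : ℝ)⁻¹ ^ 2 * ‖z - w‖) * R := by
        gcongr
        · exact hS z hz
        · exact hR w hw
    _ = _ := by push_cast; ring

/-- The radial projection `z ↦ z / gauge C z` maps the boundary of the cube onto `∂C`. It is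
Lipschitz on each face, because the gauge is Lipschitz and at least `1 / R` there, and the faces are
Lipschitz images of bounded sets in dimension `m`. -/
theorem hausdorffMeasure_frontier_lt_top {m : ℕ} {C : Set (𝔼 (m + 1))} (hC : IsConvexBody C)
    (h0 : (0 : 𝔼 (m + 1)) ∈ interior C) : μH[(m : ℝ)] (frontier C) < ⊤ := by
  have hnhds : C ∈ 𝓝 (0 : 𝔼 (m + 1)) := mem_interior_iff_mem_nhds.1 h0
  obtain ⟨L, hL⟩ := hC.convex.lipschitz_gauge hnhds
  obtain ⟨R, hR, hCR⟩ := hC.exists_subset_closedBall 0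
  let B : Set (Fin m → ℝ) := Metric.closedBall 0 1
  let ψ : (𝔼 (m + 1)) → 𝔼 (m + 1) := fun z => (gauge C z)⁻¹ • z
  have hface : ∀ (i : Fin (m + 1)) (s : ℝ), |s| = 1 → μH[(m : ℝ)] (ψ '' (cubeFace i s '' B)) < ⊤ := by
    intro i s hs
    obtain ⟨K, hK⟩ := exists_lipschitzWith_cubeFace i s
    have hcomp : IsCompact (cubeFace i s '' B) :=
      (isCompact_closedBall 0 1).image hK.continuous
    obtain ⟨R', hR'⟩ := hcomp.isBounded.exists_norm_le
    have hlip := lipschitzOnWith_inv_smul hL (c := ⟨R⁻¹, by positivity⟩) (R := R'.toNNReal)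
      (S := cubeFace i s '' B) (by exact_mod_cast inv_pos.2 hR) (by
        rintro _ ⟨a, -, rfl⟩
        refine le_trans ?_ (le_gauge_of_subset_closedBall (absorbent_nhds_zero hnhds) hR.le hCR)
        have := abs_le_norm_cubeFace i s a
        rw [hs] at this
        change R⁻¹ ≤ _
        rw [inv_eq_one_div]
        gcongr) (fun z hz => (hR' z hz).trans (Real.le_coe_toNNReal R'))
    refine (hlip.hausdorffMeasure_image_le m.cast_nonneg).trans_lt (ENNReal.mul_lt_top ?_ ?_)
    · exact ENNReal.rpow_lt_top_of_nonneg m.cast_nonneg ENNReal.coe_ne_top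
    · refine (hK.hausdorffMeasure_image_le m.cast_nonneg _).trans_lt (ENNReal.mul_lt_top ?_ ?_)
      · exact ENNReal.rpow_lt_top_of_nonneg m.cast_nonneg ENNReal.coe_ne_top
      · have := hausdorffMeasure_pi_real (ι := Fin m)
        rw [Fintype.card_fin] at this
        rw [this]
        exact measure_closedBall_lt_top
  have hcover : frontier C ⊆ ⋃ i : Fin (m + 1),
      (ψ '' (cubeFace i 1 '' B) ∪ ψ '' (cubeFace i (-1) '' B)) := by
    intro y hy
    have hy0 : y ≠ 0 := by rintro rfl; exact hy.2 h0
    obtain ⟨i, s, hs, a, ha, t, ht, hyt⟩ := exists_eq_smul_cubeFace hy0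
    have hg : gauge C y = 1 := (gauge_eq_one_iff_mem_frontier hC.convex hnhds).2 hy
    have hψ : ψ (cubeFace i s a) = y := by
      rw [hyt, gauge_smul_of_nonneg ht.le, smul_eq_mul] at hg
      have : (gauge C (cubeFace i s a))⁻¹ = t := (eq_inv_of_mul_eq_one_left hg).symm
      simp only [ψ]
      rw [this, ← hyt]
    rw [mem_iUnion]
    refine ⟨i, ?_⟩
    rcases hs with rfl | rfl
    · exact Or.inl ⟨_, ⟨a, ha, rfl⟩, hψ⟩
    · exact Or.inr ⟨_, ⟨a, ha, rfl⟩, hψ⟩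
  refine (measure_mono hcover).trans_lt ((measure_iUnion_le _).trans_lt ?_)
  rw [tsum_fintype]
  exact ENNReal.sum_lt_top.2 fun i _ => measure_union_lt_top (hface i 1 (by simp)) (hface i (-1) (by simp))

theorem euclideanHausdorffMeasure_frontier_lt_top (hn : 1 ≤ n) {C : Set (𝔼 n)} (hC : IsConvexBody C)
    (h0 : (0 : 𝔼 n) ∈ interior C) :
    (Measure.euclideanHausdorffMeasure (n - 1) : Measure (𝔼 n)) (frontier C) < ⊤ := by
  obtain ⟨m, rfl⟩ : ∃ m, n = m + 1 := ⟨n - 1, by omega⟩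
  rw [Nat.add_sub_cancel, Measure.euclideanHausdorffMeasure_def, Measure.smul_apply,
    ENNReal.smul_def, smul_eq_mul]
  exact ENNReal.mul_lt_top ENNReal.coe_lt_top (hausdorffMeasure_frontier_lt_top hC h0)

/-! ### Behaviour of boundary integrals under homotheties. -/

theorem map_smul_euclideanHausdorffMeasure (d : ℕ) {r : ℝ} (hr : 0 < r) :
    Measure.map (fun x : 𝔼 n => r • x) (Measure.euclideanHausdorffMeasure d) =
      (ENNReal.ofReal (r⁻¹ ^ d)) • (Measure.euclideanHausdorffMeasure d : Measure (𝔼 n)) := by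
  ext s hs
  rw [Measure.map_apply (by fun_prop) hs, preimage_smul₀ hr.ne',
    Measure.euclideanHausdorffMeasure_smul₀ d (inv_ne_zero hr.ne'), Measure.smul_apply, smul_eq_mul,
    ENNReal.smul_def, smul_eq_mul]
  congr 1
  rw [ENNReal.ofReal_eq_coe_nnreal (by positivity : 0 ≤ r⁻¹ ^ d)]
  congr 1
  ext
  rw [NNReal.coe_pow, coe_nnnorm, Real.norm_of_nonneg (by positivity), NNReal.coe_mk]

theorem measurableEmbedding_smul {r : ℝ} (hr : 0 < r) :
    MeasurableEmbedding (fun x : 𝔼 n => r • x) :=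
  (Homeomorph.smulOfNeZero r hr.ne').measurableEmbedding

theorem setIntegral_smul_set (d : ℕ) {r : ℝ} (hr : 0 < r) (S : Set (𝔼 n)) (f : (𝔼 n) → ℝ) :
    ∫ x in r • S, f x ∂(Measure.euclideanHausdorffMeasure d : Measure (𝔼 n)) =
      r ^ d * ∫ x in S, f (r • x) ∂(Measure.euclideanHausdorffMeasure d : Measure (𝔼 n)) := by
  have h1 := (measurableEmbedding_smul (n := n) hr).setIntegral_map
    (μ := Measure.euclideanHausdorffMeasure d) f (r • S)
  rw [map_smul_euclideanHausdorffMeasure d hr, preimage_smul₀ hr.ne', inv_smul_smul₀ hr.ne',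
    Measure.restrict_smul, integral_smul_measure, ENNReal.toReal_ofReal (by positivity),
    smul_eq_mul] at h1
  rw [← h1, ← mul_assoc, ← mul_pow, mul_inv_cancel₀ hr.ne', one_pow, one_mul]

theorem integrableOn_smul_set_iff (d : ℕ) {r : ℝ} (hr : 0 < r) (S : Set (𝔼 n)) (f : (𝔼 n) → ℝ) :
    IntegrableOn f (r • S) (Measure.euclideanHausdorffMeasure d : Measure (𝔼 n)) ↔
      IntegrableOn (fun x => f (r • x)) S
        (Measure.euclideanHausdorffMeasure d : Measure (𝔼 n)) := by
  have h1 := (measurableEmbedding_smul (n := n) hr).integrableOn_map_iff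
    (μ := Measure.euclideanHausdorffMeasure d) (f := f) (s := r • S)
  rw [map_smul_euclideanHausdorffMeasure d hr, preimage_smul₀ hr.ne', inv_smul_smul₀ hr.ne'] at h1
  rw [← Function.comp_def f, ← h1, IntegrableOn, IntegrableOn, Measure.restrict_smul,
    integrable_smul_measure (by simpa using pow_pos (inv_pos.2 hr) d) ENNReal.ofReal_ne_top]

theorem frontier_smul_set {r : ℝ} (hr : 0 < r) (S : Set (𝔼 n)) : frontier (r • S) = r • frontier S :=
  ((Homeomorph.smulOfNeZero r hr.ne' : (𝔼 n) ≃ₜ (𝔼 n)).image_frontier S).symm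

end Hausdorff


/-! ### The centro-affine surface area as a limit of floating areas -/

section Main

variable {C : Set (𝔼 n)} {ρ : ℝ} {σ : Set (𝔼 n) → (𝔼 n) → ℝ}

theorem HasRollingBall.integrableOn_centroAffineIntegrand (hn : 1 ≤ n) (h : HasRollingBall C ρ)
    (hρ : 0 < ρ) (hC : IsConvexBody C) (h0 : (0 : 𝔼 n) ∈ interior C) :
    IntegrableOn (centroAffineIntegrand C) (frontier C)
      (Measure.euclideanHausdorffMeasure (n - 1) : Measure (𝔼 n)) := by
  obtain ⟨b, hb, hbC⟩ := IsConvexBody.exists_closedBall_subset h0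
  obtain ⟨K, hK⟩ := h.exists_curvature_bound hρ hC h0
  have hn' : (1 : ℝ) ≤ n := by exact_mod_cast hn
  have hS : MeasurableSet (frontier C) := isClosed_frontier.measurableSet
  have hpos : ∀ y ∈ frontier C, b ≤ ⟪y, outerNormal C y⟫ := fun y hy => by
    rw [real_inner_comm]
    exact (h.isOuterUnitNormal hρ hy).le_inner hb hbC
  have hm := h.aemeasurable_gaussKroneckerCurvature hρ hC h0
    (Measure.euclideanHausdorffMeasure (n - 1))
  have hcn := h.continuousOn_outerNormal hρ
  have hm2 : AEMeasurable (fun y => ⟪y, outerNormal C y⟫)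
      ((Measure.euclideanHausdorffMeasure (n - 1)).restrict (frontier C)) :=
    ContinuousOn.aemeasurable (by fun_prop) hS
  refine ⟨((hm.pow_const _).div (hm2.pow_const _)).aestronglyMeasurable,
    .restrict_of_bounded (C := K ^ ((1 : ℝ) / 2) / b ^ (((n : ℝ) - 1) / 2))
      (euclideanHausdorffMeasure_frontier_lt_top hn hC h0) ?_⟩
  filter_upwards [ae_restrict_mem hS] with y hy
  have h1 := h.gaussKroneckerCurvature_nonneg hρ hy
  have h2 := hpos y hy
  have h3 : 0 < ⟪y, outerNormal C y⟫ := hb.trans_le h2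
  have h4 : 0 ≤ ((n : ℝ) - 1) / 2 := by linarith
  rw [centroAffineIntegrand, Real.norm_of_nonneg (by positivity)]
  have h5 := h1.trans (hK y hy)
  have h6 := hK y hy
  gcongr

theorem HasRollingBall.floatingIntegrand_smul (h : HasRollingBall C ρ) (hρ : 0 < ρ) {y : 𝔼 n}
    (hy : y ∈ frontier C) {r : ℝ} (hr : 0 < r) (s : (𝔼 n) → ℝ) :
    floatingIntegrand s (r • C) (r • y) =
      (r⁻¹ ^ (n - 1) * gaussKroneckerCurvature C y) ^ (1 / ((n : ℝ) + 1)) *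
        s (r • y) ^ (((n : ℝ) - 1) / ((n : ℝ) + 1)) := by
  rw [floatingIntegrand, gaussKroneckerCurvature_smul hr (h.isOuterUnitNormal hρ hy).1]

theorem HasRollingBall.aemeasurable_floatingIntegrand_smul (h : HasRollingBall C ρ)
    (hρ : 0 < ρ) (hC : IsConvexBody C) (h0 : (0 : 𝔼 n) ∈ interior C) (hσ : IsCovariantDensity σ)
    (μ : Measure (𝔼 n)) {r : ℝ} (hr : 0 < r) (hr1 : r < 1) :
    AEMeasurable (fun y => floatingIntegrand (σ C) (r • C) (r • y)) (μ.restrict (frontier C)) := by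
  have hS : MeasurableSet (frontier C) := isClosed_frontier.measurableSet
  have hm := h.aemeasurable_gaussKroneckerCurvature hρ hC h0 μ
  have hm2 : AEMeasurable (fun y => σ C (r • y)) (μ.restrict (frontier C)) := by
    refine ContinuousOn.aemeasurable ((hσ.continuousOn hC).comp (by fun_prop) fun y hy => ?_) hS
    exact smul_mem_interior_of_mem hC.convex h0 (hC.isClosed.frontier_subset hy) hr.le hr1
  refine (((hm.const_mul (r⁻¹ ^ (n - 1))).pow_const (1 / ((n : ℝ) + 1))).mul
    (hm2.pow_const (((n : ℝ) - 1) / ((n : ℝ) + 1)))).congr ?_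
  filter_upwards [ae_restrict_mem hS] with y hy
  rw [h.floatingIntegrand_smul hρ hy hr]
  rfl

theorem HasRollingBall.integrableOn_floatingIntegrand (hn : 1 ≤ n) (h : HasRollingBall C ρ)
    (hρ : 0 < ρ) (hC : IsConvexBody C) (h0 : (0 : 𝔼 n) ∈ interior C) (hσ : IsCovariantDensity σ)
    {r : ℝ} (hr : 0 < r) (hr1 : r < 1) :
    IntegrableOn (floatingIntegrand (σ C) (r • C)) (frontier (r • C))
      (Measure.euclideanHausdorffMeasure (n - 1) : Measure (𝔼 n)) := by
  rw [frontier_smul_set hr, integrableOn_smul_set_iff (n - 1) hr]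
  obtain ⟨K, hK⟩ := h.exists_curvature_bound hρ hC h0
  have hn' : (1 : ℝ) ≤ n := by exact_mod_cast hn
  have hS : MeasurableSet (frontier C) := isClosed_frontier.measurableSet
  have hcomp : IsCompact (frontier C) :=
    hC.isCompact.of_isClosed_subset isClosed_frontier hC.isClosed.frontier_subset
  have hint : ∀ y ∈ frontier C, r • y ∈ interior C := fun y hy =>
    smul_mem_interior_of_mem hC.convex h0 (hC.isClosed.frontier_subset hy) hr.le hr1
  obtain ⟨K', hK'⟩ := hcomp.exists_bound_of_continuousOn (f := fun y => σ C (r • y))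
    ((hσ.continuousOn hC).comp (by fun_prop) hint)
  refine ⟨(h.aemeasurable_floatingIntegrand_smul hρ hC h0 hσ _ hr hr1).aestronglyMeasurable,
    .restrict_of_bounded (C := (r⁻¹ ^ (n - 1) * K) ^ (1 / ((n : ℝ) + 1)) *
      K' ^ (((n : ℝ) - 1) / ((n : ℝ) + 1)))
      (euclideanHausdorffMeasure_frontier_lt_top hn hC h0) ?_⟩
  filter_upwards [ae_restrict_mem hS] with y hy
  have h1 := h.gaussKroneckerCurvature_nonneg hρ hy
  have h2 := hσ.nonneg C hC _ (hint y hy)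
  have h3 := (le_abs_self _).trans (hK' y hy)
  have h4 : 0 ≤ ((n : ℝ) - 1) / ((n : ℝ) + 1) := div_nonneg (by linarith) (by positivity)
  have h5 := hK y hy
  have h6 := h1.trans h5
  rw [h.floatingIntegrand_smul hρ hy hr, Real.norm_of_nonneg (by positivity)]
  gcongr

/-- The exponents of the floating area are made for this: `1/(n+1) + (n-1)/(2(n+1)) = 1/2` for `H`,
and `((n+1)/2) · (n-1)/(n+1) = (n-1)/2` for `2t`, whose power of `2` cancels the prefactor. -/
theorem rpow_limit_identity (hn : 1 ≤ n) {H t : ℝ} (hH : 0 ≤ H) (ht : 0 < t) :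
    (2 : ℝ) ^ (((n : ℝ) - 1) / 2) * (H ^ (1 / ((n : ℝ) + 1)) *
      (√H * (2 * t) ^ (-(((n : ℝ) + 1) / 2))) ^ (((n : ℝ) - 1) / ((n : ℝ) + 1))) =
      H ^ ((1 : ℝ) / 2) / t ^ (((n : ℝ) - 1) / 2) := by
  have hn' : (1 : ℝ) ≤ n := by exact_mod_cast hn
  have hn1 : (n : ℝ) + 1 ≠ 0 := by positivity
  have h4 : 0 ≤ ((n : ℝ) - 1) / ((n : ℝ) + 1) := div_nonneg (by linarith) (by positivity)
  rw [Real.mul_rpow (Real.sqrt_nonneg _) (by positivity), Real.sqrt_eq_rpow, ← Real.rpow_mul hH,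
    ← Real.rpow_mul (by positivity), ← mul_assoc (H ^ _),
    ← Real.rpow_add_of_nonneg hH (by positivity) (by positivity)]
  have e1 : 1 / ((n : ℝ) + 1) + 1 / 2 * (((n : ℝ) - 1) / ((n : ℝ) + 1)) = 1 / 2 := by
    field_simp; ring
  have e2 : -(((n : ℝ) + 1) / 2) * (((n : ℝ) - 1) / ((n : ℝ) + 1)) = -(((n : ℝ) - 1) / 2) := by
    field_simp
  rw [e1, e2, Real.mul_rpow (by norm_num) ht.le, Real.rpow_neg (by norm_num : (0 : ℝ) ≤ 2),
    Real.rpow_neg ht.le]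
  have := Real.rpow_pos_of_pos (by norm_num : (0 : ℝ) < 2) (((n : ℝ) - 1) / 2)
  field_simp

theorem HasRollingBall.floatingIntegrand_mul (hn : 1 ≤ n) (h : HasRollingBall C ρ)
    (hρ : 0 < ρ) (hC : IsConvexBody C) (h0 : (0 : 𝔼 n) ∈ interior C) (hσ : IsCovariantDensity σ)
    {y : 𝔼 n} (hy : y ∈ frontier C) {r : ℝ} (hr : 0 < r) (hr1 : r < 1) :
    floatingIntegrand (σ C) (r • C) (r • y) * (1 - r) ^ (((n : ℝ) - 1) / 2) =
      (r⁻¹ ^ (n - 1) * gaussKroneckerCurvature C y) ^ (1 / ((n : ℝ) + 1)) *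
        (σ C (r • y) * (1 - r) ^ (((n : ℝ) + 1) / 2)) ^ (((n : ℝ) - 1) / ((n : ℝ) + 1)) := by
  have hr0 : 0 < 1 - r := by linarith
  have h2 := hσ.nonneg C hC (r • y)
    (smul_mem_interior_of_mem hC.convex h0 (hC.isClosed.frontier_subset hy) hr.le hr1)
  have hn1 : (n : ℝ) + 1 ≠ 0 := by positivity
  have e2 : ((n : ℝ) + 1) / 2 * (((n : ℝ) - 1) / ((n : ℝ) + 1)) = ((n : ℝ) - 1) / 2 := by
    field_simp
  rw [h.floatingIntegrand_smul hρ hy hr, Real.mul_rpow h2 (by positivity), ← Real.rpow_mul hr0.le,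
    e2, mul_assoc]

theorem HasRollingBall.tendsto_floatingIntegrand (hn : 1 ≤ n) (h : HasRollingBall C ρ)
    (hρ : 0 < ρ) (hC : IsConvexBody C) (h0 : (0 : 𝔼 n) ∈ interior C) (hσ : IsCovariantDensity σ)
    {y : 𝔼 n} (hy : y ∈ frontier C) :
    Tendsto (fun r : ℝ => (2 : ℝ) ^ (((n : ℝ) - 1) / 2) * (r ^ (n - 1) *
      (floatingIntegrand (σ C) (r • C) (r • y) * (1 - r) ^ (((n : ℝ) - 1) / 2)))) (𝓝[<] 1)
      (𝓝 (centroAffineIntegrand C y)) := by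
  have hn' : (1 : ℝ) ≤ n := by exact_mod_cast hn
  have h4 : 0 ≤ ((n : ℝ) - 1) / ((n : ℝ) + 1) := div_nonneg (by linarith) (by positivity)
  obtain ⟨b, hb, hbC⟩ := IsConvexBody.exists_closedBall_subset h0
  have hpos := hb.trans_le ((h.isOuterUnitNormal hρ hy).le_inner hb hbC)
  have hH := h.gaussKroneckerCurvature_nonneg hρ hy
  have hr0 : ∀ᶠ r : ℝ in 𝓝[<] 1, 0 < r := (eventually_gt_nhds one_pos).filter_mono nhdsWithin_le_nhds
  have hid : Tendsto (fun r : ℝ => r) (𝓝[<] 1) (𝓝 1) := nhdsWithin_le_nhds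
  by_cases hA : ∃ A, IsSecondFundamentalForm C y (outerNormal C y) A
  · have h1 := h.tendsto_density_mul hρ hC h0 hσ hy hA
    have h2 : Tendsto (fun r : ℝ => r⁻¹ ^ (n - 1) * gaussKroneckerCurvature C y) (𝓝[<] 1)
        (𝓝 (gaussKroneckerCurvature C y)) := by
      have := ((hid.inv₀ one_ne_zero).pow (n - 1)).mul_const (gaussKroneckerCurvature C y)
      simpa using this
    have h3 := ((hid.pow (n - 1)).mul ((h2.rpow_const (p := 1 / ((n : ℝ) + 1))
      (Or.inr (by positivity))).mul (h1.rpow_const (Or.inr h4)))).const_mul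
        ((2 : ℝ) ^ (((n : ℝ) - 1) / 2))
    rw [one_pow, one_mul, rpow_limit_identity hn hH hpos, real_inner_comm] at h3
    refine h3.congr' ?_
    filter_upwards [hr0, eventually_one_sub_pos] with r hr hr1
    rw [h.floatingIntegrand_mul hn hρ hC h0 hσ hy hr (by linarith)]
  -- Without second fundamental form the curvature is `0` by definition, and both integrands vanish
  -- because their exponents of the curvature are non-zero.
  · have hH0 := gaussKroneckerCurvature_eq_zero hA
    have hz : centroAffineIntegrand C y = 0 := by
      rw [centroAffineIntegrand, hH0, Real.zero_rpow (by norm_num), zero_div]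
    rw [hz]
    refine tendsto_const_nhds.congr' ?_
    filter_upwards [hr0] with r hr
    have hn1 : 1 / ((n : ℝ) + 1) ≠ 0 := by positivity
    rw [h.floatingIntegrand_smul hρ hy hr, hH0, mul_zero, Real.zero_rpow hn1]
    ring

/-- The integrals over `∂(rC)` are pulled back to the fixed set `∂C`, of finite measure, with the
factor `r^(n-1)`; dominated convergence applies there. -/
theorem HasRollingBall.floatingAreaLimit (hn : 1 ≤ n) (h : HasRollingBall C ρ)
    (hρ : 0 < ρ) (hC : IsConvexBody C) (h0 : (0 : 𝔼 n) ∈ interior C) (hσ : IsCovariantDensity σ) :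
    FloatingAreaLimit C (σ C) := by
  refine ⟨fun r hr hr1 => h.integrableOn_floatingIntegrand hn hρ hC h0 hσ hr hr1, ?_⟩
  have hn' : (1 : ℝ) ≤ n := by exact_mod_cast hn
  have h4 : 0 ≤ ((n : ℝ) - 1) / ((n : ℝ) + 1) := div_nonneg (by linarith) (by positivity)
  have hS : MeasurableSet (frontier C) := isClosed_frontier.measurableSet
  have hfin := euclideanHausdorffMeasure_frontier_lt_top hn hC h0
  obtain ⟨K, hK⟩ := h.exists_curvature_bound hρ hC h0
  obtain ⟨K', hK'⟩ := h.exists_density_bound hρ hC h0 hσ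
  have hr2 : ∀ᶠ r : ℝ in 𝓝[<] 1, 1 / 2 < r :=
    (eventually_gt_nhds (by norm_num)).filter_mono nhdsWithin_le_nhds
  have hlim := tendsto_integral_filter_of_dominated_convergence
    (μ := (Measure.euclideanHausdorffMeasure (n - 1) : Measure (𝔼 n)).restrict (frontier C))
    (l := 𝓝[<] (1 : ℝ)) (f := centroAffineIntegrand C)
    (F := fun (r : ℝ) (y : 𝔼 n) => (2 : ℝ) ^ (((n : ℝ) - 1) / 2) * (r ^ (n - 1) *
      (floatingIntegrand (σ C) (r • C) (r • y) * (1 - r) ^ (((n : ℝ) - 1) / 2))))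
    -- The bound follows the integrand factor by factor for `1/2 < r < 1`: `r ≤ 1`, `r⁻¹ ≤ 2`,
    -- curvature at most `K`, rescaled density at most `K'`.
    (fun _ => (2 : ℝ) ^ (((n : ℝ) - 1) / 2) * (1 ^ (n - 1) *
      ((2 ^ (n - 1) * K) ^ (1 / ((n : ℝ) + 1)) * K' ^ (((n : ℝ) - 1) / ((n : ℝ) + 1)))))
    ?_ ?_ ?_ ?_
  · refine hlim.congr' ?_
    filter_upwards [hr2] with r hr
    have hr0 : 0 < r := by linarith
    rw [floatingArea, frontier_smul_set hr0, setIntegral_smul_set (n - 1) hr0, integral_const_mul,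
      integral_const_mul, integral_mul_const, mul_assoc]
  · filter_upwards [hr2, eventually_one_sub_pos] with r hr hr1
    exact ((((h.aemeasurable_floatingIntegrand_smul hρ hC h0 hσ _ (by linarith)
      (by linarith)).mul_const _).const_mul _).const_mul _).aestronglyMeasurable
  · filter_upwards [hr2, eventually_one_sub_pos, hK'] with r hr hr1 hKr
    filter_upwards [ae_restrict_mem hS] with y hy
    have hr0 : 0 < r := by linarith
    have h1 := h.gaussKroneckerCurvature_nonneg hρ hy
    have h2 := hσ.nonneg C hC (r • y)
      (smul_mem_interior_of_mem hC.convex h0 (hC.isClosed.frontier_subset hy) hr0.le (by linarith))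
    have h3 := hKr y hy
    have h5 := hK y hy
    have h6 := h1.trans h5
    have h7 : r ≤ 1 := by linarith
    have h8 : r⁻¹ ≤ 2 := by
      rw [inv_le_comm₀ hr0 two_pos]; linarith
    rw [h.floatingIntegrand_mul hn hρ hC h0 hσ hy hr0 (by linarith),
      Real.norm_of_nonneg (by positivity)]
    gcongr
  · have : IsFiniteMeasure
        ((Measure.euclideanHausdorffMeasure (n - 1) : Measure (𝔼 n)).restrict (frontier C)) :=
      isFiniteMeasure_restrict.2 hfin.ne
    exact integrable_const _
  · filter_upwards [ae_restrict_mem hS] with y hy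
    exact h.tendsto_floatingIntegrand hn hρ hC h0 hσ hy

end Main

theorem mainTheorem5 (n : ℕ) (hn : 1 ≤ n) (C : Set (EuclideanSpace ℝ (Fin n)))
    (hC : IsConvexBody C) (h0 : (0 : EuclideanSpace ℝ (Fin n)) ∈ interior C)
    (hC11 : HasC11Boundary C) :
    IntegrableOn (centroAffineIntegrand C) (frontier C)
      (Measure.euclideanHausdorffMeasure (n - 1) : Measure (EuclideanSpace ℝ (Fin n))) ∧
    FloatingAreaLimit C (busemannDensity C) ∧
    FloatingAreaLimit C (holmesThompsonDensity C) ∧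
    ∀ (vol : Set (EuclideanSpace ℝ (Fin n)) → Measure (EuclideanSpace ℝ (Fin n)))
      (σ : Set (EuclideanSpace ℝ (Fin n)) → EuclideanSpace ℝ (Fin n) → ℝ),
      IsHilbertVolume vol σ → FloatingAreaLimit C (σ C) := by
  obtain ⟨ρ, hρ, h⟩ := hC11.exists_rollingBall hC
  exact ⟨h.integrableOn_centroAffineIntegrand hn hρ hC h0,
    h.floatingAreaLimit hn hρ hC h0 isCovariantDensity_busemannDensity,
    h.floatingAreaLimit hn hρ hC h0 isCovariantDensity_holmesThompsonDensity,
    fun vol σ hvol => h.floatingAreaLimit hn hρ hC h0 hvol.isCovariantDensity⟩
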